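/- All rings are commutative and Noetherian. Let $S$ be a Cohen–Macaulay ring that is either local, or standard graded over a field $k$ (i.e. $S=\bigoplus_{i\ge 0}S_i$ with $S_0=k$ and $S=k[S_1]$), and let $m\ge 1$ be an integer. Let $I$ be a proper ideal of $S$, and put $c=\operatorname{ht} I$. Assume that $I$ is unmixed, i.e. every associated prime of $S/I$ has height $c$, and that $I$ is generically a complete intersection, i.e. for every associated prime $p$ of $S/I$ the ideal $I_p$ is generated by an $S_p$-regular sequence. Let $I^{(m)}=\bigcap_{p\in \operatorname{Ass}(S/I)}(I^m S_p\cap S)$ be the $m$-th symbolic power of $I$, and let $J\subseteq I^{(m)}$ be an ideal with $\operatorname{ht} J=c$; in the graded case assume that $I$ and $J$ are homogeneous. Let $J^{\mathrm{unm}}$ be the intersection of the primary components of $J$ at those minimal primes of $J$ that have height $c$. For a proper ideal $L$ of $S$ (homogeneous in the graded case), let $d=\dim S/L$ and let $e(S/L)$ be the multiplicity of the ring $S/L$: in the local case, with $\mathfrak m$ the maximal ideal of $S$ and $\lambda$ denoting length, $$e(S/L)=\lim_{t\to\infty}\frac{d!}{t^d}\,\lambda\bigl(S/(L+\mathfrak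 m^t)\bigr),$$ and in the graded case $$e(S/L)=\lim_{t\to\infty}\frac{(d-1)!}{t^{d-1}}\dim_k [S/L]_t \ \text{ if } d\ge 1,\qquad e(S/L)=\dim_k S/L\ \text{ if } d=0.$$ Then the following assertions are equivalent: (i) $I^{(m)}=J^{\mathrm{unm}}$; (ii) $e(S/J)=e(S/I)\binom{c+m-1}{c}$. -/

import Mathlib

open Filter Topology

noncomputable section

/-! ### Cohen–Macaulay rings -/

/-- The depth of a local ring: the supremum of the lengths of the regular sequences contained
in its maximal ideal. -/
def localDepth (R : Type*) [CommRing R] [IsLocalRing R] : ℕ∞ :=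
  ⨆ (rs : List R) (_ : RingTheory.Sequence.IsRegular R rs ∧
    ∀ r ∈ rs, r ∈ IsLocalRing.maximalIdeal R), (rs.length : ℕ∞)

/-- A ring is Cohen–Macaulay if it is Noetherian and each of its local rings has depth equal to
its Krull dimension. -/
structure IsCohenMacaulayRing (R : Type*) [CommRing R] : Prop where
  isNoetherianRing : IsNoetherianRing R
  depth_eq_dim : ∀ (p : Ideal R) [p.IsPrime],
    (localDepth (Localization.AtPrime p) : WithBot ℕ∞) = ringKrullDim (Localization.AtPrime p)

/-! ### Unmixed ideals, symbolic powers -/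

section Ideals

variable {S : Type*} [CommRing S]

/-- `I` is unmixed: all associated primes of `S ⧸ I` have height `ht I`. -/
def IsUnmixedIdeal (I : Ideal S) : Prop :=
  ∀ p ∈ associatedPrimes S (S ⧸ I), p.height = I.height

/-- `I` is generically a complete intersection: for each associated prime `p` of `S ⧸ I`, the
localization `I_p` is generated by an `S_p`-regular sequence. -/
def IsGenericallyCI (I : Ideal S) : Prop :=
  ∀ (p : Ideal S) [p.IsPrime], p ∈ associatedPrimes S (S ⧸ I) →
    ∃ rs : List (Localization.AtPrime p),
      RingTheory.Sequence.IsRegular (Localization.AtPrime p) rs ∧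
        I.map (algebraMap S (Localization.AtPrime p)) = Ideal.ofList rs

/-- `I_p ∩ S`, the contraction to `S` of the localization of `I` at the prime `p`. If `p` is a
minimal prime of `I` (and `S` is Noetherian), this is the `p`-primary component of `I`. -/
def contractedLocalization (I p : Ideal S) [p.IsPrime] : Ideal S :=
  (I.map (algebraMap S (Localization.AtPrime p))).comap (algebraMap S (Localization.AtPrime p))

/-- The symbolic power `I^(m)`: the intersection of the ideals `(I ^ m)_p ∩ S` over all associated
primes `p` of `S ⧸ I`. -/
def symbolicPower (I : Ideal S) (m : ℕ) : Ideal S :=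
  ⨅ (p : Ideal S) (_ : p.IsPrime) (_ : p ∈ associatedPrimes S (S ⧸ I)),
    contractedLocalization (I ^ m) p

/-- The unmixed part `J^unm`: the intersection of the primary components of `J` at those minimal
primes of `J` that have the minimal possible height, `ht J`. -/
def unmixedPart (J : Ideal S) : Ideal S :=
  ⨅ (p : Ideal S) (_ : p.IsPrime) (_ : p ∈ J.minimalPrimes ∧ p.height = J.height),
    contractedLocalization J p

end Ideals

/-! ### Multiplicities -/

/-- The Krull dimension as a natural number (for a nonzero ring of finite dimension). -/
def natKrullDim (R : Type*) [CommRing R] : ℕ := ((ringKrullDim R).unbotD 0).toNat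

/-- The Hilbert–Samuel multiplicity `lim (d! / t ^ d) * length (R / 𝔪 ^ t)`, `d = dim R`, where `𝔪`
is the maximal ideal of the local ring `R`. (The limit exists when `R` is Noetherian.) -/
def hilbertSamuelMultiplicity {R : Type*} [CommRing R] (𝔪 : Ideal R) : ℝ :=
  lim (map (fun t : ℕ => ((natKrullDim R).factorial : ℝ) / (t : ℝ) ^ natKrullDim R *
    ((Module.length R (R ⧸ 𝔪 ^ t)).toNat : ℝ)) atTop)

/-- The multiplicity `e(S/J)` of the local ring `S ⧸ J`, for a proper ideal `J` of a local ring
`S`. The maximal ideal of `S ⧸ J` is the image of that of `S`. -/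
def localMultiplicity {S : Type*} [CommRing S] [IsLocalRing S] (J : Ideal S) : ℝ :=
  hilbertSamuelMultiplicity ((IsLocalRing.maximalIdeal S).map (Ideal.Quotient.mk J))

section Graded

variable {k S : Type*} [Field k] [CommRing S] [Algebra k S]

/-- A graded `k`-algebra `S = ⨁ S_i` is standard graded if `S_0 = k` and `S` is generated by `S_1`
as a `k`-algebra. -/
structure IsStandardGraded (𝒜 : ℕ → Submodule k S) [GradedAlgebra 𝒜] : Prop where
  zero_eq : 𝒜 0 = 1
  adjoin_eq : Algebra.adjoin k (𝒜 1 : Set S) = ⊤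

/-- The Hilbert function `t ↦ dim_k [S ⧸ J]_t`, for a homogeneous ideal `J`. -/
def hilbertFunction (𝒜 : ℕ → Submodule k S) (J : Ideal S) (t : ℕ) : ℕ :=
  Module.finrank k ((𝒜 t).map (Ideal.Quotient.mkₐ k J).toLinearMap)

/-- The multiplicity `e(S/J)` of the standard graded algebra `S ⧸ J`, for a homogeneous ideal `J`:
with `d = dim S ⧸ J`, it is `lim ((d - 1)! / t ^ (d - 1)) * dim_k [S ⧸ J]_t` if `d > 0`, and
`dim_k (S ⧸ J)` if `d = 0`. (The limit exists when `S` is Noetherian.) -/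
def gradedMultiplicity (𝒜 : ℕ → Submodule k S) (J : Ideal S) : ℝ :=
  if natKrullDim (S ⧸ J) = 0 then (Module.finrank k (S ⧸ J) : ℝ)
  else lim (map (fun t : ℕ => ((natKrullDim (S ⧸ J) - 1).factorial : ℝ) /
    (t : ℝ) ^ (natKrullDim (S ⧸ J) - 1) * (hilbertFunction 𝒜 J t : ℝ)) atTop)

end Graded

end

/-! # Symbolic powers and multiplicities

Let `𝔪` be the maximal ideal of the local ring, or the irrelevant ideal of the standard graded
algebra `S`, and write `e(M)` for the limit of `length (M / 𝔪 ^ t M) / t ^ d`, where `d + c` is the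
height of `𝔪`.

The theorem rests on the associativity formula `hasNormalizedMultiplicity_sum`:
`e(M) = ∑ length (M_p) * e(S ⧸ p)`, summed over the primes `p ≤ 𝔪` of height `c` in the support of
`M`. In a Cohen–Macaulay ring `(S ⧸ p)_𝔪` has dimension `d` for each of these
(`IsCohenMacaulayRing.exists_ltSeries`), so that all the numbers `e(S ⧸ p)` are positive. Apply this
to `S ⧸ I` and `S ⧸ J`. For each such `p` containing `I`, the ideal `I_p` is generated by a regular
sequence of length `c`, hence `length (S_p / I_p ^ m) = length (S_p / I_p) * (c + m - 1).choose c`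
(`length_quotient_sup_ofList_pow`), while `J_p ≤ I_p ^ m` gives
`length (S_p / I_p ^ m) ≤ length (S_p / J_p)`, with equality if and only if `J_p = I_p ^ m`. Therefore
`e(S ⧸ I) * (c + m - 1).choose c ≤ e(S ⧸ J)`, with equality if and only if `J_p = I_p ^ m` for all
these `p`. As `I` is unmixed, the latter means that the ideals `symbolicPower I m` and
`unmixedPart J`, both intersections of contractions from the localizations at primes of height `c`,
agree (`symbolicPower_eq_unmixedPart_iff`).

The limits exist because Hilbert–Samuel functions are eventually polynomial
(`exists_polynomial_hilbertSamuelFunction`). This is the Hilbert–Serre argument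
(`exists_polynomial_length_of_stableFamiliesACC`), with Noetherianity of the associated graded module
phrased as a chain condition on families of submodules that are stable under multiplication by
generators of `𝔪`.

It remains to identify `d ! * e(S ⧸ L)` with the multiplicities of the statement, for `L = I, J`.
This needs `dim (S ⧸ L) = d`. In the local case that is the dimension formula above. In the graded
case a chain of primes above `L` may end at a maximal ideal `𝔫` other than `𝔪`; since the elements of
`S` of degree at most a linear function of `t` span `S` modulo `𝔫 ^ t`, the growth of the
Hilbert–Samuel function at `𝔫` is controlled by that at `𝔪`
(`IsStandardGraded.hilbertSamuelBounded`), which bounds the lengths of such chains. Finally the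
Hilbert function of `S ⧸ L` is the difference function of its Hilbert–Samuel function at `𝔪`
(`IsStandardGraded.hilbertSamuelFunction_succ`). -/

noncomputable section

/-! ### Eventually polynomial sequences -/

open Polynomial in
/-- Every real polynomial is the forward difference of a polynomial; Bernoulli polynomials give the
monomials. -/
theorem Polynomial.exists_forward_difference_eq (Q : ℝ[X]) :
    ∃ P : ℝ[X], ∀ x : ℝ, P.eval (x + 1) - P.eval x = Q.eval x := by
  induction Q using Polynomial.induction_on' with
  | add p q hp hq =>
    obtain ⟨P, hP⟩ := hp
    obtain ⟨P', hP'⟩ := hq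
    exact ⟨P + P', fun x => by rw [eval_add, eval_add, eval_add, ← hP, ← hP']; ring⟩
  | monomial n a =>
    refine ⟨C (a / (n + 1)) * (bernoulli (n + 1)).map (algebraMap ℚ ℝ), fun x => ?_⟩
    have h := congrArg (fun P : ℚ[X] => (P.map (algebraMap ℚ ℝ)).eval x)
      (bernoulli_comp_one_add_X (n + 1))
    simp only [Polynomial.map_comp, eval_comp, Polynomial.map_add, Polynomial.map_one,
      Polynomial.map_X, eval_add, eval_one, eval_X,
      Polynomial.map_pow, eval_pow, Nat.add_sub_cancel, nsmul_eq_mul, Polynomial.map_mul,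
      Polynomial.map_natCast, eval_mul, eval_natCast] at h
    simp only [eval_mul, eval_C, eval_monomial]
    rw [add_comm x 1, h]
    have : (n : ℝ) + 1 ≠ 0 := by positivity
    push_cast
    field_simp
    ring

open Polynomial in
theorem exists_polynomial_of_difference {f : ℕ → ℝ} {Q : ℝ[X]}
    (h : ∀ᶠ t : ℕ in atTop, f (t + 1) - f t = Q.eval (t : ℝ)) :
    ∃ P : ℝ[X], ∀ᶠ t : ℕ in atTop, f t = P.eval (t : ℝ) := by
  obtain ⟨P, hP⟩ := Q.exists_forward_difference_eq
  obtain ⟨t₀, ht₀⟩ := eventually_atTop.1 h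
  refine ⟨P + C (f t₀ - P.eval (t₀ : ℝ)), eventually_atTop.2 ⟨t₀, fun t ht => ?_⟩⟩
  induction t, ht using Nat.le_induction with
  | base => simp
  | succ t ht ih =>
    have h1 := ht₀ t ht
    have h2 := hP (t : ℝ)
    rw [eval_add, eval_C] at ih ⊢
    push_cast
    linarith

/-! ### Lengths of graded families of modules -/

section HilbertSerre

variable {R : Type*} [CommRing R]

theorem Module.toNat_length_eq_add_of_exact {M N P : Type*} [AddCommGroup M] [AddCommGroup N]
    [AddCommGroup P] [Module R M] [Module R N] [Module R P] {f : N →ₗ[R] M} {g : M →ₗ[R] P}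
    (hf : Function.Injective f) (hg : Function.Surjective g) (H : Function.Exact f g)
    (hM : Module.length R M ≠ ⊤) :
    (Module.length R M).toNat = (Module.length R N).toNat + (Module.length R P).toNat := by
  have h := Module.length_eq_add_of_exact f g hf hg H
  rw [h] at hM ⊢
  exact ENat.toNat_add (fun h => hM (by simp [h])) (fun h => hM (by simp [h]))

/-- The ascending chain condition for the families of submodules `N t ≤ M t` of a sequence of
modules that are stable under given operators `M t → M (t + 1)`. This is the graded
form of Noetherianity of `⨁ t, M t` over the polynomial ring acting through the operators. -/
def StableFamiliesACC {ι : Type*} (M : ℕ → Type*) [∀ t, AddCommGroup (M t)]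
    [∀ t, Module R (M t)] (x : ι → ∀ t, M t →ₗ[R] M (t + 1)) : Prop :=
  ∀ N : ℕ → ∀ t, Submodule R (M t), Monotone N →
    (∀ s t i, N s t ≤ (N s (t + 1)).comap (x i t)) → ∃ s₀, ∀ s ≥ s₀, N s = N s₀

/-- The Hilbert–Serre theorem: for a sequence of modules of finite length with finitely many
commuting operators of degree one and the ascending chain condition on stable families,
the length is eventually polynomial. Both the kernel and the cokernel of the last operator are
killed by it, so that the induction on the number of operators applies to them. -/
theorem exists_polynomial_length_of_stableFamiliesACC (n : ℕ) :
    ∀ (M : ℕ → Type*) [∀ t, AddCommGroup (M t)] [∀ t, Module R (M t)]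
      (x : Fin n → ∀ t, M t →ₗ[R] M (t + 1)),
      (∀ i j t m, x i (t + 1) (x j t m) = x j (t + 1) (x i t m)) →
      (∀ t, Module.length R (M t) ≠ ⊤) → StableFamiliesACC M x →
      ∃ P : Polynomial ℝ, ∀ᶠ t : ℕ in atTop,
        ((Module.length R (M t)).toNat : ℝ) = P.eval (t : ℝ) := by
  induction n with
  | zero =>
    intro M _ _ x _ _ hacc
    obtain ⟨s₀, hs₀⟩ := hacc (fun s t => if t < s then ⊤ else ⊥)
      (fun a b hab t => by
        dsimp only
        split_ifs with h1 h2
        · exact le_rfl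
        · omega
        · exact bot_le
        · exact le_rfl) (fun _ _ i => i.elim0)
    refine ⟨0, eventually_atTop.2 ⟨s₀, fun t ht => ?_⟩⟩
    have h := congrFun (hs₀ (t + 1) (by omega)) t
    simp only [Nat.lt_succ_self, if_true, not_lt.2 ht, if_false] at h
    have : Subsingleton (M t) := (Submodule.subsingleton_iff R).1 (subsingleton_of_bot_eq_top h.symm)
    simp
  | succ n ih =>
    intro M _ _ x hx hlen hacc
    set y : ∀ t, M t →ₗ[R] M (t + 1) := x (Fin.last n) with hy
    -- the kernel of the last operator
    let K : ℕ → Type _ := fun t => LinearMap.ker (y t)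
    let xK : Fin n → ∀ t, K t →ₗ[R] K (t + 1) := fun i t =>
      (x i.castSucc t).restrict (fun m hm => by
        rw [LinearMap.mem_ker] at hm ⊢
        rw [hy, hx, ← hy, hm, map_zero])
    -- the cokernel of the last operator, shifted by one
    let C : ℕ → Type _ := fun t => M (t + 1) ⧸ LinearMap.range (y t)
    let xC : Fin n → ∀ t, C t →ₗ[R] C (t + 1) := fun i t =>
      Submodule.mapQ _ _ (x i.castSucc (t + 1)) (by
        rintro _ ⟨m, rfl⟩
        exact ⟨x i.castSucc t m, by rw [hy, hx]⟩)
    have hKlen : ∀ t, Module.length R (K t) ≠ ⊤ := fun t =>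
      ne_top_of_le_ne_top (hlen t)
        (Module.length_le_of_injective (Submodule.subtype _) (Submodule.subtype_injective _))
    have hClen : ∀ t, Module.length R (C t) ≠ ⊤ := fun t =>
      ne_top_of_le_ne_top (hlen (t + 1))
        (Module.length_le_of_surjective (Submodule.mkQ _) (Submodule.mkQ_surjective _))
    obtain ⟨PK, hPK⟩ := ih K xK (fun i j t m => Subtype.ext (hx _ _ _ _)) hKlen (by
      intro N hN hst
      obtain ⟨s₀, hs₀⟩ := hacc (fun s t => (N s t).map (Submodule.subtype _))
        (fun a b hab t => Submodule.map_mono (hN hab t)) (by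
          rintro s t i _ ⟨m, hm, rfl⟩
          refine Fin.lastCases ?_ (fun j => ?_) i
          · have hm0 : x (Fin.last n) t m.1 = 0 := m.2
            change x (Fin.last n) t m.1 ∈ (N s (t + 1)).map (Submodule.subtype _)
            rw [hm0]
            exact Submodule.zero_mem _
          · exact ⟨xK j t m, hst s t j hm, rfl⟩)
      exact ⟨s₀, fun s hs => funext fun t =>
        Submodule.map_injective_of_injective (Submodule.subtype_injective _)
          (congrFun (hs₀ s hs) t)⟩)
    obtain ⟨PC, hPC⟩ := ih C xC (fun i j t m => by
      obtain ⟨m, rfl⟩ := Submodule.mkQ_surjective _ m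
      exact congrArg (Submodule.mkQ _) (hx _ _ _ _)) hClen (by
      intro N hN hst
      let N' : ℕ → ∀ t, Submodule R (M t) := fun s t =>
        match t with
        | 0 => ⊥
        | t + 1 => (N s t).comap (Submodule.mkQ _)
      obtain ⟨s₀, hs₀⟩ := hacc N'
        (fun a b hab t => by
          cases t with
          | zero => exact le_rfl
          | succ t => exact Submodule.comap_mono (hN hab t)) (by
          intro s t i
          cases t with
          | zero => exact bot_le
          | succ t =>
            intro m hm
            refine Fin.lastCases ?_ (fun j => ?_) i
            · change Submodule.mkQ _ (y (t + 1) m) ∈ N s (t + 1)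
              rw [show Submodule.mkQ (LinearMap.range (y (t + 1))) (y (t + 1) m) = 0 from
                (Submodule.Quotient.mk_eq_zero _).2 ⟨m, rfl⟩]
              exact Submodule.zero_mem _
            · exact hst s t j hm)
      exact ⟨s₀, fun s hs => funext fun t =>
        Submodule.comap_injective_of_surjective (Submodule.mkQ_surjective _)
          (congrFun (hs₀ s hs) (t + 1))⟩)
    refine exists_polynomial_of_difference (Q := PC - PK) ?_
    filter_upwards [hPK, hPC] with t h1 h2
    rw [Polynomial.eval_sub, ← h1, ← h2]
    have e1 := Module.toNat_length_eq_add_of_exact (Submodule.subtype_injective _)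
      (LinearMap.surjective_rangeRestrict (y t)) (f := (LinearMap.ker (y t)).subtype) (by
        rw [LinearMap.exact_iff, LinearMap.ker_rangeRestrict, Submodule.range_subtype]) (hlen t)
    have e2 := Module.toNat_length_eq_add_of_exact (f := (LinearMap.range (y t)).subtype)
      (Submodule.subtype_injective _) (Submodule.mkQ_surjective (LinearMap.range (y t)))
      (LinearMap.exact_subtype_mkQ _) (hlen (t + 1))
    rw [e1, e2]
    push_cast
    ring

end HilbertSerre

/-! ### The Hilbert–Samuel function -/

section HilbertSamuel

variable {R : Type*} [CommRing R]

/-- The Hilbert–Samuel function `t ↦ length (M / I ^ t M)`, as a natural number; it is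
meaningful when these lengths are finite, e.g. for finite modules over a Noetherian ring
and a maximal ideal `I`. -/
def hilbertSamuelFunction (I : Ideal R) (M : Type*) [AddCommGroup M] [Module R M] (t : ℕ) : ℕ :=
  (Module.length R (M ⧸ (I ^ t • ⊤ : Submodule R M))).toNat

theorem Module.length_ne_top_of_pow_smul_eq_zero [IsNoetherianRing R] {I : Ideal R}
    (hI : I.IsMaximal) (t : ℕ) (M : Type*) [AddCommGroup M] [Module R M] (hM : Module.Finite R M)
    (h : ∀ a ∈ I ^ t, ∀ x : M, a • x = 0) : Module.length R M ≠ ⊤ := by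
  revert h
  induction hM using IsNoetherianRing.induction_on_isQuotientEquivQuotientPrime R with
  | subsingleton N => intro _; simp
  | quotient N p e =>
    intro h
    have hle : I ^ t ≤ p.1 := fun a ha => by
      have h1 := h a ha (e.symm 1)
      rw [← map_smul, LinearEquiv.map_eq_zero_iff] at h1
      rw [← Ideal.Quotient.eq_zero_iff_mem, ← h1, Algebra.smul_def, mul_one]
      rfl
    have hp : I = p.1 := hI.eq_of_le p.2.ne_top (p.2.le_of_pow_le hle)
    have : IsSimpleModule R (R ⧸ p.1) := by
      rw [← hp]
      exact isSimpleModule_iff_isCoatom.2 hI.out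
    rw [e.length_eq, Module.length_eq_one]
    exact ENat.one_ne_top
  | exact N₁ N₂ N₃ f g hf hg hfg h₁ h₃ =>
    intro h
    rw [Module.length_eq_add_of_exact f g hf hg hfg]
    refine WithTop.add_ne_top.2 ⟨h₁ fun a ha x => hf ?_, h₃ fun a ha x => ?_⟩
    · rw [map_smul, h a ha, map_zero]
    · obtain ⟨x, rfl⟩ := hg x
      rw [← map_smul, h a ha, map_zero]

theorem Module.length_quotient_pow_smul_ne_top [IsNoetherianRing R] {I : Ideal R}
    (hI : I.IsMaximal) (M : Type*) [AddCommGroup M] [Module R M] [Module.Finite R M] (t : ℕ) :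
    Module.length R (M ⧸ (I ^ t • ⊤ : Submodule R M)) ≠ ⊤ := by
  refine Module.length_ne_top_of_pow_smul_eq_zero hI t _ inferInstance fun a ha x => ?_
  obtain ⟨x, rfl⟩ := Submodule.mkQ_surjective _ x
  rw [← map_smul]
  exact (Submodule.Quotient.mk_eq_zero _).2 (Submodule.smul_mem_smul ha trivial)

/-- The component of degree `t` of the associated graded module of `M` with respect to `I`. -/
abbrev GradedPiece (I : Ideal R) (M : Type*) [AddCommGroup M] [Module R M] (t : ℕ) : Type _ :=
  ↥(I ^ t • ⊤ : Submodule R M) ⧸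
    (I ^ (t + 1) • ⊤ : Submodule R M).comap (I ^ t • ⊤ : Submodule R M).subtype

theorem smul_mem_pow_succ_smul {I : Ideal R} {M : Type*} [AddCommGroup M] [Module R M] {a : R}
    (ha : a ∈ I) {t : ℕ} {N : Submodule R M} {m : M} (hm : m ∈ I ^ t • N) :
    a • m ∈ I ^ (t + 1) • N := by
  rw [pow_succ', ← smul_eq_mul, Submodule.smul_assoc]
  exact Submodule.smul_mem_smul ha hm

/-- Multiplication by an element of `I`, as an operator of degree one on the associated graded
module. -/
def gradedPieceSmul {I : Ideal R} (M : Type*) [AddCommGroup M] [Module R M] (a : R) (ha : a ∈ I)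
    (t : ℕ) : GradedPiece I M t →ₗ[R] GradedPiece I M (t + 1) :=
  Submodule.mapQ _ _
    ((LinearMap.lsmul R M a).restrict (p := I ^ t • ⊤) (q := I ^ (t + 1) • ⊤)
      (fun _ hm => smul_mem_pow_succ_smul ha hm))
    (fun _ hm => smul_mem_pow_succ_smul ha hm)

/-- The chain condition for the associated graded module: a stable family of submodules of
`I ^ t M / I ^ (t + 1) M` pulls back to an `I`-filtration of `M`, hence to a submodule of the
Noetherian module `⨁ I ^ t M` over the Rees algebra. -/
theorem stableFamiliesACC_gradedPiece [IsNoetherianRing R] {I : Ideal R} (M : Type*)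
    [AddCommGroup M] [Module R M] [Module.Finite R M] {ι : Type*} (x : ι → R)
    (hx : Ideal.span (Set.range x) = I) :
    StableFamiliesACC (GradedPiece I M)
      (fun i => gradedPieceSmul M (x i) (hx ▸ Ideal.subset_span ⟨i, rfl⟩)) := by
  intro N hN hst
  let L : ℕ → ℕ → Submodule R M := fun s t =>
    ((N s t).comap (Submodule.mkQ _)).map (Submodule.subtype _)
  have hLmem : ∀ s t m, m ∈ L s t ↔
      ∃ h : m ∈ (I ^ t • ⊤ : Submodule R M), Submodule.mkQ _ ⟨m, h⟩ ∈ N s t := by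
    intro s t m
    constructor
    · rintro ⟨m, hm, rfl⟩
      exact ⟨m.2, hm⟩
    · rintro ⟨h, hm⟩
      exact ⟨⟨m, h⟩, hm, rfl⟩
  let F : ℕ → I.Filtration M := fun s =>
    { N := L s
      mono := fun t m hm => by
        obtain ⟨h, -⟩ := (hLmem _ _ _).1 hm
        refine (hLmem _ _ _).2
          ⟨Submodule.smul_mono_left (Ideal.pow_le_pow_right (Nat.le_succ t)) h, ?_⟩
        rw [show Submodule.mkQ ((I ^ (t + 1) • ⊤ : Submodule R M).comap
            (I ^ t • ⊤ : Submodule R M).subtype) ⟨m, _⟩ = 0 from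
            (Submodule.Quotient.mk_eq_zero _).2 h]
        exact Submodule.zero_mem _
      smul_le := fun t => Submodule.smul_le.2 fun a ha m hm => by
        rw [← hx] at ha
        induction ha using Submodule.span_induction with
        | mem a ha =>
          obtain ⟨i, rfl⟩ := ha
          obtain ⟨h, h'⟩ := (hLmem _ _ _).1 hm
          exact (hLmem _ _ _).2 ⟨smul_mem_pow_succ_smul (hx ▸ Ideal.subset_span ⟨i, rfl⟩) h,
            hst s t i h'⟩
        | zero => rw [zero_smul]; exact Submodule.zero_mem _
        | add a b _ _ iha ihb => rw [add_smul]; exact Submodule.add_mem _ iha ihb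
        | smul r a _ iha => rw [smul_assoc]; exact Submodule.smul_mem _ _ iha }
  have hnoeth : IsNoetherian (reesAlgebra I) (I.stableFiltration (⊤ : Submodule R M)).submodule :=
    isNoetherian_of_fg_of_noetherian _
      ((Ideal.Filtration.submodule_fg_iff_stable _
        (fun i => IsNoetherian.noetherian _)).2 (I.stableFiltration_stable ⊤))
  have hle : ∀ s, (F s).submodule ≤ (I.stableFiltration (⊤ : Submodule R M)).submodule :=
    fun s f hf i => ((hLmem _ _ _).1 (hf i)).1
  obtain ⟨s₀, hs₀⟩ := monotone_stabilizes_iff_noetherian.2 hnoeth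
    ⟨fun s => (F s).submodule.comap (Submodule.subtype _), fun a b hab =>
      Submodule.comap_mono fun f hf i => by
        obtain ⟨h, h'⟩ := (hLmem _ _ _).1 (hf i)
        exact (hLmem _ _ _).2 ⟨h, hN hab i h'⟩⟩
  refine ⟨s₀, fun s hs => funext fun t => le_antisymm ?_ (hN hs t)⟩
  intro q hq
  obtain ⟨⟨m, hm⟩, rfl⟩ := Submodule.mkQ_surjective _ q
  have hmL : m ∈ L s t := (hLmem _ _ _).2 ⟨hm, hq⟩
  have hsingle : PolynomialModule.single R t m ∈ (F s).submodule := by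
    intro i
    rw [PolynomialModule.coeff_single, Finsupp.single_apply]
    split_ifs with h
    · exact h ▸ hmL
    · exact Submodule.zero_mem _
  have h3 : PolynomialModule.single R t m ∈ (F s₀).submodule :=
    (SetLike.ext_iff.1 (hs₀ s hs) ⟨_, hle s hsingle⟩).2 hsingle
  have h4 := h3 t
  rw [PolynomialModule.coeff_single, Finsupp.single_eq_same] at h4
  exact ((hLmem _ _ _).1 h4).2

/-- `0 → I ^ t M / I ^ (t + 1) M → M / I ^ (t + 1) M → M / I ^ t M → 0` is exact. -/
theorem Module.length_quotient_pow_succ_smul (I : Ideal R) (M : Type*) [AddCommGroup M]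
    [Module R M] (t : ℕ) :
    Module.length R (M ⧸ (I ^ (t + 1) • ⊤ : Submodule R M)) =
      Module.length R (GradedPiece I M t) +
        Module.length R (M ⧸ (I ^ t • ⊤ : Submodule R M)) := by
  have hle : (I ^ (t + 1) • ⊤ : Submodule R M) ≤ I ^ t • ⊤ :=
    Submodule.smul_mono_left (Ideal.pow_le_pow_right (Nat.le_succ t))
  refine Module.length_eq_add_of_exact
    (Submodule.mapQ _ _ (Submodule.subtype _) le_rfl)
    (Submodule.factor hle) ?_ (Submodule.factor_surjective hle) ?_
  · rw [← LinearMap.ker_eq_bot]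
    exact Submodule.ker_liftQ_eq_bot _ _ _ (by
      rw [LinearMap.ker_comp, Submodule.ker_mkQ])
  · intro q
    obtain ⟨m, rfl⟩ := Submodule.mkQ_surjective _ q
    rw [show Submodule.factor hle (Submodule.mkQ _ m) = Submodule.mkQ _ m from rfl]
    constructor
    · intro h
      exact ⟨Submodule.mkQ _ ⟨m, (Submodule.Quotient.mk_eq_zero _).1 h⟩, rfl⟩
    · rintro ⟨q', hq'⟩
      obtain ⟨m', rfl⟩ := Submodule.mkQ_surjective _ q'
      have h : m'.1 - m ∈ (I ^ (t + 1) • ⊤ : Submodule R M) :=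
        (Submodule.Quotient.eq _).1 hq'
      refine (Submodule.Quotient.mk_eq_zero _).2 ?_
      have := Submodule.sub_mem _ m'.2 (hle h)
      rwa [sub_sub_cancel] at this

/-- The Hilbert–Samuel function of a finite module is eventually polynomial. -/
theorem exists_polynomial_hilbertSamuelFunction [IsNoetherianRing R] {I : Ideal R}
    (hI : I.IsMaximal) (M : Type*) [AddCommGroup M] [Module R M] [Module.Finite R M] :
    ∃ P : Polynomial ℝ, ∀ᶠ t : ℕ in atTop,
      (hilbertSamuelFunction I M t : ℝ) = P.eval (t : ℝ) := by
  obtain ⟨n, x, hx⟩ := Submodule.fg_iff_exists_fin_generating_family.1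
    (IsNoetherian.noetherian I)
  have hne := Module.length_quotient_pow_smul_ne_top hI M
  have hadd := Module.length_quotient_pow_succ_smul I M
  have hlen : ∀ t, Module.length R (GradedPiece I M t) ≠ ⊤ := fun t h =>
    hne (t + 1) (by rw [hadd, h, top_add])
  obtain ⟨Q, hQ⟩ := exists_polynomial_length_of_stableFamiliesACC n (GradedPiece I M)
    (fun i => gradedPieceSmul M (x i) (hx ▸ Ideal.subset_span ⟨i, rfl⟩))
    (fun i j t m => by
      obtain ⟨⟨m, hm⟩, rfl⟩ := Submodule.mkQ_surjective _ m
      exact congrArg (Submodule.mkQ _) (Subtype.ext (smul_comm _ _ _)))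
    hlen (stableFamiliesACC_gradedPiece M x hx)
  refine exists_polynomial_of_difference (Q := Q) ?_
  filter_upwards [hQ] with t ht
  rw [hilbertSamuelFunction, hilbertSamuelFunction, hadd, ENat.toNat_add (hlen t) (hne t), ← ht]
  push_cast
  ring

/-! ### Exact sequences -/

section Exact

variable {M N P : Type*} [AddCommGroup M] [AddCommGroup N] [AddCommGroup P] [Module R M]
  [Module R N] [Module R P] {f : N →ₗ[R] M} {g : M →ₗ[R] P}

/-- The Hilbert–Samuel function in a short exact sequence `0 → N → M → P → 0`: the
difference for `M` and `P` is the length of `N` modulo the induced filtration. -/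
theorem hilbertSamuelFunction_eq_add_of_exact [IsNoetherianRing R] [Module.Finite R M]
    {I : Ideal R} (hI : I.IsMaximal) (hg : Function.Surjective g) (H : Function.Exact f g)
    (t : ℕ) :
    hilbertSamuelFunction I M t =
      (Module.length R (N ⧸ (I ^ t • ⊤ : Submodule R M).comap f)).toNat +
        hilbertSamuelFunction I P t := by
  have hmap : (I ^ t • ⊤ : Submodule R M).map g = I ^ t • ⊤ := by
    rw [Submodule.map_smul'', Submodule.map_top, LinearMap.range_eq_top.2 hg]
  have hle : (I ^ t • ⊤ : Submodule R M) ≤ (I ^ t • ⊤ : Submodule R P).comap g :=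
    Submodule.map_le_iff_le_comap.1 hmap.le
  refine Module.toNat_length_eq_add_of_exact (f := Submodule.mapQ _ _ f le_rfl)
    (g := Submodule.mapQ _ _ g hle) ?_ ?_ ?_ (Module.length_quotient_pow_smul_ne_top hI M t)
  · rw [← LinearMap.ker_eq_bot]
    exact Submodule.ker_liftQ_eq_bot _ _ _ (by rw [LinearMap.ker_comp, Submodule.ker_mkQ])
  · intro q
    obtain ⟨p, rfl⟩ := Submodule.mkQ_surjective _ q
    obtain ⟨m, rfl⟩ := hg p
    exact ⟨Submodule.mkQ _ m, rfl⟩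
  · intro q
    obtain ⟨m, rfl⟩ := Submodule.mkQ_surjective _ q
    constructor
    · intro h
      have h' : g m ∈ (I ^ t • ⊤ : Submodule R P) := (Submodule.Quotient.mk_eq_zero _).1 h
      rw [← hmap] at h'
      obtain ⟨m', hm', e⟩ := h'
      obtain ⟨n, hn⟩ := (H (m - m')).1 (by rw [map_sub, e, sub_self])
      refine ⟨Submodule.mkQ _ n, (Submodule.Quotient.eq _).2 ?_⟩
      rw [hn, sub_sub_cancel_left]
      exact Submodule.neg_mem _ hm'
    · rintro ⟨q', hq'⟩
      obtain ⟨n, rfl⟩ := Submodule.mkQ_surjective _ q'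
      rw [← hq']
      refine (Submodule.Quotient.mk_eq_zero _).2 ?_
      rw [(H (f n)).2 ⟨n, rfl⟩]
      exact Submodule.zero_mem _

theorem length_quotient_toNat_anti [IsNoetherianRing R] [Module.Finite R N] {I : Ideal R}
    (hI : I.IsMaximal) {t : ℕ} {A B : Submodule R N} (hA : I ^ t • ⊤ ≤ A) (hAB : A ≤ B) :
    (Module.length R (N ⧸ B)).toNat ≤ (Module.length R (N ⧸ A)).toNat := by
  refine ENat.toNat_le_toNat (Module.length_le_of_surjective (Submodule.factor hAB)
    (Submodule.factor_surjective hAB)) ?_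
  exact ne_top_of_le_ne_top (Module.length_quotient_pow_smul_ne_top hI N t)
    (Module.length_le_of_surjective (Submodule.factor hA) (Submodule.factor_surjective hA))

theorem hilbertSamuelFunction_mono [IsNoetherianRing R] [Module.Finite R N] {I : Ideal R}
    (hI : I.IsMaximal) {s t : ℕ} (h : s ≤ t) :
    hilbertSamuelFunction I N s ≤ hilbertSamuelFunction I N t :=
  length_quotient_toNat_anti hI le_rfl (Submodule.smul_mono_left (Ideal.pow_le_pow_right h))

theorem pow_smul_top_le_comap (I : Ideal R) (f : N →ₗ[R] M) (t : ℕ) :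
    (I ^ t • ⊤ : Submodule R N) ≤ (I ^ t • ⊤ : Submodule R M).comap f := by
  rw [← Submodule.map_le_iff_le_comap, Submodule.map_smul'']
  exact smul_mono_right _ le_top

theorem hilbertSamuelFunction_le_add_of_exact [IsNoetherianRing R] [Module.Finite R M]
    [Module.Finite R N] {I : Ideal R} (hI : I.IsMaximal) (hg : Function.Surjective g)
    (H : Function.Exact f g) (t : ℕ) :
    hilbertSamuelFunction I M t ≤ hilbertSamuelFunction I N t + hilbertSamuelFunction I P t := by
  rw [hilbertSamuelFunction_eq_add_of_exact hI hg H]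
  exact Nat.add_le_add_right
    (length_quotient_toNat_anti hI le_rfl (pow_smul_top_le_comap I f t)) _

theorem hilbertSamuelFunction_right_le [IsNoetherianRing R] [Module.Finite R M]
    {I : Ideal R} (hI : I.IsMaximal) {g : M →ₗ[R] P} (hg : Function.Surjective g) (t : ℕ) :
    hilbertSamuelFunction I P t ≤ hilbertSamuelFunction I M t := by
  rw [hilbertSamuelFunction_eq_add_of_exact hI hg (LinearMap.exact_subtype_ker_map g)]
  exact Nat.le_add_left _ _

/-- By the Artin–Rees lemma, the filtration induced on the submodule `N` agrees with the `I`-adic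
one up to a shift. -/
theorem exists_hilbertSamuelFunction_add_le_of_exact [IsNoetherianRing R] [Module.Finite R M]
    [Module.Finite R N] {I : Ideal R} (hI : I.IsMaximal) (hf : Function.Injective f)
    (hg : Function.Surjective g) (H : Function.Exact f g) :
    ∃ s : ℕ, ∀ t, hilbertSamuelFunction I N (t - s) + hilbertSamuelFunction I P t ≤
      hilbertSamuelFunction I M t := by
  obtain ⟨s, hs⟩ := I.exists_pow_inf_eq_pow_smul (LinearMap.range f)
  refine ⟨s, fun t => ?_⟩
  rw [hilbertSamuelFunction_eq_add_of_exact hI hg H]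
  refine Nat.add_le_add_right (length_quotient_toNat_anti hI (pow_smul_top_le_comap I f t) ?_) _
  rcases le_or_gt s t with h | h
  · intro n hn
    have h1 : f n ∈ (I ^ t • ⊤ ⊓ LinearMap.range f : Submodule R M) := ⟨hn, n, rfl⟩
    rw [hs t h] at h1
    have h2 : f n ∈ (I ^ (t - s) • ⊤ : Submodule R N).map f := by
      rw [Submodule.map_smul'', Submodule.map_top]
      exact Submodule.smul_mono le_rfl inf_le_right h1
    obtain ⟨n', hn', e⟩ := h2
    rwa [← hf e]
  · rw [Nat.sub_eq_zero_of_le h.le, pow_zero, Ideal.one_eq_top, Submodule.top_smul]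
    exact le_top

theorem LinearEquiv.hilbertSamuelFunction_eq (I : Ideal R) (e : M ≃ₗ[R] N) (t : ℕ) :
    hilbertSamuelFunction I M t = hilbertSamuelFunction I N t := by
  unfold hilbertSamuelFunction
  rw [(Submodule.Quotient.equiv _ _ e (by
    rw [Submodule.map_smul'', Submodule.map_top, LinearEquiv.range]) :
    (M ⧸ (I ^ t • ⊤ : Submodule R M)) ≃ₗ[R] N ⧸ (I ^ t • ⊤ : Submodule R N)).length_eq]

theorem hilbertSamuelFunction_of_subsingleton (I : Ideal R) [Subsingleton M] (t : ℕ) :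
    hilbertSamuelFunction I M t = 0 := by
  simp [hilbertSamuelFunction]

end Exact

end HilbertSamuel

/-! ### Growth of polynomials along the natural numbers -/

open Polynomial in
theorem Polynomial.natDegree_le_of_eventually_le {P : ℝ[X]} {f : ℕ → ℝ} {C : ℝ} {e : ℕ}
    (hf : ∀ᶠ t : ℕ in atTop, f t = P.eval (t : ℝ)) (hC : ∀ t, |f t| ≤ C * (t + 1) ^ e) :
    P.natDegree ≤ e := by
  by_contra! h
  have hQ : ((X + 1 : ℝ[X]) ^ e).degree = (e : WithBot ℕ) := by
    rw [show (1 : ℝ[X]) = Polynomial.C 1 by simp, degree_pow, degree_X_add_C, nsmul_one]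
  have hdeg : ((X + 1 : ℝ[X]) ^ e).degree < P.degree := by
    rw [hQ]
    exact not_le.1 fun h' => absurd (natDegree_le_of_degree_le h') (not_le.2 h)
  have hne : ((X + 1 : ℝ[X]) ^ e) ≠ 0 := by
    intro h0
    rw [h0, degree_zero] at hQ
    exact absurd hQ (by simp)
  have h1 := (P.abs_div_tendsto_atTop_atTop_of_degree_gt _ hdeg hne).comp
    (tendsto_natCast_atTop_atTop (R := ℝ))
  obtain ⟨t, ht1, ht2⟩ := (hf.and (h1.eventually_gt_atTop C)).exists
  have hpos : (0 : ℝ) < ((t : ℝ) + 1) ^ e := by positivity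
  simp only [Function.comp, eval_pow, eval_add, eval_X, eval_one, ← ht1, abs_div] at ht2
  rw [abs_of_pos hpos, lt_div_iff₀ hpos] at ht2
  exact absurd (hC t) (not_le.2 ht2)

open Polynomial in
theorem Polynomial.tendsto_eval_div_pow {P : ℝ[X]} {d : ℕ} (h : P.natDegree ≤ d) :
    Tendsto (fun t : ℕ => P.eval (t : ℝ) / (t : ℝ) ^ d) atTop (𝓝 (P.coeff d)) := by
  have hX : (fun t : ℕ => P.eval (t : ℝ) / (t : ℝ) ^ d) =
      (fun x : ℝ => P.eval x / ((X : ℝ[X]) ^ d).eval x) ∘ ((↑) : ℕ → ℝ) := by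
    funext t
    simp
  rw [hX]
  refine Tendsto.comp ?_ tendsto_natCast_atTop_atTop
  rcases h.lt_or_eq with h | h
  · rw [coeff_eq_zero_of_natDegree_lt h]
    refine P.div_tendsto_atTop_zero_of_degree_lt _ ?_
    rw [degree_X_pow]
    exact degree_le_natDegree.trans_lt (by exact_mod_cast h)
  · rcases eq_or_ne P 0 with rfl | hP
    · simp
    · have := P.div_tendsto_atTop_leadingCoeff_div_of_degree_eq (X ^ d)
        (by rw [degree_X_pow, degree_eq_natDegree hP, h])
      rwa [leadingCoeff_X_pow, div_one, leadingCoeff, h] at this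

open Polynomial in
theorem Polynomial.natDegree_sub_comp_X_sub_C_le {P : ℝ[X]} {e : ℕ} (h : P.natDegree ≤ e + 1)
    (a : ℝ) : (P - P.comp (X - C a)).natDegree ≤ e := by
  rcases Nat.eq_zero_or_pos P.natDegree with h0 | h0
  · rw [eq_C_of_natDegree_eq_zero h0]
    simp
  · have hP : P ≠ 0 := by
      rintro rfl
      simp at h0
    have hd : (P.comp (X - C a)).natDegree = P.natDegree := by
      rw [natDegree_comp, natDegree_X_sub_C, mul_one]
    have hlc : (P.comp (X - C a)).leadingCoeff = P.leadingCoeff := by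
      rw [leadingCoeff_comp (by rw [natDegree_X_sub_C]; exact one_ne_zero), leadingCoeff_X_sub_C,
        one_pow, mul_one]
    have hne : P.comp (X - C a) ≠ 0 := by
      rw [← leadingCoeff_ne_zero, hlc]
      exact leadingCoeff_ne_zero.2 hP
    have hlt : (P - P.comp (X - C a)).degree < P.degree :=
      degree_sub_lt_left (by rw [degree_eq_natDegree hP, degree_eq_natDegree hne, hd]) hP hlc.symm
    rcases eq_or_ne (P - P.comp (X - C a)) 0 with h1 | h1
    · rw [h1]
      simp
    · have := natDegree_lt_natDegree h1 hlt
      omega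

/-! ### Growth of Hilbert–Samuel functions -/

section Growth

variable {R : Type*} [CommRing R]

/-- The Hilbert–Samuel function of `M` grows at most like `t ^ e`. -/
def HilbertSamuelBounded (I : Ideal R) (M : Type*) [AddCommGroup M] [Module R M] (e : ℕ) : Prop :=
  ∃ C : ℕ, ∀ t, hilbertSamuelFunction I M t ≤ C * (t + 1) ^ e

variable {M N P : Type*} [AddCommGroup M] [AddCommGroup N] [AddCommGroup P] [Module R M]
  [Module R N] [Module R P]

theorem HilbertSamuelBounded.of_exact [IsNoetherianRing R] [Module.Finite R M]
    [Module.Finite R N] {I : Ideal R} (hI : I.IsMaximal) {f : N →ₗ[R] M} {g : M →ₗ[R] P}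
    (hg : Function.Surjective g) (H : Function.Exact f g) {e : ℕ}
    (hN : HilbertSamuelBounded I N e) (hP : HilbertSamuelBounded I P e) :
    HilbertSamuelBounded I M e := by
  obtain ⟨C, hC⟩ := hN
  obtain ⟨D, hD⟩ := hP
  refine ⟨C + D, fun t => (hilbertSamuelFunction_le_add_of_exact hI hg H t).trans ?_⟩
  rw [add_mul]
  exact Nat.add_le_add (hC t) (hD t)

theorem HilbertSamuelBounded.of_surjective [IsNoetherianRing R] [Module.Finite R M]
    {I : Ideal R} (hI : I.IsMaximal) {g : M →ₗ[R] P}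
    (hg : Function.Surjective g) {e : ℕ} (h : HilbertSamuelBounded I M e) :
    HilbertSamuelBounded I P e := by
  obtain ⟨C, hC⟩ := h
  exact ⟨C, fun t => (hilbertSamuelFunction_right_le hI hg t).trans (hC t)⟩

theorem hilbertSamuelFunction_eq_zero_of_not_le {I : Ideal R} (hI : I.IsMaximal) {A : Ideal R}
    (hA : ¬ A ≤ I) (h : ∀ a ∈ A, ∀ x : M, a • x = 0) (t : ℕ) :
    hilbertSamuelFunction I M t = 0 := by
  have htop : (I ^ t • ⊤ : Submodule R M) = ⊤ := by
    rw [eq_top_iff]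
    intro m _
    have h1 : A ⊔ I ^ t = ⊤ := by
      have h2 : IsCoprime A I := by
        rw [Ideal.isCoprime_iff_sup_eq, sup_comm]
        exact hI.out.2 _ (left_lt_sup.2 hA)
      exact Ideal.isCoprime_iff_sup_eq.1 h2.pow_right
    obtain ⟨a, ha, b, hb, hab⟩ := Submodule.mem_sup.1 (h1 ▸ trivial : (1 : R) ∈ A ⊔ I ^ t)
    rw [← one_smul R m, ← hab, add_smul, h a ha, zero_add]
    exact Submodule.smul_mem_smul hb trivial
  rw [hilbertSamuelFunction, htop]
  simp

/-- A module killed by `A` is as bounded as the quotients by the primes containing `A`. -/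
theorem HilbertSamuelBounded.of_forall_prime [IsNoetherianRing R] {I : Ideal R} (hI : I.IsMaximal)
    (A : Ideal R) {e : ℕ}
    (hA : ∀ p : Ideal R, p.IsPrime → A ≤ p → p ≤ I → HilbertSamuelBounded I (R ⧸ p) e)
    (hM : Module.Finite R M) (h : ∀ a ∈ A, ∀ x : M, a • x = 0) :
    HilbertSamuelBounded I M e := by
  revert h
  induction hM using IsNoetherianRing.induction_on_isQuotientEquivQuotientPrime R with
  | subsingleton N => exact fun _ => ⟨0, fun t => by simp [hilbertSamuelFunction_of_subsingleton]⟩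
  | quotient N p e' =>
    intro h
    have hle : A ≤ p.1 := fun a ha => by
      have h1 := h a ha (e'.symm 1)
      rw [← map_smul, LinearEquiv.map_eq_zero_iff] at h1
      rw [← Ideal.Quotient.eq_zero_iff_mem, ← h1, Algebra.smul_def, mul_one]
      rfl
    by_cases hp : p.1 ≤ I
    · obtain ⟨C, hC⟩ := hA p.1 p.2 hle hp
      exact ⟨C, fun t => by rw [e'.hilbertSamuelFunction_eq]; exact hC t⟩
    · refine ⟨0, fun t => ?_⟩
      rw [e'.hilbertSamuelFunction_eq, hilbertSamuelFunction_eq_zero_of_not_le hI hp]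
      · exact Nat.zero_le _
      · intro a ha x
        obtain ⟨x, rfl⟩ := Ideal.Quotient.mk_surjective x
        rw [Algebra.smul_def]
        exact Ideal.Quotient.eq_zero_iff_mem.2 (p.1.mul_mem_right x ha)
  | exact N₁ N₂ N₃ f g hf hg hfg h₁ h₃ =>
    intro h
    refine .of_exact hI hg hfg (h₁ fun a ha x => hf ?_) (h₃ fun a ha x => ?_)
    · rw [map_smul, h a ha, map_zero]
    · obtain ⟨x, rfl⟩ := hg x
      rw [← map_smul, h a ha, map_zero]

/-- Multiplication by `x` on `R ⧸ p`. -/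
def quotientMul (p : Ideal R) (x : R) : (R ⧸ p) →ₗ[R] (R ⧸ p) := LinearMap.lsmul R (R ⧸ p) x

theorem quotientMul_injective {p : Ideal R} (hp : p.IsPrime) {x : R} (hx : x ∉ p) :
    Function.Injective (quotientMul p x) := by
  rw [injective_iff_map_eq_zero]
  intro a ha
  obtain ⟨a, rfl⟩ := Ideal.Quotient.mk_surjective a
  have h : Ideal.Quotient.mk p (x * a) = 0 := by rw [map_mul]; exact ha
  exact Ideal.Quotient.eq_zero_iff_mem.2
    ((hp.mem_or_mem (Ideal.Quotient.eq_zero_iff_mem.1 h)).resolve_left hx)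

theorem range_quotientMul_smul (p : Ideal R) (x : R) :
    ∀ a ∈ p ⊔ Ideal.span {x}, ∀ y : (R ⧸ p) ⧸ LinearMap.range (quotientMul p x), a • y = 0 := by
  intro a ha y
  obtain ⟨y, rfl⟩ := Submodule.mkQ_surjective _ y
  obtain ⟨y, rfl⟩ := Ideal.Quotient.mk_surjective y
  obtain ⟨b, hb, c, hc, rfl⟩ := Submodule.mem_sup.1 ha
  obtain ⟨c, rfl⟩ := Ideal.mem_span_singleton'.1 hc
  rw [← map_smul]
  refine (Submodule.Quotient.mk_eq_zero _).2 ⟨Ideal.Quotient.mk p (c * y), ?_⟩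
  change Ideal.Quotient.mk p (x * (c * y)) = Ideal.Quotient.mk p ((b + c * x) * y)
  rw [Ideal.Quotient.eq]
  have : x * (c * y) - (b + c * x) * y = -(b * y) := by ring
  rw [this]
  exact p.neg_mem (p.mul_mem_right y hb)

theorem hilbertSamuelFunction_zero (I : Ideal R) : hilbertSamuelFunction I M 0 = 0 := by
  rw [hilbertSamuelFunction, pow_zero, Ideal.one_eq_top, Submodule.top_smul]
  simp

theorem HilbertSamuelBounded.quotient_maximal {I : Ideal R} (hI : I.IsMaximal) (e : ℕ) :
    HilbertSamuelBounded I (R ⧸ I) e := by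
  have : IsSimpleModule R (R ⧸ I) := isSimpleModule_iff_isCoatom.2 hI.out
  refine ⟨1, fun t => ?_⟩
  have h1 : Module.length R ((R ⧸ I) ⧸ (I ^ t • ⊤ : Submodule R (R ⧸ I))) ≤
      Module.length R (R ⧸ I) :=
    Module.length_le_of_surjective (Submodule.mkQ _) (Submodule.mkQ_surjective _)
  rw [Module.length_eq_one (R := R) (M := R ⧸ I)] at h1
  have h2 := ENat.toNat_le_toNat h1 ENat.one_ne_top
  rw [one_mul]
  exact h2.trans (Nat.one_le_pow _ _ (Nat.succ_pos t))

/-- The Hilbert–Samuel function of `R ⧸ p` grows at most like `t ^ (ht I - ht p)`. For `x ∈ I`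
outside `p`, the increments of this function are at most the values of the Hilbert–Samuel
function of `R ⧸ (p + (x))`, and the primes containing `p + (x)` have bigger height. -/
theorem HilbertSamuelBounded.quotient_prime [IsNoetherianRing R] {I : Ideal R} (hI : I.IsMaximal)
    (e : ℕ) : ∀ p : Ideal R, p.IsPrime → p ≤ I → I.height ≤ p.height + e →
      HilbertSamuelBounded I (R ⧸ p) e := by
  have := hI.isPrime
  induction e with
  | zero =>
    intro p hp hpI hht
    rw [Nat.cast_zero, add_zero] at hht
    have hpeq : p = I := Ideal.eq_of_le_of_height_le _ hpI hht
    subst hpeq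
    exact .quotient_maximal hI 0
  | succ e ih =>
    intro p hp hpI hht
    rcases hpI.eq_or_lt with heq | hlt
    · subst heq
      exact .quotient_maximal hI _
    · obtain ⟨x, hxI, hxp⟩ := SetLike.exists_of_lt hlt
      have hB : HilbertSamuelBounded I ((R ⧸ p) ⧸ LinearMap.range (quotientMul p x)) e := by
        refine .of_forall_prime hI (p ⊔ Ideal.span {x}) (fun q hq hpq hqI => ih q hq hqI ?_)
          inferInstance (range_quotientMul_smul p x)
        have hxq : x ∈ q := hpq (Ideal.mem_sup_right (Ideal.mem_span_singleton_self x))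
        have hpq' : p < q := lt_of_le_of_ne (le_sup_left.trans hpq) (fun h => hxp (h ▸ hxq))
        have h1 := Ideal.height_add_one_le_of_lt_of_isPrime hpq'
        calc I.height ≤ p.height + ((e + 1 : ℕ) : ℕ∞) := hht
          _ = p.height + 1 + e := by push_cast; ring
          _ ≤ q.height + e := by gcongr
      obtain ⟨C, hC⟩ := hB
      have hstep : ∀ t, hilbertSamuelFunction I (R ⧸ p) (t + 1) ≤
          hilbertSamuelFunction I (R ⧸ p) t + C * (t + 1 + 1) ^ e := by
        intro t
        rw [hilbertSamuelFunction_eq_add_of_exact hI (Submodule.mkQ_surjective _)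
          (LinearMap.exact_map_mkQ_range (quotientMul p x))]
        refine Nat.add_le_add (length_quotient_toNat_anti hI (t := t) le_rfl ?_) (hC (t + 1))
        intro y hy
        exact smul_mem_pow_succ_smul hxI hy
      refine ⟨C * 2 ^ e, fun t => ?_⟩
      induction t with
      | zero => simp [hilbertSamuelFunction_zero]
      | succ t iht =>
        calc hilbertSamuelFunction I (R ⧸ p) (t + 1)
            ≤ hilbertSamuelFunction I (R ⧸ p) t + C * (t + 1 + 1) ^ e := hstep t
          _ ≤ C * 2 ^ e * (t + 1) ^ (e + 1) + C * 2 ^ e * (t + 1 + 1) ^ e := by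
              gcongr
              exact Nat.le_mul_of_pos_right _ (by positivity)
          _ ≤ C * 2 ^ e * ((t + 1) * (t + 1 + 1) ^ e) + C * 2 ^ e * (t + 1 + 1) ^ e := by
              gcongr
              rw [pow_succ, mul_comm]
              gcongr
              omega
          _ = C * 2 ^ e * (t + 1 + 1) ^ (e + 1) := by ring

theorem HilbertSamuelBounded.of_eventually_le [IsNoetherianRing R] [Module.Finite R M]
    {I : Ideal R} (hI : I.IsMaximal) {e : ℕ} {P : Polynomial ℝ} (hP : P.natDegree ≤ e)
    (h : ∀ᶠ t : ℕ in atTop, (hilbertSamuelFunction I M t : ℝ) ≤ P.eval (t : ℝ)) :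
    HilbertSamuelBounded I M e := by
  obtain ⟨B, hB⟩ := (Polynomial.tendsto_eval_div_pow hP).bddAbove_range
  obtain ⟨t₀, ht₀⟩ := eventually_atTop.1 h
  obtain ⟨b, hb⟩ := exists_nat_ge B
  refine ⟨b + hilbertSamuelFunction I M (t₀ + 1), fun t => ?_⟩
  rcases le_or_gt t (t₀ + 1) with h | h
  · refine (hilbertSamuelFunction_mono hI h).trans ?_
    exact (Nat.le_add_left _ b).trans (Nat.le_mul_of_pos_right _ (by positivity))
  · have h1 := ht₀ t (by omega)
    have h2 : P.eval (t : ℝ) / (t : ℝ) ^ e ≤ B := hB ⟨t, rfl⟩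
    have htpos : (0 : ℝ) < t := by exact_mod_cast (show 0 < t by omega)
    rw [div_le_iff₀ (by positivity)] at h2
    have h3 : (hilbertSamuelFunction I M t : ℝ) ≤ b * ((t : ℝ) + 1) ^ e :=
      calc _ ≤ B * (t : ℝ) ^ e := h1.trans h2
        _ ≤ b * (t : ℝ) ^ e := by gcongr
        _ ≤ b * ((t : ℝ) + 1) ^ e := by gcongr; linarith
    have h4 : hilbertSamuelFunction I M t ≤ b * (t + 1) ^ e := by exact_mod_cast h3
    exact h4.trans (Nat.mul_le_mul_right _ (Nat.le_add_right _ _))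

/-- The normalized limit of the Hilbert–Samuel function. -/
theorem HilbertSamuelBounded.exists_tendsto [IsNoetherianRing R] [Module.Finite R M]
    {I : Ideal R} (hI : I.IsMaximal) {d : ℕ} (h : HilbertSamuelBounded I M d) :
    ∃ e : ℝ, Tendsto (fun t : ℕ => (hilbertSamuelFunction I M t : ℝ) / (t : ℝ) ^ d) atTop (𝓝 e) := by
  obtain ⟨P, hP⟩ := exists_polynomial_hilbertSamuelFunction hI M
  obtain ⟨C, hC⟩ := h
  have hdeg : P.natDegree ≤ d := Polynomial.natDegree_le_of_eventually_le (C := C) hP (fun t => by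
    rw [abs_of_nonneg (Nat.cast_nonneg _)]
    exact_mod_cast hC t)
  refine ⟨_, (Polynomial.tendsto_eval_div_pow hdeg).congr' ?_⟩
  filter_upwards [hP] with t ht
  rw [ht]

theorem one_le_hilbertSamuelFunction_quotient [IsNoetherianRing R] {I : Ideal R}
    (hI : I.IsMaximal) {p : Ideal R} (hp : p ≤ I) {t : ℕ} (ht : t ≠ 0) :
    1 ≤ hilbertSamuelFunction I (R ⧸ p) t := by
  have hne := Module.length_quotient_pow_smul_ne_top hI (R ⧸ p) t
  rw [Nat.one_le_iff_ne_zero, hilbertSamuelFunction, Ne, ENat.toNat_eq_zero, not_or]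
  refine ⟨?_, hne⟩
  rw [Module.length_eq_zero_iff, Submodule.Quotient.subsingleton_iff]
  intro h
  have h1 : (I ^ t • ⊤ : Submodule R (R ⧸ p)) ≤ (I.map (Ideal.Quotient.mk p)).restrictScalars R := by
    refine Submodule.smul_le.2 fun a ha y _ => ?_
    rw [Algebra.smul_def]
    exact Ideal.mul_mem_right _ _ (Ideal.mem_map_of_mem _ (Ideal.pow_le_self ht ha))
  have h2 : (1 : R ⧸ p) ∈ I.map (Ideal.Quotient.mk p) := h1 (by rw [h]; trivial)
  rw [← map_one (Ideal.Quotient.mk p), ← Ideal.mem_comap,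
    Ideal.comap_map_of_surjective _ Ideal.Quotient.mk_surjective, ← RingHom.ker_eq_comap_bot,
    Ideal.mk_ker, sup_eq_left.2 hp] at h2
  exact hI.ne_top ((Ideal.eq_top_iff_one _).2 h2)

/-- A chain of primes of length `d` from `p` to `I` forces the Hilbert–Samuel function of `R ⧸ p`
to grow at least like `t ^ d`: passing to a strictly bigger prime lowers the growth. -/
theorem length_le_of_hilbertSamuelBounded [IsNoetherianRing R] {I : Ideal R} (hI : I.IsMaximal)
    (d : ℕ) : ∀ (e : ℕ) (l : LTSeries (PrimeSpectrum R)), l.length = d → l.last.asIdeal = I →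
      HilbertSamuelBounded I (R ⧸ l.head.asIdeal) e → d ≤ e := by
  induction d with
  | zero => intro e _ _ _ _; exact Nat.zero_le e
  | succ d ih =>
    intro e l hl hlast hb
    have hl0 : l.length ≠ 0 := by omega
    have : NeZero l.length := ⟨hl0⟩
    set p := l.head.asIdeal with hp
    set l' := l.tail hl0 with hl'
    set q := l'.head.asIdeal with hq
    have hpq : p < q := by
      have h1 : l.head < l'.head := by
        rw [hl', RelSeries.head_tail]
        exact l.strictMono (by
          rw [Fin.lt_def]
          simp [Nat.mod_eq_of_lt (show 1 < l.length + 1 by omega)])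
      exact h1
    have hlast' : l'.last.asIdeal = I := by rw [hl', RelSeries.last_tail, hlast]
    have hlen' : l'.length = d := by rw [hl', RelSeries.tail_length, hl]; rfl
    have hqI : q ≤ I := by
      rw [← hlast']
      exact LTSeries.head_le_last l'
    obtain ⟨x, hxq, hxp⟩ := SetLike.exists_of_lt hpq
    have hpI : p ≤ I := hpq.le.trans hqI
    obtain ⟨P, hP⟩ := exists_polynomial_hilbertSamuelFunction hI (R ⧸ p)
    obtain ⟨C, hC⟩ := hb
    have hdeg : P.natDegree ≤ e := Polynomial.natDegree_le_of_eventually_le (C := C) hP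
      (fun t => by
        rw [abs_of_nonneg (Nat.cast_nonneg _)]
        exact_mod_cast hC t)
    obtain ⟨s, hs⟩ := exists_hilbertSamuelFunction_add_le_of_exact hI
      (quotientMul_injective l.head.2 hxp) (Submodule.mkQ_surjective _)
      (LinearMap.exact_map_mkQ_range (quotientMul p x))
    -- the quotient of `R ⧸ p` by `x` surjects onto `R ⧸ q`
    let g : ((R ⧸ p) ⧸ LinearMap.range (quotientMul p x)) →ₗ[R] R ⧸ q :=
      Submodule.liftQ _ (Submodule.factor hpq.le) (by
        rintro _ ⟨y, rfl⟩
        obtain ⟨y, rfl⟩ := Ideal.Quotient.mk_surjective y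
        exact Ideal.Quotient.eq_zero_iff_mem.2 (q.mul_mem_right y hxq))
    have hg : Function.Surjective g := by
      intro y
      obtain ⟨y, rfl⟩ := Ideal.Quotient.mk_surjective y
      exact ⟨Submodule.mkQ _ (Ideal.Quotient.mk p y), rfl⟩
    have hkey : ∀ t, hilbertSamuelFunction I (R ⧸ p) (t - s) +
        hilbertSamuelFunction I (R ⧸ q) t ≤ hilbertSamuelFunction I (R ⧸ p) t := fun t =>
      (Nat.add_le_add_left (hilbertSamuelFunction_right_le hI hg t) _).trans (hs t)
    obtain ⟨Q, hQ⟩ := exists_polynomial_hilbertSamuelFunction hI (R ⧸ q)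
    have hev : ∀ᶠ t : ℕ in atTop, (hilbertSamuelFunction I (R ⧸ q) t : ℝ) ≤
        (P - P.comp (Polynomial.X - Polynomial.C (s : ℝ))).eval (t : ℝ) := by
      have h1 := (tendsto_sub_atTop_nat s).eventually hP
      filter_upwards [hP, h1, eventually_ge_atTop s] with t h1 h2 h3
      have h4 := hkey t
      rw [Polynomial.eval_sub, Polynomial.eval_comp, ← h1]
      simp only [Polynomial.eval_sub, Polynomial.eval_X, Polynomial.eval_C]
      rw [← Nat.cast_sub h3, ← h2, le_sub_iff_add_le]
      rw [add_comm]
      exact_mod_cast h4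
    rcases Nat.eq_zero_or_pos e with he | he
    · -- a bounded Hilbert–Samuel function is eventually constant, so that of `R ⧸ q` vanishes
      exfalso
      rw [he, Nat.le_zero] at hdeg
      obtain ⟨t, ht1, ht2⟩ := (hev.and (eventually_ne_atTop 0)).exists
      rw [Polynomial.eq_C_of_natDegree_eq_zero hdeg] at ht1
      simp only [Polynomial.C_comp, sub_self, Polynomial.eval_zero] at ht1
      have h1 := one_le_hilbertSamuelFunction_quotient hI hqI ht2
      have : (1 : ℝ) ≤ hilbertSamuelFunction I (R ⧸ q) t := by exact_mod_cast h1
      linarith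
    · obtain ⟨e, rfl⟩ : ∃ e', e = e' + 1 := ⟨e - 1, by omega⟩
      have hD := Polynomial.natDegree_sub_comp_X_sub_C_le hdeg (s : ℝ)
      exact Nat.succ_le_succ (ih e l' hlen' hlast' (.of_eventually_le hI hD hev))

/-- The limit is positive when there is a chain of primes of the expected length. -/
theorem tendsto_hilbertSamuelFunction_pos [IsNoetherianRing R] {I : Ideal R} (hI : I.IsMaximal)
    {d : ℕ} (l : LTSeries (PrimeSpectrum R)) (hl : l.length = d) (hlast : l.last.asIdeal = I)
    {e : ℝ} (h : Tendsto (fun t : ℕ =>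
      (hilbertSamuelFunction I (R ⧸ l.head.asIdeal) t : ℝ) / (t : ℝ) ^ d) atTop (𝓝 e)) :
    0 < e := by
  have hnn : 0 ≤ e := ge_of_tendsto' h fun t => by positivity
  refine lt_of_le_of_ne hnn fun h0 => ?_
  obtain ⟨P, hP⟩ := exists_polynomial_hilbertSamuelFunction hI (R ⧸ l.head.asIdeal)
  obtain ⟨B, hB⟩ := h.bddAbove_range
  obtain ⟨b, hb⟩ := exists_nat_ge B
  -- `t = 0` contributes nothing
  have hbound : ∀ t, hilbertSamuelFunction I (R ⧸ l.head.asIdeal) t ≤ b * (t + 1) ^ d := by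
    intro t
    rcases Nat.eq_zero_or_pos t with rfl | ht
    · simp [hilbertSamuelFunction_zero]
    · have h2 : (hilbertSamuelFunction I (R ⧸ l.head.asIdeal) t : ℝ) / (t : ℝ) ^ d ≤ B :=
        hB ⟨t, rfl⟩
      have htpos : (0 : ℝ) < t := by exact_mod_cast ht
      rw [div_le_iff₀ (by positivity)] at h2
      have h3 : (hilbertSamuelFunction I (R ⧸ l.head.asIdeal) t : ℝ) ≤ b * ((t : ℝ) + 1) ^ d :=
        calc _ ≤ B * (t : ℝ) ^ d := h2
          _ ≤ b * (t : ℝ) ^ d := by gcongr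
          _ ≤ b * ((t : ℝ) + 1) ^ d := by gcongr; linarith
      exact_mod_cast h3
  have hdeg : P.natDegree ≤ d := Polynomial.natDegree_le_of_eventually_le (C := b) hP
    (fun t => by
      rw [abs_of_nonneg (Nat.cast_nonneg _)]
      exact_mod_cast hbound t)
  have hcoeff : P.coeff d = 0 := by
    refine tendsto_nhds_unique (Polynomial.tendsto_eval_div_pow hdeg) ?_
    rw [h0]
    refine h.congr' ?_
    filter_upwards [hP] with t ht
    rw [ht]
  have hpI : l.head.asIdeal ≤ I := by
    rw [← hlast]
    exact LTSeries.head_le_last l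
  rcases Nat.eq_zero_or_pos d with hd | hd
  · rw [hd] at hcoeff hdeg
    rw [Polynomial.eq_C_of_natDegree_le_zero hdeg, hcoeff] at hP
    obtain ⟨t, ht1, ht2⟩ := (hP.and (eventually_ne_atTop 0)).exists
    have h1 := one_le_hilbertSamuelFunction_quotient hI hpI ht2
    simp only [Polynomial.C_0, Polynomial.eval_zero, Nat.cast_eq_zero] at ht1
    omega
  · obtain ⟨d, rfl⟩ : ∃ d', d = d' + 1 := ⟨d - 1, by omega⟩
    have hdeg' : P.natDegree ≤ d := by
      refine Nat.le_of_lt_succ (lt_of_le_of_ne hdeg fun h => ?_)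
      rw [Nat.succ_eq_add_one] at h
      rw [← h, Polynomial.coeff_natDegree, Polynomial.leadingCoeff_eq_zero] at hcoeff
      rw [hcoeff] at h
      simp at h
    have := length_le_of_hilbertSamuelBounded hI (d + 1) d l hl hlast
      (.of_eventually_le hI hdeg' (hP.mono fun t ht => ht.le))
    omega

end Growth

/-! ### Lengths of localizations -/

section LocalizedLength

variable {R : Type*} [CommRing R]

/-- The length of `M_p` over `R_p`. -/
def localizedLength (p : Ideal R) [p.IsPrime] (M : Type*) [AddCommGroup M] [Module R M] : ℕ∞ :=
  Module.length (Localization.AtPrime p) (LocalizedModule p.primeCompl M)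

variable {M N P : Type*} [AddCommGroup M] [AddCommGroup N] [AddCommGroup P] [Module R M]
  [Module R N] [Module R P]

theorem localizedLength_eq_add_of_exact (p : Ideal R) [p.IsPrime] {f : N →ₗ[R] M}
    {g : M →ₗ[R] P} (hf : Function.Injective f) (hg : Function.Surjective g)
    (H : Function.Exact f g) :
    localizedLength p M = localizedLength p N + localizedLength p P :=
  Module.length_eq_add_of_exact (LocalizedModule.map p.primeCompl f)
    (LocalizedModule.map p.primeCompl g) (LocalizedModule.map_injective _ _ hf)
    (LocalizedModule.map_surjective _ _ hg) (LocalizedModule.map_exact _ _ _ H)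

theorem LinearEquiv.localizedLength_eq (p : Ideal R) [p.IsPrime] (e : M ≃ₗ[R] N) :
    localizedLength p M = localizedLength p N := by
  rw [localizedLength_eq_add_of_exact p (f := e.toLinearMap) (g := (0 : N →ₗ[R] PUnit.{1}))
    e.injective (fun _ => ⟨0, rfl⟩) ((LinearMap.exact_zero_iff_surjective _ _).2 e.surjective),
    localizedLength, localizedLength, Module.length_eq_zero (M := LocalizedModule _ PUnit.{1}),
    add_zero]

theorem localizedLength_quotient (p : Ideal R) [p.IsPrime] (L : Ideal R) :
    localizedLength p (R ⧸ L) = Module.length (Localization.AtPrime p)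
      (Localization.AtPrime p ⧸ L.map (algebraMap R (Localization.AtPrime p))) := by
  have h : Submodule.localized' (Localization.AtPrime p) p.primeCompl
      (Algebra.linearMap R (Localization.AtPrime p)) L =
      L.map (algebraMap R (Localization.AtPrime p)) :=
    Submodule.localized'_eq_span _ _ _ _
  rw [← h]
  exact ((IsLocalizedModule.linearEquiv p.primeCompl
    (LocalizedModule.mkLinearMap p.primeCompl (R ⧸ L))
    (Submodule.toLocalizedQuotient' (Localization.AtPrime p) p.primeCompl
      (Algebra.linearMap R (Localization.AtPrime p)) L)).extendScalarsOfIsLocalization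
      p.primeCompl (Localization.AtPrime p)).length_eq

theorem Ideal.map_atPrime_eq_top_iff {p : Ideal R} [p.IsPrime] {L : Ideal R} :
    L.map (algebraMap R (Localization.AtPrime p)) = ⊤ ↔ ¬ L ≤ p := by
  constructor
  · intro h hle
    have h1 := Ideal.map_mono (f := algebraMap R (Localization.AtPrime p)) hle
    rw [h, Localization.AtPrime.map_eq_maximalIdeal] at h1
    exact Ideal.IsPrime.ne_top' (top_le_iff.1 h1)
  · intro h
    by_contra hne
    obtain ⟨m, hm, hle⟩ := Ideal.exists_le_maximal _ hne
    rw [IsLocalRing.eq_maximalIdeal hm, Ideal.map_le_iff_le_comap] at hle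
    exact h (hle.trans (Localization.AtPrime.under_maximalIdeal (I := p)).le)

theorem localizedLength_quotient_eq_zero {p : Ideal R} [p.IsPrime] {L : Ideal R} (h : ¬ L ≤ p) :
    localizedLength p (R ⧸ L) = 0 := by
  rw [localizedLength_quotient, Module.length_eq_zero_iff, Submodule.Quotient.subsingleton_iff]
  exact Ideal.map_atPrime_eq_top_iff.2 h

theorem localizedLength_quotient_self (p : Ideal R) [p.IsPrime] :
    localizedLength p (R ⧸ p) = 1 := by
  rw [localizedLength_quotient, Localization.AtPrime.map_eq_maximalIdeal,
    Module.length_eq_one_iff]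
  exact isSimpleModule_iff_isCoatom.2 (IsLocalRing.maximalIdeal.isMaximal _).out

end LocalizedLength

/-! ### The associativity formula -/

section Associativity

variable {R : Type*} [CommRing R] [IsNoetherianRing R]
variable {M N P : Type*} [AddCommGroup M] [AddCommGroup N] [AddCommGroup P] [Module R M]
  [Module R N] [Module R P]

/-- The Hilbert–Samuel function of `M`, divided by `t ^ d`, tends to `e`. When `d` is the
dimension of `M`, the multiplicity of `M` is `d! * e`. -/
def HasNormalizedMultiplicity (I : Ideal R) (d : ℕ) (M : Type*) [AddCommGroup M] [Module R M]
    (e : ℝ) : Prop :=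
  Tendsto (fun t : ℕ => (hilbertSamuelFunction I M t : ℝ) / (t : ℝ) ^ d) atTop (𝓝 e)

theorem HasNormalizedMultiplicity.of_exact [Module.Finite R M] [Module.Finite R N] {I : Ideal R}
    (hI : I.IsMaximal) {d : ℕ} {f : N →ₗ[R] M} {g : M →ₗ[R] P} (hf : Function.Injective f)
    (hg : Function.Surjective g) (H : Function.Exact f g) {a b : ℝ}
    (hN : HasNormalizedMultiplicity I d N a) (hP : HasNormalizedMultiplicity I d P b) :
    HasNormalizedMultiplicity I d M (a + b) := by
  obtain ⟨s, hs⟩ := exists_hilbertSamuelFunction_add_le_of_exact hI hf hg H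
  have hratio : Tendsto (fun t : ℕ => ((t - s : ℕ) : ℝ) / (t : ℝ)) atTop (𝓝 1) := by
    have h1 : Tendsto (fun t : ℕ => 1 - (s : ℝ) / (t : ℝ)) atTop (𝓝 (1 - 0)) :=
      tendsto_const_nhds.sub (tendsto_const_nhds.div_atTop tendsto_natCast_atTop_atTop)
    rw [sub_zero] at h1
    refine h1.congr' ?_
    filter_upwards [eventually_ge_atTop s, eventually_ne_atTop 0] with t ht ht0
    rw [Nat.cast_sub ht, sub_div, div_self (by exact_mod_cast ht0)]
  have hshift : Tendsto (fun t : ℕ => (hilbertSamuelFunction I N (t - s) : ℝ) / (t : ℝ) ^ d)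
      atTop (𝓝 a) := by
    have h1 := (hN.comp (tendsto_sub_atTop_nat s)).mul (hratio.pow d)
    rw [one_pow, mul_one] at h1
    refine h1.congr' ?_
    filter_upwards [eventually_gt_atTop s] with t ht
    have h2 : ((t - s : ℕ) : ℝ) ≠ 0 := by exact_mod_cast (Nat.sub_pos_of_lt ht).ne'
    simp only [Function.comp, div_pow]
    field_simp
  refine tendsto_of_tendsto_of_tendsto_of_le_of_le (hshift.add hP) (hN.add hP) ?_ ?_
  · intro t
    simp only
    rw [← add_div]
    gcongr
    exact_mod_cast hs t
  · intro t
    simp only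
    rw [← add_div]
    gcongr
    exact_mod_cast hilbertSamuelFunction_le_add_of_exact hI hg H t

theorem HasNormalizedMultiplicity.of_bounded [Module.Finite R M] {I : Ideal R}
    (hI : I.IsMaximal) {d e : ℕ} (he : e < d) (h : HilbertSamuelBounded I M e) :
    HasNormalizedMultiplicity I d M 0 := by
  obtain ⟨a, ha⟩ := h.exists_tendsto hI
  obtain ⟨k, rfl⟩ := Nat.exists_eq_add_of_lt he
  have h1 : Tendsto (fun t : ℕ => (((t : ℝ) ^ (k + 1))⁻¹)) atTop (𝓝 0) :=
    ((tendsto_pow_atTop (Nat.succ_ne_zero k)).comp tendsto_natCast_atTop_atTop).inv_tendsto_atTop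
  have h2 := ha.mul h1
  rw [mul_zero] at h2
  refine h2.congr fun t => ?_
  rw [← div_eq_mul_inv, div_div, ← pow_add, add_assoc]

/-- The associativity formula: for modules killed by `A`, the normalized multiplicity is the sum
of the contributions of the primes in `T`, each weighted with the length of the module there.
The primes of `T` are minimal over `A`, and no other prime between `A` and `I` contributes in
degree `d`. Both sides are additive, so this is a check on the modules `R ⧸ q`. -/
theorem hasNormalizedMultiplicity_sum {I : Ideal R} (hI : I.IsMaximal) {d : ℕ} (A : Ideal R)
    (T : Finset (PrimeSpectrum R)) (e : PrimeSpectrum R → ℝ)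
    (hmin : ∀ p ∈ T, ∀ q : Ideal R, q.IsPrime → A ≤ q → q ≤ p.asIdeal → q = p.asIdeal)
    (hT : ∀ p ∈ T, HasNormalizedMultiplicity I d (R ⧸ p.asIdeal) (e p))
    (hlow : ∀ q : PrimeSpectrum R, A ≤ q.asIdeal → q.asIdeal ≤ I → q ∉ T →
      HasNormalizedMultiplicity I d (R ⧸ q.asIdeal) 0)
    (hM : Module.Finite R M) (h : ∀ a ∈ A, ∀ x : M, a • x = 0) :
    (∀ p ∈ T, localizedLength p.asIdeal M ≠ ⊤) ∧
      HasNormalizedMultiplicity I d M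
        (∑ p ∈ T, ((localizedLength p.asIdeal M).toNat : ℝ) * e p) := by
  classical
  revert h
  induction hM using IsNoetherianRing.induction_on_isQuotientEquivQuotientPrime R with
  | subsingleton N =>
    intro _
    have h0 : ∀ p : PrimeSpectrum R, localizedLength p.asIdeal N = 0 := fun p =>
      Module.length_eq_zero
    refine ⟨fun p _ => by rw [h0]; exact ENat.zero_ne_top, ?_⟩
    simp [h0, HasNormalizedMultiplicity, hilbertSamuelFunction_of_subsingleton]
  | quotient N q e' =>
    intro h
    have hle : A ≤ q.asIdeal := fun a ha => by
      have h1 := h a ha (e'.symm 1)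
      rw [← map_smul, LinearEquiv.map_eq_zero_iff] at h1
      rw [← Ideal.Quotient.eq_zero_iff_mem, ← h1, Algebra.smul_def, mul_one]
      rfl
    have hlen : ∀ p ∈ T, localizedLength p.asIdeal N = if p = q then 1 else 0 := by
      intro p hp
      rw [e'.localizedLength_eq p.asIdeal]
      split_ifs with hpq
      · exact hpq ▸ localizedLength_quotient_self p.asIdeal
      · refine localizedLength_quotient_eq_zero fun hqp => hpq ?_
        exact PrimeSpectrum.ext (hmin p hp q.asIdeal q.2 hle hqp).symm
    have hsum : ∑ p ∈ T, ((localizedLength p.asIdeal N).toNat : ℝ) * e p =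
        if q ∈ T then e q else 0 := by
      rw [← Finset.sum_ite_eq' T q e]
      refine Finset.sum_congr rfl fun p hp => ?_
      rw [hlen p hp]
      split_ifs <;> simp
    have hχ : ∀ t, hilbertSamuelFunction I N t = hilbertSamuelFunction I (R ⧸ q.asIdeal) t :=
      e'.hilbertSamuelFunction_eq I
    refine ⟨fun p hp => ?_, ?_⟩
    · rw [hlen p hp]
      split_ifs
      · exact ENat.one_ne_top
      · exact ENat.zero_ne_top
    · rw [hsum]
      simp only [HasNormalizedMultiplicity, hχ]
      split_ifs with hq
      · exact hT q hq
      · by_cases hqI : q.asIdeal ≤ I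
        · exact hlow q hle hqI hq
        · have h0 : ∀ t, hilbertSamuelFunction I (R ⧸ q.asIdeal) t = 0 :=
            hilbertSamuelFunction_eq_zero_of_not_le hI hqI fun a ha x => by
              obtain ⟨x, rfl⟩ := Ideal.Quotient.mk_surjective x
              rw [Algebra.smul_def]
              exact Ideal.Quotient.eq_zero_iff_mem.2 (q.asIdeal.mul_mem_right x ha)
          simp [h0]
  | exact N₁ N₂ N₃ f g hf hg hfg h₁ h₃ =>
    intro h
    obtain ⟨f₁, m₁⟩ := h₁ fun a ha x => hf (by rw [map_smul, h a ha, map_zero])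
    obtain ⟨f₃, m₃⟩ := h₃ fun a ha x => by
      obtain ⟨x, rfl⟩ := hg x
      rw [← map_smul, h a ha, map_zero]
    have hadd := fun p : PrimeSpectrum R => localizedLength_eq_add_of_exact p.asIdeal hf hg hfg
    refine ⟨fun p hp => ?_, ?_⟩
    · rw [hadd]
      exact WithTop.add_ne_top.2 ⟨f₁ p hp, f₃ p hp⟩
    · convert m₁.of_exact hI hf hg hfg m₃ using 1
      rw [← Finset.sum_add_distrib]
      refine Finset.sum_congr rfl fun p hp => ?_
      rw [hadd, ENat.toNat_add (f₁ p hp) (f₃ p hp)]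
      push_cast
      ring

end Associativity

/-! ### Regular sequences modulo an ideal -/

section RegularModulo

variable {R : Type*} [CommRing R]

/-- `x` is a nonzerodivisor on `R ⧸ A`. -/
def RegularModulo (A : Ideal R) (x : R) : Prop := ∀ a, x * a ∈ A → a ∈ A

/-- `xs` is a weakly regular sequence on `R ⧸ A`. Phrasing this with ideals of the fixed ring `R`
allows inductions to run over `A` without changing the ring. -/
def RegularSequenceModulo : Ideal R → List R → Prop
  | _, [] => True
  | A, x :: xs => RegularModulo A x ∧ RegularSequenceModulo (A ⊔ Ideal.span {x}) xs

theorem regularSequenceModulo_cons {A : Ideal R} {x : R} {xs : List R} :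
    RegularSequenceModulo A (x :: xs) ↔
      RegularModulo A x ∧ RegularSequenceModulo (A ⊔ Ideal.span {x}) xs := Iff.rfl

theorem mem_sup_span_singleton_iff {A : Ideal R} {x a : R} :
    a ∈ A ⊔ Ideal.span {x} ↔ ∃ b ∈ A, ∃ c, a = b + x * c := by
  rw [Submodule.mem_sup]
  constructor
  · rintro ⟨b, hb, y, hy, rfl⟩
    obtain ⟨c, rfl⟩ := Ideal.mem_span_singleton.1 hy
    exact ⟨b, hb, c, rfl⟩
  · rintro ⟨b, hb, c, rfl⟩
    exact ⟨b, hb, _, Ideal.mem_span_singleton.2 ⟨c, rfl⟩, rfl⟩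

theorem regularSequenceModulo_of_forall_getElem (xs : List R) : ∀ A : Ideal R,
    (∀ (i : ℕ) (h : i < xs.length), RegularModulo (A ⊔ Ideal.ofList (xs.take i)) xs[i]) →
      RegularSequenceModulo A xs := by
  induction xs with
  | nil => exact fun _ _ => trivial
  | cons x xs ih =>
    intro A h
    refine ⟨?_, ih _ fun i hi => ?_⟩
    · intro a ha
      have := h 0 (by simp) a
      rw [List.take_zero, Ideal.ofList_nil, sup_bot_eq, List.getElem_cons_zero] at this
      exact this ha
    · have := h (i + 1) (by simpa using hi)
      rwa [List.take_succ_cons, Ideal.ofList_cons, ← sup_assoc, List.getElem_cons_succ] at this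

theorem RingTheory.Sequence.IsWeaklyRegular.regularSequenceModulo_bot {xs : List R}
    (h : RingTheory.Sequence.IsWeaklyRegular R xs) : RegularSequenceModulo ⊥ xs := by
  refine regularSequenceModulo_of_forall_getElem xs ⊥ fun i hi a ha => ?_
  have h1 := h.regular_mod_prev i hi
  have h2 : (Ideal.ofList (xs.take i) • ⊤ : Submodule R R) = Ideal.ofList (xs.take i) := by
    rw [smul_eq_mul, Ideal.mul_top]
  rw [h2] at h1
  rw [bot_sup_eq] at ha ⊢
  rw [← Ideal.Quotient.eq_zero_iff_mem] at ha ⊢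
  refine h1 ?_
  dsimp only
  rw [smul_zero, ← ha, map_mul]
  rfl

theorem RegularModulo.swap_right {A : Ideal R} {x y : R} (hx : RegularModulo A x)
    (hy : RegularModulo (A ⊔ Ideal.span {x}) y) : RegularModulo (A ⊔ Ideal.span {y}) x := by
  intro a ha
  obtain ⟨a₀, ha₀, b, hb⟩ := mem_sup_span_singleton_iff.1 ha
  have h1 : b ∈ A ⊔ Ideal.span {x} := hy b (mem_sup_span_singleton_iff.2
    ⟨-a₀, A.neg_mem ha₀, a, by rw [hb]; ring⟩)
  obtain ⟨a₁, ha₁, c, rfl⟩ := mem_sup_span_singleton_iff.1 h1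
  have h2 : a - y * c ∈ A := hx _ (by
    rw [mul_sub, hb, show a₀ + y * (a₁ + x * c) - x * (y * c) = a₀ + y * a₁ by ring]
    exact A.add_mem ha₀ (A.mul_mem_left y ha₁))
  exact mem_sup_span_singleton_iff.2 ⟨_, h2, c, by ring⟩

section Noetherian

variable [IsNoetherianRing R]

theorem mem_associatedPrimes_quotient_iff {A q : Ideal R} :
    q ∈ associatedPrimes R (R ⧸ A) ↔ q.IsPrime ∧ ∃ u, ∀ r, r ∈ q ↔ r * u ∈ A := by
  rw [AssociatedPrimes.mem_iff, isAssociatedPrime_iff]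
  refine and_congr_right fun _ => ?_
  have key : ∀ u r : R, r ∈ (⊥ : Submodule R (R ⧸ A)).colon {Ideal.Quotient.mk A u} ↔
      r * u ∈ A := fun u r => by
    rw [Submodule.mem_colon_singleton, Submodule.mem_bot, Algebra.smul_def, ←
      Ideal.Quotient.eq_zero_iff_mem, map_mul]
    rfl
  constructor
  · rintro ⟨x, rfl⟩
    obtain ⟨u, rfl⟩ := Ideal.Quotient.mk_surjective x
    exact ⟨u, key u⟩
  · rintro ⟨u, hu⟩
    exact ⟨Ideal.Quotient.mk A u, Ideal.ext fun r => by rw [hu, key]⟩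

theorem exists_associatedPrime_of_notMem {A : Ideal R} {u : R} (hu : u ∉ A) :
    ∃ q ∈ associatedPrimes R (R ⧸ A), ∀ r, r * u ∈ A → r ∈ q := by
  obtain ⟨q, hq, hle⟩ := exists_le_isAssociatedPrime_of_isNoetherianRing R (Ideal.Quotient.mk A u)
    (fun h => hu (Ideal.Quotient.eq_zero_iff_mem.1 h))
  refine ⟨q, hq, fun r hr => hle ?_⟩
  rw [Submodule.mem_colon_singleton, Submodule.mem_bot, Algebra.smul_def]
  exact Ideal.Quotient.eq_zero_iff_mem.2 hr

theorem RegularModulo.notMem_associatedPrime {A q : Ideal R} {x : R} (hx : RegularModulo A x)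
    (hq : q ∈ associatedPrimes R (R ⧸ A)) : x ∉ q := by
  obtain ⟨hp, u, hu⟩ := mem_associatedPrimes_quotient_iff.1 hq
  intro hxq
  refine hp.ne_top ((Ideal.eq_top_iff_one q).2 ((hu 1).2 ?_))
  rw [one_mul]
  exact hx u ((hu x).1 hxq)

/-- Prime avoidance: an ideal contained in no associated prime of `R ⧸ A`, for finitely many `A`,
has an element regular modulo all of them. -/
theorem exists_regularModulo {B : Ideal R} (s : Finset (Ideal R))
    (h : ∀ A ∈ s, ∀ q ∈ associatedPrimes R (R ⧸ A), ¬ B ≤ q) :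
    ∃ z ∈ B, ∀ A ∈ s, RegularModulo A z := by
  by_contra! hcon
  have hfin : (⋃ A ∈ s, associatedPrimes R (R ⧸ A)).Finite :=
    s.finite_toSet.biUnion fun A _ => associatedPrimes.finite R (R ⧸ A)
  have hsub : (B : Set R) ⊆ ⋃ q ∈ ⋃ A ∈ s, associatedPrimes R (R ⧸ A), (q : Set R) := by
    intro z hz
    obtain ⟨A, hA, hreg⟩ := hcon z hz
    simp only [RegularModulo, not_forall] at hreg
    obtain ⟨u, hu, hu'⟩ := hreg
    obtain ⟨q, hq, hq'⟩ := exists_associatedPrime_of_notMem hu'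
    exact Set.mem_biUnion (Set.mem_biUnion hA hq) (hq' z hu)
  obtain ⟨q, hq, hle⟩ := (Ideal.subset_union_prime_finite hfin (f := fun q => q) ⊤ ⊤
    (fun q hq _ _ => by
      obtain ⟨A, -, hq⟩ := Set.mem_iUnion₂.1 hq
      exact hq.1)).1 hsub
  obtain ⟨A, hA, hq⟩ := Set.mem_iUnion₂.1 hq
  exact h A hA q hq hle

theorem exists_associatedPrime_le {A p : Ideal R} (hp : p.IsPrime) (h : A ≤ p) :
    ∃ q ∈ associatedPrimes R (R ⧸ A), A ≤ q ∧ q ≤ p := by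
  obtain ⟨q, hq, hqp⟩ := Ideal.exists_minimalPrimes_le h
  refine ⟨q, ?_, hq.1.2, hqp⟩
  apply Module.associatedPrimes.minimalPrimes_annihilator_subset_associatedPrimes R (R ⧸ A)
  rwa [Ideal.annihilator_quotient]

end Noetherian

section Local

variable [IsNoetherianRing R] [IsLocalRing R]

open IsLocalRing

theorem Ideal.le_of_le_sup_span_mul {A B : Ideal R} {x : R} (hx : x ∈ maximalIdeal R)
    (h : ∀ b ∈ B, ∃ a ∈ A, ∃ c ∈ B, b = a + x * c) : B ≤ A := by
  refine Submodule.le_of_le_smul_of_le_jacobson_bot (I := Ideal.span {x})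
    (IsNoetherian.noetherian B) ?_ ?_
  · rw [Ideal.span_singleton_le_iff_mem]
    exact IsLocalRing.maximalIdeal_le_jacobson ⊥ hx
  · intro b hb
    obtain ⟨a, ha, c, hc, rfl⟩ := h b hb
    exact Submodule.add_mem_sup ha
      (Submodule.smul_mem_smul (Ideal.mem_span_singleton_self x) hc)

theorem RegularModulo.swap_left {A : Ideal R} {x y : R} (hxm : x ∈ maximalIdeal R)
    (hx : RegularModulo A x) (hy : RegularModulo (A ⊔ Ideal.span {x}) y) :
    RegularModulo A y := by
  refine Ideal.le_of_le_sup_span_mul (B := Submodule.comap (LinearMap.mulLeft R y) A) hxm fun a ha => ?_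
  have ha' : y * a ∈ A := ha
  obtain ⟨a₀, ha₀, b, rfl⟩ := mem_sup_span_singleton_iff.1 (hy a (Ideal.mem_sup_left ha'))
  refine ⟨a₀, ha₀, b, hx _ ?_, rfl⟩
  have h1 := A.sub_mem ha' (A.mul_mem_left y ha₀)
  rwa [show y * (a₀ + x * b) - y * a₀ = x * (y * b) by ring] at h1

/-- Whether `R ⧸ (A + (x))` has positive depth does not depend on the regular element `x`. -/
theorem maximalIdeal_notMem_associatedPrimes_sup {A : Ideal R} {x y : R}
    (hym : y ∈ maximalIdeal R) (hx : RegularModulo A x)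
    (hy : RegularModulo A y)
    (h : maximalIdeal R ∉ associatedPrimes R (R ⧸ (A ⊔ Ideal.span {y}))) :
    maximalIdeal R ∉ associatedPrimes R (R ⧸ (A ⊔ Ideal.span {x})) := by
  intro hmem
  obtain ⟨hp, u, hu⟩ := mem_associatedPrimes_quotient_iff.1 hmem
  have hu1 : u ∉ A ⊔ Ideal.span {x} := fun h1 =>
    hp.ne_top ((Ideal.eq_top_iff_one _).2 ((hu 1).2 (by rwa [one_mul])))
  obtain ⟨a₀, ha₀, v, hv⟩ := mem_sup_span_singleton_iff.1 ((hu y).1 hym)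
  have hv1 : v ∉ A ⊔ Ideal.span {y} := by
    intro h1
    obtain ⟨a₁, ha₁, w, rfl⟩ := mem_sup_span_singleton_iff.1 h1
    have h2 : u - x * w ∈ A := hy _ (by
      rw [mul_sub, hv, show a₀ + x * (a₁ + y * w) - y * (x * w) = a₀ + x * a₁ by ring]
      exact A.add_mem ha₀ (A.mul_mem_left x ha₁))
    exact hu1 (mem_sup_span_singleton_iff.2 ⟨_, h2, w, by ring⟩)
  refine h (mem_associatedPrimes_quotient_iff.2 ⟨inferInstance, v, fun r => ⟨fun hr => ?_,
    fun hr => ?_⟩⟩)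
  · obtain ⟨a₂, ha₂, w, hw⟩ := mem_sup_span_singleton_iff.1 ((hu r).1 hr)
    have h2 : r * v - y * w ∈ A := hx _ (by
      have : x * (r * v - y * w) = y * a₂ - r * a₀ := by
        linear_combination (-r) * hv + y * hw
      rw [this]
      exact A.sub_mem (A.mul_mem_left y ha₂) (A.mul_mem_left r ha₀))
    exact mem_sup_span_singleton_iff.2 ⟨_, h2, w, by ring⟩
  · by_contra hr'
    have hunit : IsUnit r := by
      by_contra hn
      exact hr' ((mem_maximalIdeal r).2 hn)
    exact hv1 ((Ideal.unit_mul_mem_iff_mem _ hunit).1 hr)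

/-- Any regular element in the maximal ideal starts a regular sequence of maximal length. -/
theorem exists_regularSequenceModulo_sup (n : ℕ) : ∀ (A : Ideal R) (xs : List R) (x : R),
    xs.length = n + 1 → (∀ y ∈ xs, y ∈ maximalIdeal R) → RegularSequenceModulo A xs →
      x ∈ maximalIdeal R → RegularModulo A x →
      ∃ ys : List R, ys.length = n ∧ (∀ y ∈ ys, y ∈ maximalIdeal R) ∧
        RegularSequenceModulo (A ⊔ Ideal.span {x}) ys := by
  classical
  induction n with
  | zero => exact fun _ _ _ _ _ _ _ _ => ⟨[], rfl, by simp, trivial⟩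
  | succ n ih =>
    intro A xs x hlen hmem hreg hxm hx
    obtain _ | ⟨y, xs⟩ := xs
    · simp at hlen
    obtain ⟨hy, hreg'⟩ := regularSequenceModulo_cons.1 hreg
    have hym : y ∈ maximalIdeal R := hmem y (by simp)
    have hmem' : ∀ z ∈ xs, z ∈ maximalIdeal R := fun z hz => hmem z (by simp [hz])
    have hlen' : xs.length = n + 1 := by simpa using hlen
    have hAy : maximalIdeal R ∉ associatedPrimes R (R ⧸ (A ⊔ Ideal.span {y})) := by
      obtain _ | ⟨z', xs'⟩ := xs
      · simp at hlen'
      exact fun h => hreg'.1.notMem_associatedPrime h (hmem' z' (by simp))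
    have hAx := maximalIdeal_notMem_associatedPrimes_sup hym hx hy hAy
    have hA : maximalIdeal R ∉ associatedPrimes R (R ⧸ A) := fun h =>
      hx.notMem_associatedPrime h hxm
    obtain ⟨z, hzm, hz⟩ := exists_regularModulo (B := maximalIdeal R)
      {A, A ⊔ Ideal.span {x}, A ⊔ Ideal.span {y}} (by
        intro B hB q hq hle
        have : q = maximalIdeal R := (le_maximalIdeal hq.1.ne_top).antisymm hle
        subst this
        simp only [Finset.mem_insert, Finset.mem_singleton] at hB
        rcases hB with rfl | rfl | rfl
        · exact hA hq
        · exact hAx hq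
        · exact hAy hq)
    have hz₁ := hz A (by simp)
    have hz₂ := hz (A ⊔ Ideal.span {x}) (by simp)
    have hz₃ := hz (A ⊔ Ideal.span {y}) (by simp)
    obtain ⟨ys, hys1, hys2, hys3⟩ := ih _ xs z hlen' hmem' hreg' hzm hz₃
    obtain ⟨zs, hzs1, hzs2, hzs3⟩ := ih (A ⊔ Ideal.span {z}) (y :: ys) x (by simp [hys1])
      (by simpa using ⟨hym, hys2⟩)
      ⟨hy.swap_right hz₃, by rwa [sup_right_comm] at hys3⟩ hxm (hx.swap_right hz₂)
    exact ⟨z :: zs, by simp [hzs1], by simpa using ⟨hzm, hzs2⟩, hz₂,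
      by rwa [sup_right_comm] at hzs3⟩

/-- The depth of `R ⧸ A` is at most `dim R ⧸ p` for each associated prime `p`. -/
theorem exists_ltSeries_of_mem_associatedPrimes (xs : List R) : ∀ (A : Ideal R)
    (p : PrimeSpectrum R), (∀ y ∈ xs, y ∈ maximalIdeal R) → RegularSequenceModulo A xs →
      p.asIdeal ∈ associatedPrimes R (R ⧸ A) →
      ∃ l : LTSeries (PrimeSpectrum R), l.head = p ∧ l.last = closedPoint R ∧
        xs.length ≤ l.length := by
  induction xs with
  | nil =>
    intro A p _ _ _
    rcases (le_maximalIdeal p.2.ne_top).eq_or_lt with h | h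
    · exact ⟨RelSeries.singleton _ p, rfl, PrimeSpectrum.ext h, Nat.zero_le _⟩
    · exact ⟨(RelSeries.singleton _ (closedPoint R)).cons p h, RelSeries.head_cons _ _ _,
        RelSeries.last_cons _ _ _, Nat.zero_le _⟩
  | cons x xs ih =>
    intro A p hmem hreg hp
    obtain ⟨hx, hreg'⟩ := regularSequenceModulo_cons.1 hreg
    have hxm : x ∈ maximalIdeal R := hmem x (by simp)
    obtain ⟨hprime, u, hu⟩ := mem_associatedPrimes_quotient_iff.1 hp
    -- some element killed by `p` modulo `A` lies outside `A + (x)`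
    obtain ⟨v, hv, hv'⟩ : ∃ v, (∀ r ∈ p.asIdeal, r * v ∈ A) ∧ v ∉ A ⊔ Ideal.span {x} := by
      by_contra! hcon
      let B : Ideal R :=
        { carrier := {v | ∀ r ∈ p.asIdeal, r * v ∈ A}
          add_mem' := fun ha hb r hr => by rw [mul_add]; exact A.add_mem (ha r hr) (hb r hr)
          zero_mem' := fun r _ => by rw [mul_zero]; exact A.zero_mem
          smul_mem' := fun c v hv r hr => by
            rw [smul_eq_mul, mul_left_comm]
            exact A.mul_mem_left c (hv r hr) }
      have hBA : B ≤ A := Ideal.le_of_le_sup_span_mul hxm fun b hb => by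
        obtain ⟨a, ha, c, rfl⟩ := mem_sup_span_singleton_iff.1 (hcon b hb)
        refine ⟨a, ha, c, fun r hr => hx _ ?_, rfl⟩
        have h1 := A.sub_mem (hb r hr) (A.mul_mem_left r ha)
        rwa [show r * (a + x * c) - r * a = x * (r * c) by ring] at h1
      have huA : u ∈ A := hBA fun r hr => (hu r).1 hr
      exact hprime.ne_top ((Ideal.eq_top_iff_one _).2 ((hu 1).2 (by rwa [one_mul])))
    obtain ⟨q, hq, hq'⟩ := exists_associatedPrime_of_notMem hv'
    have hpq : p.asIdeal < q := by
      refine lt_of_le_of_ne (fun r hr => hq' r (Ideal.mem_sup_left (hv r hr))) fun h => ?_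
      refine hx.notMem_associatedPrime hp (h ▸ hq' x ?_)
      exact Ideal.mem_sup_right (Ideal.mul_mem_right v _ (Ideal.mem_span_singleton_self x))
    obtain ⟨l, hl1, hl2, hl3⟩ := ih _ ⟨q, IsAssociatedPrime.isPrime hq⟩ (fun z hz => hmem z (by simp [hz])) hreg' hq
    refine ⟨l.cons p (by rw [hl1]; exact hpq), RelSeries.head_cons _ _ _, ?_, ?_⟩
    · rw [RelSeries.last_cons, hl2]
    · rw [RelSeries.cons_length, List.length_cons]
      omega

/-- If `R ⧸ A` is Cohen–Macaulay of dimension `N`, then every prime `p ⊇ A` with at most `h` steps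
below it has at least `N - h` steps above it. One factors out regular elements of `p` until `p`
is an associated prime. -/
theorem exists_ltSeries_of_regularSequenceModulo (h : ℕ) : ∀ (A : Ideal R) (xs : List R)
    (p : PrimeSpectrum R), (∀ y ∈ xs, y ∈ maximalIdeal R) → RegularSequenceModulo A xs →
      (∀ l : LTSeries (PrimeSpectrum R), A ≤ l.head.asIdeal → l.length ≤ xs.length) →
      A ≤ p.asIdeal →
      (∀ l : LTSeries (PrimeSpectrum R), A ≤ l.head.asIdeal → l.last = p → l.length ≤ h) →
      ∃ l : LTSeries (PrimeSpectrum R), l.head = p ∧ l.last = closedPoint R ∧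
        xs.length ≤ l.length + h := by
  induction h with
  | zero =>
    intro A xs p hmem hreg hdim hAp hht
    obtain ⟨q, hq, hAq, hqp⟩ := exists_associatedPrime_le p.2 hAp
    have hqp' : q = p.asIdeal := by
      by_contra hne
      have hlt : (⟨q, IsAssociatedPrime.isPrime hq⟩ : PrimeSpectrum R) < p :=
        lt_of_le_of_ne hqp fun h => hne (congrArg PrimeSpectrum.asIdeal h)
      have h1 := hht (RelSeries.cons (RelSeries.singleton _ p) _ hlt) hAq
        (RelSeries.last_cons _ _ _)
      exact absurd h1 (Nat.not_succ_le_zero _)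
    obtain ⟨l, hl1, hl2, hl3⟩ := exists_ltSeries_of_mem_associatedPrimes xs A p hmem hreg
      (hqp' ▸ hq)
    exact ⟨l, hl1, hl2, hl3⟩
  | succ h ih =>
    intro A xs p hmem hreg hdim hAp hht
    by_cases hass : ∃ q ∈ associatedPrimes R (R ⧸ A), p.asIdeal ≤ q
    · obtain ⟨q, hq, hpq⟩ := hass
      obtain ⟨l, hl1, hl2, hl3⟩ := exists_ltSeries_of_mem_associatedPrimes xs A ⟨q, IsAssociatedPrime.isPrime hq⟩ hmem
        hreg hq
      rcases hpq.eq_or_lt with heq | hlt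
      · exact ⟨l, hl1.trans (PrimeSpectrum.ext heq.symm), hl2, by omega⟩
      · have := hdim (l.cons p (by rw [hl1]; exact hlt))
          (by rw [RelSeries.head_cons]; exact hAp)
        rw [RelSeries.cons_length] at this
        omega
    · push Not at hass
      obtain ⟨x, hxp, hx⟩ := exists_regularModulo (B := p.asIdeal) {A} (by
        intro B hB
        rw [Finset.mem_singleton] at hB
        subst hB
        exact hass)
      replace hx := hx A (by simp)
      have hxm : x ∈ maximalIdeal R := le_maximalIdeal p.2.ne_top hxp
      -- chains above `A + (x)` extend downwards
      have hext : ∀ l : LTSeries (PrimeSpectrum R), A ⊔ Ideal.span {x} ≤ l.head.asIdeal →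
          ∃ l' : LTSeries (PrimeSpectrum R), A ≤ l'.head.asIdeal ∧ l'.last = l.last ∧
            l'.length = l.length + 1 := by
        intro l hl
        obtain ⟨q, hq, hAq, hql⟩ := exists_associatedPrime_le l.head.2 (le_sup_left.trans hl)
        have hne : q ≠ l.head.asIdeal := fun heq => hx.notMem_associatedPrime hq
          (heq ▸ hl (Ideal.mem_sup_right (Ideal.mem_span_singleton_self x)))
        have hlt : (⟨q, IsAssociatedPrime.isPrime hq⟩ : PrimeSpectrum R) < l.head :=
          lt_of_le_of_ne hql fun h => hne (congrArg PrimeSpectrum.asIdeal h)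
        exact ⟨l.cons ⟨q, IsAssociatedPrime.isPrime hq⟩ hlt, by rw [RelSeries.head_cons]; exact hAq,
          RelSeries.last_cons _ _ _, RelSeries.cons_length _ _ _⟩
      have hAxp : A ⊔ Ideal.span {x} ≤ p.asIdeal :=
        sup_le hAp ((Ideal.span_singleton_le_iff_mem _).2 hxp)
      have hpos : 1 ≤ xs.length := by
        obtain ⟨l', hl1, -, hl3⟩ := hext (RelSeries.singleton _ p) hAxp
        have := hdim l' hl1
        omega
      obtain ⟨ys, hys1, hys2, hys3⟩ := exists_regularSequenceModulo_sup (xs.length - 1) A xs x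
        (by omega) hmem hreg hxm hx
      obtain ⟨l, hl1, hl2, hl3⟩ := ih _ ys p hys2 hys3
        (fun l hl => by
          obtain ⟨l', hl1, -, hl3⟩ := hext l hl
          have := hdim l' hl1
          omega)
        hAxp
        (fun l hl hlp => by
          obtain ⟨l', hl1, hl2, hl3⟩ := hext l hl
          have := hht l' hl1 (hl2.trans hlp)
          omega)
      exact ⟨l, hl1, hl2, by omega⟩

end Local

end RegularModulo

/-! ### Dimension in Cohen–Macaulay rings -/

section CohenMacaulay

variable {S : Type*} [CommRing S]

theorem exists_isWeaklyRegular_length_eq {R : Type*} [CommRing R] [IsLocalRing R] {n : ℕ}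
    (h : localDepth R = n) :
    ∃ rs : List R, RingTheory.Sequence.IsWeaklyRegular R rs ∧
      (∀ r ∈ rs, r ∈ IsLocalRing.maximalIdeal R) ∧ rs.length = n := by
  rcases Nat.eq_zero_or_pos n with rfl | hn
  · exact ⟨[], .nil R R, by simp, rfl⟩
  have hlt : ((n - 1 : ℕ) : ℕ∞) < localDepth R := by
    rw [h]
    exact_mod_cast Nat.sub_lt hn one_pos
  obtain ⟨rs, hrs⟩ := lt_iSup_iff.1 hlt
  obtain ⟨hreg, hrs⟩ := lt_iSup_iff.1 hrs
  have hle : ((rs.length : ℕ) : ℕ∞) ≤ n := by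
    rw [← h]
    exact le_iSup₂_of_le rs hreg le_rfl
  have h1 : n - 1 < rs.length := by exact_mod_cast hrs
  have h2 : rs.length ≤ n := by exact_mod_cast hle
  exact ⟨rs, hreg.1.toIsWeaklyRegular, hreg.2, by omega⟩

theorem LTSeries.length_add_height_head_le (l : LTSeries (PrimeSpectrum S)) :
    (l.length : ℕ∞) + l.head.asIdeal.height ≤ l.last.asIdeal.height := by
  have key : ∀ (i : ℕ) (hi : i < l.length + 1),
      (i : ℕ∞) + l.head.asIdeal.height ≤ (l ⟨i, hi⟩).asIdeal.height := by
    intro i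
    induction i with
    | zero =>
      intro hi
      rw [Nat.cast_zero, zero_add]
      exact le_rfl
    | succ i ih =>
      intro hi
      have hlt : (l ⟨i, by omega⟩).asIdeal < (l ⟨i + 1, hi⟩).asIdeal :=
        l.strictMono (Fin.mk_lt_mk.2 (Nat.lt_succ_self i))
      refine le_trans ?_ (Ideal.height_add_one_le_of_lt_of_isPrime hlt)
      rw [Nat.cast_succ, add_right_comm]
      exact add_le_add_left (ih (by omega)) 1
  exact key l.length (Nat.lt_succ_self _)

/-- In a Cohen–Macaulay ring, `ht p + dim (S ⧸ p)_I = ht I` for primes `p ≤ I`. -/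
theorem IsCohenMacaulayRing.exists_ltSeries (hS : IsCohenMacaulayRing S) {I : Ideal S}
    (hI : I.IsMaximal) (p : PrimeSpectrum S) (hp : p.asIdeal ≤ I) :
    ∃ l : LTSeries (PrimeSpectrum S), l.head = p ∧ l.last.asIdeal = I ∧
      I.height = l.length + p.asIdeal.height := by
  have hnoeth := hS.isNoetherianRing
  have := hI.isPrime
  let R := Localization.AtPrime I
  have hR : IsNoetherianRing R := IsLocalization.isNoetherianRing I.primeCompl R hnoeth
  obtain ⟨n, hn⟩ := ENat.ne_top_iff_exists.1 (Ideal.height_ne_top_of_isPrime (I := I))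
  have hdim : ringKrullDim R = n := by
    rw [IsLocalization.AtPrime.ringKrullDim_eq_height I R, ← hn]
    rfl
  have hdepth : localDepth R = n := by
    have h1 := hS.depth_eq_dim I
    rw [show ringKrullDim (Localization.AtPrime I) = n from hdim] at h1
    exact WithBot.coe_injective h1
  obtain ⟨rs, hreg, hmem, hlen⟩ := exists_isWeaklyRegular_length_eq hdepth
  have hdisj : Disjoint (I.primeCompl : Set S) (p.asIdeal : Set S) :=
    Set.disjoint_left.2 fun x hx hxp => hx (hp hxp)
  have hpR : (p.asIdeal.map (algebraMap S R)).IsPrime :=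
    IsLocalization.isPrime_of_isPrime_disjoint I.primeCompl R p.asIdeal p.2 hdisj
  let q : PrimeSpectrum R := ⟨p.asIdeal.map (algebraMap S R), hpR⟩
  have hq : q.asIdeal.height = p.asIdeal.height :=
    IsLocalization.height_map_of_disjoint I.primeCompl p.asIdeal hdisj
  obtain ⟨h, hh⟩ := ENat.ne_top_iff_exists.1 (Ideal.height_ne_top_of_isPrime (I := p.asIdeal))
  obtain ⟨l, hl1, hl2, hl3⟩ := exists_ltSeries_of_regularSequenceModulo h ⊥ rs q hmem
    hreg.regularSequenceModulo_bot
    (fun l _ => by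
      have h1 : (l.length : WithBot ℕ∞) ≤ ringKrullDim R := Order.LTSeries.length_le_krullDim l
      rw [hdim] at h1
      rw [hlen]
      exact_mod_cast h1)
    bot_le
    (fun l _ hl => by
      have h1 : (l.length : ℕ∞) ≤ Order.height q := Order.length_le_height hl.le
      rw [← PrimeSpectrum.height_eq_orderHeight, hq, ← hh] at h1
      exact_mod_cast h1)
  have hmono : StrictMono (PrimeSpectrum.comap (algebraMap S R)) :=
    Monotone.strictMono_of_injective (fun a b hab => Ideal.comap_mono hab)
      (PrimeSpectrum.localization_comap_injective R I.primeCompl)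
  have e1 : (l.map _ hmono).head = p := by
    rw [LTSeries.head_map, hl1]
    exact PrimeSpectrum.ext
      (IsLocalization.under_map_of_isPrime_disjoint I.primeCompl R p.2 hdisj)
  have e2 : (l.map _ hmono).last.asIdeal = I := by
    rw [LTSeries.last_map, hl2]
    exact Localization.AtPrime.under_maximalIdeal
  refine ⟨l.map _ hmono, e1, e2, le_antisymm ?_ ?_⟩
  · rw [← hn, ← hh]
    rw [hlen] at hl3
    exact_mod_cast hl3
  · have := LTSeries.length_add_height_head_le (l.map _ hmono)
    rwa [e1, e2] at this

end CohenMacaulay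

/-! ### Powers of ideals generated by regular sequences -/

section Powers

variable {R : Type*} [CommRing R]

theorem Ideal.sup_pow_succ_le (A B : Ideal R) (m : ℕ) :
    (A ⊔ B) ^ (m + 1) ≤ A * (A ⊔ B) ^ m ⊔ B ^ (m + 1) := by
  induction m with
  | zero => simp
  | succ m ih =>
    calc (A ⊔ B) ^ (m + 1 + 1) = A * (A ⊔ B) ^ (m + 1) ⊔ B * (A ⊔ B) ^ (m + 1) := by
          rw [pow_succ' (A ⊔ B) (m + 1), Ideal.sup_mul]
      _ ≤ A * (A ⊔ B) ^ (m + 1) ⊔ B * (A * (A ⊔ B) ^ m ⊔ B ^ (m + 1)) :=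
          sup_le_sup_left (Ideal.mul_mono_right ih) _
      _ ≤ A * (A ⊔ B) ^ (m + 1) ⊔ B ^ (m + 1 + 1) := by
          rw [Ideal.mul_sup, ← mul_assoc, mul_comm B A, mul_assoc, ← pow_succ']
          refine sup_le le_sup_left (sup_le (le_sup_of_le_left ?_) le_sup_right)
          rw [pow_succ' (A ⊔ B) m]
          exact Ideal.mul_mono_right (Ideal.mul_mono_left le_sup_right)

/-- If `B = D : x`, then `0 → R ⧸ B → R ⧸ D → R ⧸ (D + (x)) → 0` is exact. -/
theorem Ideal.length_quotient_eq_add_of_colon {B D : Ideal R} {x : R}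
    (h : ∀ a, x * a ∈ D ↔ a ∈ B) :
    Module.length R (R ⧸ D) =
      Module.length R (R ⧸ B) + Module.length R (R ⧸ (D ⊔ Ideal.span {x})) := by
  have hle : D ≤ D ⊔ Ideal.span {x} := le_sup_left
  refine Module.length_eq_add_of_exact
    (Submodule.mapQ B D (LinearMap.mulLeft R x) (fun a ha => (h a).2 ha))
    (Submodule.factor hle) ?_ (Submodule.factor_surjective hle) ?_
  · rw [injective_iff_map_eq_zero]
    intro q hq
    obtain ⟨a, rfl⟩ := Submodule.mkQ_surjective _ q
    exact (Submodule.Quotient.mk_eq_zero _).2 ((h a).1 ((Submodule.Quotient.mk_eq_zero _).1 hq))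
  · intro q
    obtain ⟨a, rfl⟩ := Submodule.mkQ_surjective _ q
    constructor
    · intro hq
      have h1 : a ∈ D ⊔ Ideal.span {x} := (Submodule.Quotient.mk_eq_zero _).1 hq
      obtain ⟨b, hb, c, rfl⟩ := mem_sup_span_singleton_iff.1 h1
      refine ⟨Submodule.mkQ _ c, (Submodule.Quotient.eq _).2 ?_⟩
      change x * c - (b + x * c) ∈ D
      rw [sub_add_cancel_right]
      exact D.neg_mem hb
    · rintro ⟨q', hq'⟩
      obtain ⟨c, rfl⟩ := Submodule.mkQ_surjective _ q'
      rw [← hq']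
      exact (Submodule.Quotient.mk_eq_zero _).2 (Ideal.mem_sup_right
        (Ideal.mul_mem_right c _ (Ideal.mem_span_singleton_self x)))

theorem mem_of_mul_mem_sup_pow {A K₀ : Ideal R} {x a : R} {m : ℕ}
    (hx : RegularModulo (A ⊔ K₀ ^ (m + 1)) x)
    (ha : x * a ∈ A ⊔ (Ideal.span {x} ⊔ K₀) ^ (m + 1)) :
    a ∈ A ⊔ (Ideal.span {x} ⊔ K₀) ^ m := by
  obtain ⟨a₀, ha₀, w, hw, hsum⟩ := Submodule.mem_sup.1 ha
  obtain ⟨u, hu, c, hc, rfl⟩ := Submodule.mem_sup.1 (Ideal.sup_pow_succ_le _ _ m hw)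
  obtain ⟨b, hb, rfl⟩ := Ideal.mem_span_singleton_mul.1 hu
  have h1 : a - b ∈ A ⊔ K₀ ^ (m + 1) := hx _ (by
    rw [show x * (a - b) = a₀ + c by linear_combination -hsum]
    exact Submodule.add_mem_sup ha₀ hc)
  have h2 : A ⊔ K₀ ^ (m + 1) ≤ A ⊔ (Ideal.span {x} ⊔ K₀) ^ m :=
    sup_le_sup_left ((Ideal.pow_le_pow_right (Nat.le_succ m)).trans
      (Ideal.pow_right_mono le_sup_right m)) A
  rw [← sub_add_cancel a b]
  exact Ideal.add_mem _ (h2 h1) (Ideal.mem_sup_right hb)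

variable [IsNoetherianRing R] [IsLocalRing R]

open IsLocalRing

/-- The first element of a regular sequence in a local ring can be moved to the end. -/
theorem RegularSequenceModulo.rotate (xs : List R) : ∀ (A : Ideal R) (x : R),
    x ∈ maximalIdeal R → RegularSequenceModulo A (x :: xs) →
      RegularSequenceModulo A xs ∧ RegularModulo (A ⊔ Ideal.ofList xs) x := by
  induction xs with
  | nil =>
    intro A x _ h
    rw [Ideal.ofList_nil, sup_bot_eq]
    exact ⟨trivial, h.1⟩
  | cons z zs ih =>
    intro A x hxm h
    obtain ⟨hx, hz, hzs⟩ := h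
    obtain ⟨h1, h2⟩ := ih (A ⊔ Ideal.span {z}) x hxm
      ⟨hx.swap_right hz, by rwa [sup_right_comm]⟩
    rw [Ideal.ofList_cons, ← sup_assoc]
    exact ⟨⟨hx.swap_left hxm hz, h1⟩, h2⟩

/-- If `K` is generated by a regular sequence on `R ⧸ A` and `y` is regular modulo `A + K`, then
`y` is regular modulo `A + K ^ m`. -/
theorem RegularModulo.sup_ofList_pow (n : ℕ) : ∀ (A : Ideal R) (xs : List R) (y : R),
    xs.length = n → (∀ x ∈ xs, x ∈ maximalIdeal R) → RegularSequenceModulo A xs →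
      RegularModulo (A ⊔ Ideal.ofList xs) y → ∀ m, RegularModulo (A ⊔ Ideal.ofList xs ^ m) y := by
  induction n with
  | zero =>
    intro A xs y hlen _ _ hy m
    obtain rfl := List.length_eq_zero_iff.1 hlen
    cases m with
    | zero =>
      intro a _
      rw [pow_zero, Ideal.one_eq_top, sup_top_eq]
      trivial
    | succ m => rwa [Ideal.ofList_nil, Ideal.bot_pow (Nat.succ_ne_zero m), ← Ideal.ofList_nil]
  | succ n ih =>
    intro A xs y hlen hmem hreg hy m
    obtain _ | ⟨x, xs⟩ := xs
    · simp at hlen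
    have hlen' : xs.length = n := by simpa using hlen
    have hmem' : ∀ z ∈ xs, z ∈ maximalIdeal R := fun z hz => hmem z (by simp [hz])
    obtain ⟨h1, h2⟩ := RegularSequenceModulo.rotate xs A x (hmem x (by simp)) hreg
    have hcolon := ih A xs x hlen' hmem' h1 h2
    rw [Ideal.ofList_cons] at hy ⊢
    induction m with
    | zero =>
      intro a _
      rw [pow_zero, Ideal.one_eq_top, sup_top_eq]
      trivial
    | succ m ihm =>
      intro a ha
      have h3 := ih (A ⊔ Ideal.span {x}) xs y hlen' hmem' hreg.2 (by rwa [sup_assoc]) (m + 1)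
      have h4 : A ⊔ (Ideal.span {x} ⊔ Ideal.ofList xs) ^ (m + 1) ≤
          A ⊔ Ideal.span {x} ⊔ Ideal.ofList xs ^ (m + 1) := by
        rw [sup_assoc]
        exact sup_le_sup_left ((Ideal.sup_pow_succ_le _ _ m).trans
          (sup_le_sup_right Ideal.mul_le_left _)) A
      obtain ⟨w, hw, c, hc, rfl⟩ := Submodule.mem_sup.1 (h3 a (h4 ha))
      obtain ⟨a₀, ha₀, b, rfl⟩ := mem_sup_span_singleton_iff.1 hw
      have hc' : c ∈ (Ideal.span {x} ⊔ Ideal.ofList xs) ^ (m + 1) :=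
        Ideal.pow_right_mono le_sup_right _ hc
      have hxyb : x * (y * b) ∈ A ⊔ (Ideal.span {x} ⊔ Ideal.ofList xs) ^ (m + 1) := by
        have h5 := Ideal.sub_mem _ ha (Ideal.add_mem _
          (Ideal.mem_sup_left (A.mul_mem_left y ha₀))
          (Ideal.mem_sup_right (Ideal.mul_mem_left _ y hc')))
        rwa [show y * (a₀ + x * b + c) - (y * a₀ + y * c) = x * (y * b) by ring] at h5
      have hb := ihm b (mem_of_mul_mem_sup_pow (hcolon (m + 1)) hxyb)
      obtain ⟨a₁, ha₁, e, he, rfl⟩ := Submodule.mem_sup.1 hb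
      have hxe : x * e ∈ (Ideal.span {x} ⊔ Ideal.ofList xs) ^ (m + 1) := by
        rw [pow_succ']
        exact Ideal.mul_mem_mul (Ideal.mem_sup_left (Ideal.mem_span_singleton_self x)) he
      rw [show a₀ + x * (a₁ + e) + c = (a₀ + x * a₁) + (x * e + c) by ring]
      exact Submodule.add_mem_sup (A.add_mem ha₀ (A.mul_mem_left x ha₁)) (Ideal.add_mem _ hxe hc')

/-- For `K` generated by a regular sequence of length `n` on `R ⧸ A`, the length of
`R ⧸ (A + K ^ (m + 1))`. With `x` the first element of the sequence, `K ^ (m + 1) : x = K ^ m`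
modulo `A`, and `K` modulo `x` is generated by a shorter regular sequence; so the lengths satisfy
Pascal's recursion. -/
theorem length_quotient_sup_ofList_pow (n : ℕ) : ∀ (A : Ideal R) (xs : List R),
    xs.length = n → (∀ x ∈ xs, x ∈ maximalIdeal R) → RegularSequenceModulo A xs → ∀ m : ℕ,
      Module.length R (R ⧸ (A ⊔ Ideal.ofList xs ^ (m + 1))) =
        Module.length R (R ⧸ (A ⊔ Ideal.ofList xs)) * ((n + m).choose n : ℕ∞) := by
  induction n with
  | zero =>
    intro A xs hlen _ _ m
    obtain rfl := List.length_eq_zero_iff.1 hlen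
    rw [Ideal.ofList_nil, Ideal.bot_pow (Nat.succ_ne_zero m), Nat.choose_zero_right, Nat.cast_one,
      mul_one]
  | succ n ih =>
    intro A xs hlen hmem hreg m
    obtain _ | ⟨x, xs⟩ := xs
    · simp at hlen
    have hlen' : xs.length = n := by simpa using hlen
    have hmem' : ∀ z ∈ xs, z ∈ maximalIdeal R := fun z hz => hmem z (by simp [hz])
    obtain ⟨h1, h2⟩ := RegularSequenceModulo.rotate xs A x (hmem x (by simp)) hreg
    have hcolon := h2.sup_ofList_pow n A xs x hlen' hmem' h1
    rw [Ideal.ofList_cons]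
    induction m with
    | zero => rw [zero_add, pow_one, Nat.add_zero, Nat.choose_self, Nat.cast_one, mul_one]
    | succ m ihm =>
      rw [Ideal.length_quotient_eq_add_of_colon (x := x)
        (B := A ⊔ (Ideal.span {x} ⊔ Ideal.ofList xs) ^ (m + 1)), ihm]
      · have h3 : A ⊔ (Ideal.span {x} ⊔ Ideal.ofList xs) ^ (m + 1 + 1) ⊔ Ideal.span {x} =
            A ⊔ Ideal.span {x} ⊔ Ideal.ofList xs ^ (m + 1 + 1) := by
          refine le_antisymm (sup_le (sup_le (le_sup_of_le_left le_sup_left) ?_)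
            (le_sup_of_le_left le_sup_right)) (sup_le (sup_le (le_sup_of_le_left le_sup_left)
            le_sup_right) (le_sup_of_le_left (le_sup_of_le_right ?_)))
          · exact (Ideal.sup_pow_succ_le _ _ _).trans
              (sup_le_sup_right (Ideal.mul_le_left.trans le_sup_right) _)
          · exact Ideal.pow_right_mono le_sup_right _
        have hch : (n + 1 + (m + 1)).choose (n + 1) =
            (n + 1 + m).choose (n + 1) + (n + (m + 1)).choose n := by
          rw [show n + 1 + (m + 1) = (n + 1 + m) + 1 by ring, Nat.choose_succ_succ', add_comm,
            show n + (m + 1) = n + 1 + m by ring]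
        rw [h3, ih _ xs hlen' hmem' hreg.2 (m + 1), sup_assoc, hch, Nat.cast_add, mul_add]
      · intro a
        refine ⟨mem_of_mul_mem_sup_pow (hcolon (m + 1 + 1)), fun ha => ?_⟩
        obtain ⟨a₁, ha₁, e, he, rfl⟩ := Submodule.mem_sup.1 ha
        rw [mul_add]
        refine Submodule.add_mem_sup (A.mul_mem_left x ha₁) ?_
        rw [pow_succ' _ (m + 1)]
        exact Ideal.mul_mem_mul (Ideal.mem_sup_left (Ideal.mem_span_singleton_self x)) he

end Powers

/-! ### Generic complete intersections and symbolic powers -/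

section SymbolicPowers

theorem Ideal.eq_of_length_quotient_eq {R : Type*} [CommRing R] {B D : Ideal R} (h : B ≤ D)
    (hB : Module.length R (R ⧸ B) ≠ ⊤)
    (heq : Module.length R (R ⧸ B) = Module.length R (R ⧸ D)) : B = D := by
  by_contra hne
  rw [Module.length_quotient, Module.length_quotient] at heq
  rw [Module.length_quotient] at hB
  have h1 : Order.coheight D ≤ Order.coheight B := Order.coheight_anti h
  exact (Order.coheight_strictAnti (lt_of_le_of_ne h hne) (h1.trans_lt hB.lt_top)).ne heq.symm

/-- A regular sequence in a local ring is not longer than the dimension. -/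
theorem length_le_ringKrullDim_of_regularSequenceModulo {R : Type*} [CommRing R]
    [IsNoetherianRing R] [IsLocalRing R] {xs : List R}
    (hmem : ∀ x ∈ xs, x ∈ IsLocalRing.maximalIdeal R) (h : RegularSequenceModulo ⊥ xs) :
    (xs.length : WithBot ℕ∞) ≤ ringKrullDim R := by
  obtain ⟨q, hq, -, -⟩ := exists_associatedPrime_le (A := ⊥)
    (IsLocalRing.maximalIdeal.isMaximal R).isPrime bot_le
  obtain ⟨l, -, -, hl⟩ := exists_ltSeries_of_mem_associatedPrimes xs ⊥
    ⟨q, IsAssociatedPrime.isPrime hq⟩ hmem h hq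
  refine le_trans ?_ (Order.LTSeries.length_le_krullDim l)
  exact_mod_cast hl

variable {S : Type*} [CommRing S] {I J : Ideal S}

theorem le_of_mem_associatedPrimes_quotient {p : Ideal S}
    (hp : p ∈ associatedPrimes S (S ⧸ I)) : I ≤ p := by
  have := IsAssociatedPrime.annihilator_le hp
  rwa [Submodule.annihilator_top, Ideal.annihilator_quotient] at this

theorem symbolicPower_le_contractedLocalization (I : Ideal S) (m : ℕ) {p : Ideal S} [hp : p.IsPrime]
    (h : p ∈ associatedPrimes S (S ⧸ I)) : symbolicPower I m ≤ contractedLocalization (I ^ m) p :=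
  iInf_le_of_le p (iInf_le_of_le hp (iInf_le _ h))

theorem pow_le_symbolicPower (I : Ideal S) (m : ℕ) : I ^ m ≤ symbolicPower I m :=
  le_iInf fun _ => le_iInf fun _ => le_iInf fun _ => Ideal.le_comap_map

theorem symbolicPower_le_of_mem_associatedPrimes {m : ℕ} (hm : 1 ≤ m) {p : Ideal S} [p.IsPrime]
    (h : p ∈ associatedPrimes S (S ⧸ I)) : symbolicPower I m ≤ p := by
  refine (symbolicPower_le_contractedLocalization I m h).trans ?_
  refine le_trans (Ideal.comap_mono (Ideal.map_mono ((Ideal.pow_le_self (by omega)).trans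
    (le_of_mem_associatedPrimes_quotient h)))) ?_
  rw [Localization.AtPrime.map_eq_maximalIdeal]
  exact (Localization.AtPrime.under_maximalIdeal (I := p)).le

variable [IsNoetherianRing S]

theorem minimalPrimes_subset_associatedPrimes_quotient (I : Ideal S) {p : Ideal S}
    (hp : p ∈ I.minimalPrimes) : p ∈ associatedPrimes S (S ⧸ I) := by
  apply Module.associatedPrimes.minimalPrimes_annihilator_subset_associatedPrimes S (S ⧸ I)
  rwa [Ideal.annihilator_quotient]

theorem mem_associatedPrimes_quotient_of_le_of_height_le {p : Ideal S} [p.IsPrime] (hle : I ≤ p)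
    (hht : p.height ≤ I.height) : p ∈ associatedPrimes S (S ⧸ I) :=
  minimalPrimes_subset_associatedPrimes_quotient I (Ideal.mem_minimalPrimes_of_height_le hle hht)

/-- If `I_p` is generated by a regular sequence for `p` minimal over `I` of height `c`, this
sequence has length `c`, and the length of `S_p / I_p ^ m` follows. -/
theorem length_quotient_map_pow (hCI : IsGenericallyCI I) {p : Ideal S} [p.IsPrime]
    (hp : p ∈ associatedPrimes S (S ⧸ I)) {c m : ℕ} (hm : 1 ≤ m) (hpc : p.height = c)
    (hIc : I.height = c) :
    Module.length (Localization.AtPrime p)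
        (Localization.AtPrime p ⧸ (I.map (algebraMap S (Localization.AtPrime p))) ^ m) =
      Module.length (Localization.AtPrime p)
        (Localization.AtPrime p ⧸ I.map (algebraMap S (Localization.AtPrime p))) *
        ((c + m - 1).choose c : ℕ∞) := by
  obtain ⟨rs, hreg, hrs⟩ := hCI p hp
  have hR : IsNoetherianRing (Localization.AtPrime p) :=
    IsLocalization.isNoetherianRing p.primeCompl _ inferInstance
  have hIp : I ≤ p := le_of_mem_associatedPrimes_quotient hp
  have hle : Ideal.ofList rs ≤ IsLocalRing.maximalIdeal (Localization.AtPrime p) := by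
    rw [← hrs, ← Localization.AtPrime.map_eq_maximalIdeal]
    exact Ideal.map_mono hIp
  have hmem : ∀ x ∈ rs, x ∈ IsLocalRing.maximalIdeal (Localization.AtPrime p) :=
    fun x hx => hle (Ideal.subset_span hx)
  have hreg' := hreg.toIsWeaklyRegular.regularSequenceModulo_bot
  have hdim : ringKrullDim (Localization.AtPrime p) = (c : ℕ∞) := by
    rw [IsLocalization.AtPrime.ringKrullDim_eq_height p, hpc]
  have hlen : rs.length = c := by
    refine le_antisymm ?_ ?_
    · have h1 := length_le_ringKrullDim_of_regularSequenceModulo hmem hreg'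
      rw [hdim] at h1
      exact_mod_cast h1
    · -- the maximal ideal is minimal over `I_p`, which has `rs.length` generators
      have hmax : IsLocalRing.maximalIdeal (Localization.AtPrime p) ∈
          (Ideal.span {r | r ∈ rs}).minimalPrimes := by
        refine ⟨⟨inferInstance, hle⟩, fun q hq _ => ?_⟩
        have := hq.1
        have h1 : I ≤ q.comap (algebraMap S (Localization.AtPrime p)) := by
          rw [← Ideal.map_le_iff_le_comap, hrs]
          exact hq.2
        have h2 : q.comap (algebraMap S (Localization.AtPrime p)) ≤ p := by
          refine le_trans ?_ (Localization.AtPrime.under_maximalIdeal (I := p)).le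
          exact Ideal.comap_mono (IsLocalRing.le_maximalIdeal hq.1.ne_top)
        have h3 := Ideal.eq_of_le_of_height_le _ h2 (by
          rw [hpc, ← hIc]
          exact Ideal.height_mono h1)
        rw [← Localization.AtPrime.map_eq_maximalIdeal, Ideal.map_le_iff_le_comap]
        exact h3.ge
      have hfin : {r | r ∈ rs}.Finite := List.finite_toSet rs
      have h1 := Ideal.height_le_card_of_mem_minimalPrimes_span hfin hmax
      have h2 : (IsLocalRing.maximalIdeal (Localization.AtPrime p)).height = c := by
        rw [← WithBot.coe_inj, IsLocalRing.maximalIdeal_height_eq_ringKrullDim, hdim]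
      classical
      have h3 : {r | r ∈ rs}.ncard ≤ rs.length := by
        rw [← List.coe_toFinset, Set.ncard_coe_finset]
        exact List.toFinset_card_le rs
      rw [h2] at h1
      exact (by exact_mod_cast h1 : c ≤ _).trans h3
  obtain ⟨m, rfl⟩ : ∃ m', m = m' + 1 := ⟨m - 1, by omega⟩
  have h1 := length_quotient_sup_ofList_pow c ⊥ rs hlen hmem hreg' m
  rw [bot_sup_eq, bot_sup_eq, ← hrs] at h1
  rw [h1]
  rfl

theorem map_le_map_pow_of_le_symbolicPower {m c : ℕ} (hIc : I.height = c)
    (hJ : J ≤ symbolicPower I m) {p : Ideal S} [p.IsPrime] (hpc : p.height = c) :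
    J.map (algebraMap S (Localization.AtPrime p)) ≤
      (I ^ m).map (algebraMap S (Localization.AtPrime p)) := by
  by_cases hIp : I ≤ p
  · rw [Ideal.map_le_iff_le_comap]
    exact hJ.trans (symbolicPower_le_contractedLocalization I m
      (mem_associatedPrimes_quotient_of_le_of_height_le hIp (hpc.trans hIc.symm).le))
  · rw [Ideal.map_pow, Ideal.map_atPrime_eq_top_iff.2 hIp, Ideal.top_pow]
    exact le_top

/-- The primes at which `J` and `I ^ m` are compared are the minimal primes `p` of `J` of height
`c`. Among them, those containing `I` are the associated primes of `S ⧸ I`. The ideals `I^(m)` and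
`J^unm` agree if and only if `J_p = I_p ^ m` at all these primes. -/
theorem symbolicPower_eq_unmixedPart_iff {m c : ℕ} (hm : 1 ≤ m) (hI : IsUnmixedIdeal I)
    (hIc : I.height = c) (hJ : J ≤ symbolicPower I m) (hJc : J.height = c) :
    symbolicPower I m = unmixedPart J ↔
      ∀ p : PrimeSpectrum S, p.asIdeal ∈ J.minimalPrimes → p.asIdeal.height = c →
        J.map (algebraMap S (Localization.AtPrime p.asIdeal)) =
          (I ^ m).map (algebraMap S (Localization.AtPrime p.asIdeal)) := by
  have hass : ∀ p : PrimeSpectrum S, p.asIdeal ∈ associatedPrimes S (S ⧸ I) →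
      p.asIdeal ∈ J.minimalPrimes ∧ p.asIdeal.height = c := fun p hp => by
    have h1 := hI p.asIdeal hp
    refine ⟨Ideal.mem_minimalPrimes_of_height_le
      (hJ.trans (symbolicPower_le_of_mem_associatedPrimes hm hp)) ?_, h1.trans hIc⟩
    rw [h1, hIc, hJc]
  constructor
  · intro heq p hp hpc
    refine le_antisymm (map_le_map_pow_of_le_symbolicPower hIc hJ hpc) ?_
    rw [Ideal.map_le_iff_le_comap]
    refine (pow_le_symbolicPower I m).trans (heq.le.trans ?_)
    exact iInf_le_of_le p.asIdeal (iInf_le_of_le p.2 (iInf_le _ ⟨hp, hpc.trans hJc.symm⟩))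
  · intro heq
    refine le_antisymm ?_ ?_
    · refine le_iInf fun p => le_iInf fun hp => le_iInf fun h => ?_
      have hpc := h.2.trans hJc
      have hloc := heq ⟨p, hp⟩ h.1 hpc
      have hIp : I ≤ p := by
        by_contra hIp
        rw [Ideal.map_pow, Ideal.map_atPrime_eq_top_iff.2 hIp, Ideal.top_pow] at hloc
        exact Ideal.map_atPrime_eq_top_iff.1 hloc h.1.1.2
      have h1 := mem_associatedPrimes_quotient_of_le_of_height_le hIp (hpc.trans hIc.symm).le
      refine (symbolicPower_le_contractedLocalization I m h1).trans ?_
      exact Ideal.comap_mono hloc.ge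
    · refine le_iInf fun p => le_iInf fun hp => le_iInf fun h => ?_
      obtain ⟨h1, h2⟩ := hass ⟨p, hp⟩ h
      refine le_trans (iInf_le_of_le p (iInf_le_of_le hp (iInf_le _ ⟨h1, h2.trans hJc.symm⟩))) ?_
      exact Ideal.comap_mono (heq ⟨p, hp⟩ h1 h2).le

/-- The multiplicity criterion at a maximal ideal `𝔪` containing the relevant minimal primes of
`J`. The associativity formula writes both multiplicities as sums over the minimal primes `p` of
`J` of height `c`, and `length (S_p / J_p) ≥ length (S_p / I_p ^ m)` with equality if and only if
`J_p = I_p ^ m`. -/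
theorem symbolicPower_eq_unmixedPart_iff_multiplicity (hS : IsCohenMacaulayRing S)
    {𝔪 : Ideal S} (h𝔪 : 𝔪.IsMaximal) {m c d : ℕ} (hm : 1 ≤ m) (hI : IsUnmixedIdeal I)
    (hCI : IsGenericallyCI I) (hIc : I.height = c) (hJ : J ≤ symbolicPower I m)
    (hJc : J.height = c) (hJ𝔪 : ∀ p ∈ J.minimalPrimes, p ≤ 𝔪) (hd : 𝔪.height = d + c) :
    ∃ eI eJ : ℝ, HasNormalizedMultiplicity 𝔪 d (S ⧸ I) eI ∧
      HasNormalizedMultiplicity 𝔪 d (S ⧸ J) eJ ∧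
      (symbolicPower I m = unmixedPart J ↔ eJ = eI * ((c + m - 1).choose c : ℝ)) := by
  have hfin : {p : PrimeSpectrum S | p.asIdeal ∈ J.minimalPrimes ∧ p.asIdeal.height = c}.Finite :=
    ((Ideal.finite_minimalPrimes_of_isNoetherianRing S J).subset
      (Set.image_subset_iff.2 fun p hp => hp.1)).of_finite_image
      (fun p _ q _ h => PrimeSpectrum.ext h)
  set T := hfin.toFinset with hT
  have hmemT : ∀ p : PrimeSpectrum S,
      p ∈ T ↔ p.asIdeal ∈ J.minimalPrimes ∧ p.asIdeal.height = c := fun p => by simp [hT]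
  -- the contribution of each prime of `T`
  have hcontrib : ∀ p ∈ T, ∃ e : ℝ, HasNormalizedMultiplicity 𝔪 d (S ⧸ p.asIdeal) e ∧ 0 < e := by
    intro p hp
    obtain ⟨hpJ, hpc⟩ := (hmemT p).1 hp
    have hp𝔪 := hJ𝔪 _ hpJ
    obtain ⟨l, rfl, hl2, hl3⟩ := hS.exists_ltSeries h𝔪 p hp𝔪
    have hlen : l.length = d := by
      rw [hpc, hd] at hl3
      have : d + c = l.length + c := by exact_mod_cast hl3
      omega
    obtain ⟨e, he⟩ := (HilbertSamuelBounded.quotient_prime h𝔪 d _ l.head.2 hp𝔪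
      (by rw [hpc, hd, add_comm])).exists_tendsto h𝔪
    exact ⟨e, he, tendsto_hilbertSamuelFunction_pos h𝔪 l hlen hl2 he⟩
  choose! e he hepos using hcontrib
  have hmin : ∀ p ∈ T, ∀ q : Ideal S, q.IsPrime → J ≤ q → q ≤ p.asIdeal → q = p.asIdeal :=
    fun p hp q hq hJq hqp => hqp.antisymm (((hmemT p).1 hp).1.2 ⟨hq, hJq⟩ hqp)
  -- every other prime over `J` has bigger height and contributes nothing
  have hlow : ∀ q : PrimeSpectrum S, J ≤ q.asIdeal → q.asIdeal ≤ 𝔪 → q ∉ T →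
      HasNormalizedMultiplicity 𝔪 d (S ⧸ q.asIdeal) 0 := by
    intro q hJq hq𝔪 hqT
    have hcq : (c : ℕ∞) < q.asIdeal.height := by
      refine lt_of_le_of_ne (hJc ▸ Ideal.height_mono hJq) fun heq => hqT ((hmemT q).2 ⟨?_, heq.symm⟩)
      exact Ideal.mem_minimalPrimes_of_height_le hJq (by rw [hJc, heq])
    have h𝔪p := h𝔪.isPrime
    obtain ⟨n, hn⟩ := ENat.ne_top_iff_exists.1 (Ideal.height_ne_top_of_isPrime (I := q.asIdeal))
    have h1 := Ideal.height_mono hq𝔪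
    rw [← hn] at hcq h1
    rw [hd] at h1
    have h2 : c < n := by exact_mod_cast hcq
    have h3 : n ≤ d + c := by exact_mod_cast h1
    refine .of_bounded h𝔪 (show d - 1 < d by omega)
      (HilbertSamuelBounded.quotient_prime h𝔪 (d - 1) _ q.2 hq𝔪 ?_)
    rw [hd, ← hn]
    exact_mod_cast (show d + c ≤ n + (d - 1) by omega)
  have hIJ : ∀ q : Ideal S, q.IsPrime → I ≤ q → J ≤ q := fun q hq hIq => by
    obtain ⟨p, hp, hpq⟩ := Ideal.exists_minimalPrimes_le hIq
    have := hp.1.1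
    exact (hJ.trans (symbolicPower_le_of_mem_associatedPrimes hm
      (minimalPrimes_subset_associatedPrimes_quotient I hp))).trans hpq
  have hkill : ∀ L : Ideal S, ∀ a ∈ L, ∀ x : S ⧸ L, a • x = 0 := fun L a ha x => by
    obtain ⟨x, rfl⟩ := Ideal.Quotient.mk_surjective x
    rw [Algebra.smul_def]
    exact Ideal.Quotient.eq_zero_iff_mem.2 (L.mul_mem_right x ha)
  obtain ⟨fI, mI⟩ := hasNormalizedMultiplicity_sum h𝔪 I T e
    (fun p hp q hq hIq => hmin p hp q hq (hIJ q hq hIq)) he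
    (fun q hIq => hlow q (hIJ _ q.2 hIq)) (M := S ⧸ I) inferInstance (hkill I)
  obtain ⟨fJ, mJ⟩ := hasNormalizedMultiplicity_sum h𝔪 J T e hmin he hlow (M := S ⧸ J)
    inferInstance (hkill J)
  refine ⟨_, _, mI, mJ, ?_⟩
  rw [symbolicPower_eq_unmixedPart_iff hm hI hIc hJ hJc, Finset.sum_mul]
  -- the length of `S_p / I_p ^ m`
  have hpow : ∀ p ∈ T, Module.length (Localization.AtPrime p.asIdeal)
      (Localization.AtPrime p.asIdeal ⧸
        (I ^ m).map (algebraMap S (Localization.AtPrime p.asIdeal))) =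
      localizedLength p.asIdeal (S ⧸ I) * ((c + m - 1).choose c : ℕ∞) := by
    intro p hp
    have hpc := ((hmemT p).1 hp).2
    rw [localizedLength_quotient, Ideal.map_pow]
    by_cases hIp : I ≤ p.asIdeal
    · exact length_quotient_map_pow hCI (mem_associatedPrimes_quotient_of_le_of_height_le hIp
        (hpc.trans hIc.symm).le) hm hpc hIc
    · rw [Ideal.map_atPrime_eq_top_iff.2 hIp, Ideal.top_pow]
      have : Subsingleton (Localization.AtPrime p.asIdeal ⧸
        (⊤ : Ideal (Localization.AtPrime p.asIdeal))) := Submodule.Quotient.subsingleton_iff.2 rfl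
      rw [Module.length_eq_zero, zero_mul]
  have hterm : ∀ p ∈ T,
      ((localizedLength p.asIdeal (S ⧸ I)).toNat : ℝ) * e p * ((c + m - 1).choose c : ℝ) ≤
        ((localizedLength p.asIdeal (S ⧸ J)).toNat : ℝ) * e p ∧
      (((localizedLength p.asIdeal (S ⧸ I)).toNat : ℝ) * e p * ((c + m - 1).choose c : ℝ) =
        ((localizedLength p.asIdeal (S ⧸ J)).toNat : ℝ) * e p ↔
      J.map (algebraMap S (Localization.AtPrime p.asIdeal)) =
          (I ^ m).map (algebraMap S (Localization.AtPrime p.asIdeal))) := by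
    intro p hp
    have hle := map_le_map_pow_of_le_symbolicPower hIc hJ ((hmemT p).1 hp).2
    have hfJ := fJ p hp
    have h1 := hpow p hp
    have h2 : Module.length (Localization.AtPrime p.asIdeal)
        (Localization.AtPrime p.asIdeal ⧸
          (I ^ m).map (algebraMap S (Localization.AtPrime p.asIdeal))) ≤
        localizedLength p.asIdeal (S ⧸ J) := by
      rw [localizedLength_quotient]
      exact Module.length_le_of_surjective (Submodule.factor hle) (Submodule.factor_surjective hle)
    have h3 : (localizedLength p.asIdeal (S ⧸ I)).toNat * (c + m - 1).choose c =
        (localizedLength p.asIdeal (S ⧸ I) * ((c + m - 1).choose c : ℕ∞)).toNat := by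
      rw [ENat.toNat_mul, ENat.toNat_natCast]
    have h4 : (localizedLength p.asIdeal (S ⧸ I)).toNat * (c + m - 1).choose c ≤
        (localizedLength p.asIdeal (S ⧸ J)).toNat := by
      rw [h3, ← h1]
      exact ENat.toNat_le_toNat h2 hfJ
    have h4' : ((localizedLength p.asIdeal (S ⧸ I)).toNat : ℝ) * ((c + m - 1).choose c : ℝ) ≤
        ((localizedLength p.asIdeal (S ⧸ J)).toNat : ℝ) := by exact_mod_cast h4
    rw [mul_right_comm]
    refine ⟨mul_le_mul_of_nonneg_right h4' (hepos p hp).le, ?_⟩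
    rw [mul_left_inj' (hepos p hp).ne']
    constructor
    · intro heq
      have heq' : (localizedLength p.asIdeal (S ⧸ I)).toNat * (c + m - 1).choose c =
        (localizedLength p.asIdeal (S ⧸ J)).toNat := by exact_mod_cast heq
      rw [h3, ← h1] at heq'
      have h5 := congrArg (Nat.cast : ℕ → ℕ∞) heq'
      rw [ENat.natCast_toNat_eq_self.2 (ne_top_of_le_ne_top hfJ h2),
        ENat.natCast_toNat_eq_self.2 hfJ] at h5
      rw [localizedLength_quotient] at h5 hfJ
      exact Ideal.eq_of_length_quotient_eq hle hfJ h5.symm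
    · intro heq
      rw [localizedLength_quotient p.asIdeal J, heq, h1, ← h3]
      push_cast
      rfl
  rw [eq_comm (b := ∑ p ∈ T, _ * _ * _), Finset.sum_eq_sum_iff_of_le fun p hp => (hterm p hp).1]
  constructor
  · intro h p hp
    exact (hterm p hp).2.2 (h p ((hmemT p).1 hp).1 ((hmemT p).1 hp).2)
  · intro h p hp1 hp2
    have hp := (hmemT p).2 ⟨hp1, hp2⟩
    exact (hterm p hp).2.1 (h p hp)

end SymbolicPowers

/-! ### The local case -/

section Dimension

variable {S : Type*} [CommRing S]

theorem natKrullDim_quotient_eq {L : Ideal S} {d : ℕ}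
    (hle : ∀ l : LTSeries (PrimeSpectrum S), L ≤ l.head.asIdeal → l.length ≤ d)
    (l : LTSeries (PrimeSpectrum S)) (hl : L ≤ l.head.asIdeal) (hd : l.length = d) :
    natKrullDim (S ⧸ L) = d := by
  have key : ringKrullDim (S ⧸ L) = (d : ℕ∞) := by
    rw [ringKrullDim_quotient]
    apply le_antisymm
    · refine iSup_le fun l' => ?_
      have := hle (l'.map (fun x => x.1) fun _ _ h => h) (SetLike.coe_subset_coe.1 l'.head.2)
      exact_mod_cast this
    · have hmem : ∀ i, l i ∈ PrimeSpectrum.zeroLocus (R := S) L := fun i =>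
        SetLike.coe_subset_coe.2 (hl.trans (l.monotone (Fin.zero_le i)))
      let l' : LTSeries (PrimeSpectrum.zeroLocus (R := S) L) :=
        ⟨l.length, fun i => ⟨l i, hmem i⟩, fun i => l.step i⟩
      have := Order.LTSeries.length_le_krullDim l'
      rw [← hd]
      exact_mod_cast this
  rw [natKrullDim, key]
  rfl

/-- If all minimal primes of `L` lie in the maximal ideal `𝔪` of a Cohen–Macaulay ring, there is a
chain of primes above `L` of length `ht 𝔪 - ht L`, starting at a minimal prime of height `ht L`. -/
theorem IsCohenMacaulayRing.exists_ltSeries_le (hS : IsCohenMacaulayRing S) {𝔪 : Ideal S}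
    (h𝔪 : 𝔪.IsMaximal) {L : Ideal S} {c d : ℕ} (hLc : L.height = c)
    (hL𝔪 : ∀ p ∈ L.minimalPrimes, p ≤ 𝔪) (hd : 𝔪.height = d + c) :
    ∃ l : LTSeries (PrimeSpectrum S), L ≤ l.head.asIdeal ∧ l.length = d := by
  have := hS.isNoetherianRing
  obtain ⟨p, hp, hLp, hpc⟩ := Ideal.exists_isPrime_height_eq hLc
  have hpmin : p ∈ L.minimalPrimes := Ideal.mem_minimalPrimes_of_height_le hLp (by rw [hpc, hLc])
  obtain ⟨l, h1, -, h2⟩ := hS.exists_ltSeries h𝔪 ⟨p, hp⟩ (hL𝔪 p hpmin)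
  refine ⟨l, by rw [h1]; exact hLp, ?_⟩
  rw [hd, hpc] at h2
  have : d + c = l.length + c := by exact_mod_cast h2
  omega

theorem exists_height_eq_add [IsNoetherianRing S] {𝔪 L : Ideal S} (h𝔪 : 𝔪.IsMaximal) {c : ℕ}
    (hL : L ≤ 𝔪) (hLc : L.height = c) : ∃ d : ℕ, 𝔪.height = d + c := by
  have := h𝔪.isPrime
  obtain ⟨n, hn⟩ := ENat.ne_top_iff_exists.1 (Ideal.height_ne_top_of_isPrime (I := 𝔪))
  have h := Ideal.height_mono hL
  rw [← hn, hLc] at h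
  have h' : c ≤ n := by exact_mod_cast h
  refine ⟨n - c, ?_⟩
  rw [← hn]
  exact_mod_cast (Nat.sub_add_cancel h').symm

end Dimension

section LocalCase

variable {S : Type*} [CommRing S]

theorem Submodule.length_quotient_restrictScalars {R A M : Type*} [CommRing R] [CommRing A]
    [Algebra R A] [AddCommGroup M] [Module R M] [Module A M] [IsScalarTower R A M]
    (h : Function.Surjective (algebraMap R A)) (K : Submodule A M) :
    Module.length R (M ⧸ K.restrictScalars R) = Module.length A (M ⧸ K) :=
  (Submodule.Quotient.restrictScalarsEquiv R K).length_eq.trans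
    (Module.length_eq_of_surjective h)

/-- The length of `(S ⧸ L) ⧸ 𝔪 ^ t (S ⧸ L)` is the same over `S` and over `S ⧸ L`. -/
theorem toNat_length_quotient_map_pow (𝔪 L : Ideal S) (t : ℕ) :
    (Module.length (S ⧸ L) ((S ⧸ L) ⧸ 𝔪.map (Ideal.Quotient.mk L) ^ t)).toNat =
      hilbertSamuelFunction 𝔪 (S ⧸ L) t := by
  have h : (𝔪 ^ t • ⊤ : Submodule S (S ⧸ L)) =
      (𝔪.map (Ideal.Quotient.mk L) ^ t).restrictScalars S := by
    rw [← Ideal.map_pow]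
    exact Ideal.smul_top_eq_map (𝔪 ^ t)
  rw [hilbertSamuelFunction, h, Submodule.length_quotient_restrictScalars
    (show Function.Surjective (algebraMap S (S ⧸ L)) from Ideal.Quotient.mk_surjective)]

theorem HasNormalizedMultiplicity.hilbertSamuelMultiplicity_eq {𝔪 L : Ideal S} {d : ℕ} {e : ℝ}
    (h : HasNormalizedMultiplicity 𝔪 d (S ⧸ L) e) (hd : natKrullDim (S ⧸ L) = d) :
    hilbertSamuelMultiplicity (𝔪.map (Ideal.Quotient.mk L)) = d.factorial * e := by
  refine Tendsto.limUnder_eq (f := atTop) ?_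
  rw [hd]
  refine (Tendsto.const_mul (d.factorial : ℝ) h).congr fun t => ?_
  rw [toNat_length_quotient_map_pow]
  ring

theorem LTSeries.length_le_of_height_le [IsNoetherianRing S] [IsLocalRing S]
    {L : Ideal S} {c d : ℕ} (hLc : L.height = c)
    (hd : (IsLocalRing.maximalIdeal S).height = d + c) (l : LTSeries (PrimeSpectrum S))
    (hl : L ≤ l.head.asIdeal) : l.length ≤ d := by
  have h1 := LTSeries.length_add_height_head_le l
  have h2 := Ideal.height_mono hl
  have h3 := Ideal.height_mono (IsLocalRing.le_maximalIdeal l.last.isPrime.ne_top)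
  have h4 : (l.length : ℕ∞) + c ≤ d + c := by
    rw [← hd, ← hLc]
    exact (add_le_add le_rfl h2).trans (h1.trans h3)
  have h5 : l.length + c ≤ d + c := by exact_mod_cast h4
  omega

theorem symbolicPower_eq_unmixedPart_iff_localMultiplicity [IsLocalRing S]
    (hS : IsCohenMacaulayRing S) {I J : Ideal S} {m c : ℕ} (hm : 1 ≤ m) (hI : IsUnmixedIdeal I)
    (hCI : IsGenericallyCI I) (hIc : I.height = c) (hJ : J ≤ symbolicPower I m)
    (hJc : J.height = c) :
    symbolicPower I m = unmixedPart J ↔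
      localMultiplicity J = localMultiplicity I * ((c + m - 1).choose c : ℝ) := by
  have := hS.isNoetherianRing
  have hm' := IsLocalRing.maximalIdeal.isMaximal S
  have hle : ∀ L : Ideal S, L.height = c → ∀ p ∈ L.minimalPrimes,
      p ≤ IsLocalRing.maximalIdeal S := fun L _ p hp =>
    IsLocalRing.le_maximalIdeal hp.1.1.ne_top
  have hJtop : J ≠ ⊤ := fun h => by
    rw [h, Ideal.height_top] at hJc
    exact ENat.top_ne_natCast _ hJc
  obtain ⟨d, hd⟩ := exists_height_eq_add hm' (IsLocalRing.le_maximalIdeal hJtop) hJc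
  have hdim : ∀ L : Ideal S, L.height = c → natKrullDim (S ⧸ L) = d := fun L hL => by
    obtain ⟨l, hl, hld⟩ := hS.exists_ltSeries_le hm' hL (hle L hL) hd
    exact natKrullDim_quotient_eq (LTSeries.length_le_of_height_le hL hd) l hl hld
  obtain ⟨eI, eJ, hmI, hmJ, h⟩ := symbolicPower_eq_unmixedPart_iff_multiplicity hS hm' hm hI hCI
    hIc hJ hJc (hle J hJc) hd
  rw [h, localMultiplicity, localMultiplicity, hmI.hilbertSamuelMultiplicity_eq (hdim I hIc),
    hmJ.hilbertSamuelMultiplicity_eq (hdim J hJc), mul_assoc,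
    mul_right_inj' (by exact_mod_cast d.factorial_ne_zero)]

end LocalCase

/-! ### Standard graded algebras -/

section Graded

variable {k S : Type*} [Field k] [CommRing S] [Algebra k S] (𝒜 : ℕ → Submodule k S)
  [GradedAlgebra 𝒜]

theorem GradedAlgebra.proj_mul (x y : S) (n : ℕ) :
    GradedAlgebra.proj 𝒜 n (x * y) = ∑ ij ∈ Finset.HasAntidiagonal.antidiagonal n,
      GradedAlgebra.proj 𝒜 ij.1 x * GradedAlgebra.proj 𝒜 ij.2 y := by
  simp only [GradedAlgebra.proj_apply, DirectSum.decompose_mul,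
    DirectSum.coe_mul_apply_eq_sum_antidiagonal]

theorem GradedAlgebra.proj_mem (x : S) (n : ℕ) : GradedAlgebra.proj 𝒜 n x ∈ 𝒜 n := by
  rw [GradedAlgebra.proj_apply]
  exact SetLike.coe_mem _

theorem GradedAlgebra.proj_of_mem {x : S} {n : ℕ} (hx : x ∈ 𝒜 n) :
    GradedAlgebra.proj 𝒜 n x = x := by
  rw [GradedAlgebra.proj_apply, DirectSum.decompose_of_mem_same _ hx]

theorem GradedAlgebra.proj_of_mem_ne {x : S} {n i : ℕ} (hx : x ∈ 𝒜 n) (h : n ≠ i) :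
    GradedAlgebra.proj 𝒜 i x = 0 := by
  rw [GradedAlgebra.proj_apply, DirectSum.decompose_of_mem_ne _ hx h]

theorem GradedAlgebra.exists_sum_proj_eq (x : S) :
    ∃ N : ℕ, ∀ n, N ≤ n → ∑ i ∈ Finset.range n, GradedAlgebra.proj 𝒜 i x = x ∧
      GradedAlgebra.proj 𝒜 n x = 0 := by
  classical
  obtain ⟨N, hN⟩ := (DirectSum.decompose 𝒜 x).support.exists_nat_subset_range
  have h0 : ∀ n, N ≤ n → GradedAlgebra.proj 𝒜 n x = 0 := fun n hn => by
    by_contra h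
    rw [← Ne, ← GradedAlgebra.mem_support_iff] at h
    exact absurd (Finset.mem_range.1 (hN h)) (by omega)
  refine ⟨N, fun n hn => ⟨?_, h0 n hn⟩⟩
  conv_rhs => rw [← DirectSum.sum_support_decompose 𝒜 x]
  refine (Finset.sum_subset (fun i hi => ?_) fun i _ hi => ?_).symm
  · exact Finset.mem_range.2 ((Finset.mem_range.1 (hN hi)).trans_le hn)
  · simpa using hi

/-- The elements of degree less than `N` of a graded algebra: the `k`-submodule
`⨁ i < N, 𝒜 i`. -/
def GradedAlgebra.degreeLT (N : ℕ) : Submodule k S :=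
  ⨅ i ≥ N, LinearMap.ker (GradedAlgebra.proj 𝒜 i)

open GradedAlgebra

theorem GradedAlgebra.mem_degreeLT {N : ℕ} {x : S} :
    x ∈ degreeLT 𝒜 N ↔ ∀ i, N ≤ i → proj 𝒜 i x = 0 := by
  simp [degreeLT, Submodule.mem_iInf]

theorem GradedAlgebra.degreeLT_mono {M N : ℕ} (h : M ≤ N) : degreeLT 𝒜 M ≤ degreeLT 𝒜 N :=
  fun _ hx => (mem_degreeLT 𝒜).2 fun i hi => (mem_degreeLT 𝒜).1 hx i (h.trans hi)

theorem GradedAlgebra.exists_mem_degreeLT (x : S) : ∃ N, x ∈ degreeLT 𝒜 N := by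
  obtain ⟨N, hN⟩ := exists_sum_proj_eq 𝒜 x
  exact ⟨N, (mem_degreeLT 𝒜).2 fun i hi => (hN i hi).2⟩

theorem GradedAlgebra.exists_subset_degreeLT {s : Set S} (hs : s.Finite) :
    ∃ N, s ⊆ degreeLT 𝒜 N := by
  choose N hN using exists_mem_degreeLT 𝒜
  obtain ⟨B, hB⟩ := (hs.image N).bddAbove
  exact ⟨B, fun x hx => degreeLT_mono 𝒜 (hB ⟨x, hx, rfl⟩) (hN x)⟩

theorem GradedAlgebra.mul_mem_degreeLT {M N : ℕ} {x y : S} (hx : x ∈ degreeLT 𝒜 M)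
    (hy : y ∈ degreeLT 𝒜 N) : x * y ∈ degreeLT 𝒜 (M + N) := by
  rw [mem_degreeLT] at *
  intro i hi
  rw [proj_mul]
  refine Finset.sum_eq_zero fun ij hij => ?_
  have := Finset.HasAntidiagonal.mem_antidiagonal.1 hij
  by_cases h : M ≤ ij.1
  · rw [hx _ h, zero_mul]
  · rw [hy _ (by omega), mul_zero]

theorem GradedAlgebra.sum_proj_of_mem_degreeLT {N : ℕ} {x : S} (hx : x ∈ degreeLT 𝒜 N) :
    ∑ i ∈ Finset.range N, proj 𝒜 i x = x := by
  obtain ⟨M, hM⟩ := exists_sum_proj_eq 𝒜 x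
  conv_rhs => rw [← (hM (max M N) (le_max_left _ _)).1]
  refine Finset.sum_subset (fun i hi => ?_) fun i _ hi => ?_
  · exact Finset.mem_range.2 ((Finset.mem_range.1 hi).trans_le (le_max_right _ _))
  · exact (mem_degreeLT 𝒜).1 hx i (by simpa using hi)

/-- The irrelevant ideal `⨁ i > 0, 𝒜 i`. -/
abbrev irrelevantIdeal : Ideal S := (HomogeneousIdeal.irrelevant 𝒜).toIdeal

theorem mem_irrelevantIdeal {x : S} : x ∈ irrelevantIdeal 𝒜 ↔ proj 𝒜 0 x = 0 := by
  rw [HomogeneousIdeal.mem_iff, HomogeneousIdeal.mem_irrelevant_iff]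
  rfl

theorem proj_eq_zero_of_mem_irrelevantIdeal_pow (t : ℕ) :
    ∀ {x : S}, x ∈ irrelevantIdeal 𝒜 ^ t → ∀ i < t, proj 𝒜 i x = 0 := by
  induction t with
  | zero => intro x _ i hi; omega
  | succ t ih =>
    intro x hx i hi
    rw [pow_succ] at hx
    induction hx using Submodule.mul_induction_on' with
    | mem_mul_mem a ha b hb =>
      rw [proj_mul]
      refine Finset.sum_eq_zero fun ij hij => ?_
      have := Finset.HasAntidiagonal.mem_antidiagonal.1 hij
      by_cases h : ij.1 < t
      · rw [ih ha _ h, zero_mul]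
      · rw [show ij.2 = 0 by omega, (mem_irrelevantIdeal 𝒜).1 hb, mul_zero]
    | add a _ b _ h1 h2 => rw [map_add, h1, h2, add_zero]

variable {𝒜}

theorem Ideal.IsHomogeneous.proj_mem {L : Ideal S} (hL : L.IsHomogeneous 𝒜) {x : S} (hx : x ∈ L)
    (i : ℕ) : proj 𝒜 i x ∈ L := by
  rw [GradedAlgebra.proj_apply]
  exact hL i hx

theorem IsStandardGraded.exists_sub_algebraMap_mem (h𝒜 : IsStandardGraded 𝒜) (x : S) :
    ∃ a : k, proj 𝒜 0 x = algebraMap k S a ∧ x - algebraMap k S a ∈ irrelevantIdeal 𝒜 := by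
  have h := GradedAlgebra.proj_mem 𝒜 x 0
  have h' := h
  rw [h𝒜.zero_eq, Submodule.mem_one] at h'
  obtain ⟨a, ha⟩ := h'
  refine ⟨a, ha.symm, ?_⟩
  rw [mem_irrelevantIdeal, map_sub, ha, GradedAlgebra.proj_of_mem 𝒜 h, sub_self]

theorem IsStandardGraded.eq_top_of_proj_zero_mem (h𝒜 : IsStandardGraded 𝒜) {L : Ideal S} {x : S}
    (hx : proj 𝒜 0 x ≠ 0) (hL : proj 𝒜 0 x ∈ L) : L = ⊤ := by
  obtain ⟨a, ha, -⟩ := h𝒜.exists_sub_algebraMap_mem x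
  rw [ha] at hx hL
  refine L.eq_top_of_isUnit_mem hL (IsUnit.map _ (IsUnit.mk0 a ?_))
  rintro rfl
  exact hx (map_zero _)

theorem IsStandardGraded.irrelevantIdeal_isMaximal [Nontrivial S] (h𝒜 : IsStandardGraded 𝒜) :
    (irrelevantIdeal 𝒜).IsMaximal := by
  refine Ideal.isMaximal_iff.2 ⟨fun h => ?_, fun L x hL hx hxL => ?_⟩
  · rw [mem_irrelevantIdeal, GradedAlgebra.proj_of_mem 𝒜 (SetLike.GradedOne.one_mem)] at h
    exact one_ne_zero h
  · rw [mem_irrelevantIdeal] at hx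
    have h1 : proj 𝒜 0 x ∈ L := by
      have h2 : x - proj 𝒜 0 x ∈ irrelevantIdeal 𝒜 := by
        rw [mem_irrelevantIdeal, map_sub,
          GradedAlgebra.proj_of_mem 𝒜 (GradedAlgebra.proj_mem 𝒜 x 0), sub_self]
      simpa using L.sub_mem hxL (hL h2)
    rw [h𝒜.eq_top_of_proj_zero_mem hx h1]
    trivial

theorem IsStandardGraded.le_irrelevantIdeal (h𝒜 : IsStandardGraded 𝒜) {L : Ideal S}
    (hL : L.IsHomogeneous 𝒜) (hne : L ≠ ⊤) : L ≤ irrelevantIdeal 𝒜 := fun x hx => by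
  by_contra h
  rw [mem_irrelevantIdeal] at h
  exact hne (h𝒜.eq_top_of_proj_zero_mem h (hL.proj_mem hx 0))

theorem Ideal.IsHomogeneous.of_mem_minimalPrimes {L p : Ideal S} (hL : L.IsHomogeneous 𝒜)
    (hp : p ∈ L.minimalPrimes) : p.IsHomogeneous 𝒜 := by
  have h1 : L ≤ (p.homogeneousCore 𝒜).toIdeal := by
    rw [← hL.toIdeal_homogeneousCore_eq_self]
    exact Ideal.homogeneousCore_mono 𝒜 hp.1.2
  rw [Ideal.IsHomogeneous.iff_eq]
  exact le_antisymm (Ideal.toIdeal_homogeneousCore_le 𝒜 p)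
    (hp.2 ⟨Ideal.IsPrime.homogeneousCore hp.1.1, h1⟩ (Ideal.toIdeal_homogeneousCore_le 𝒜 p))

/-- In a standard graded algebra, forms of degree `t` lie in the `t`-th power of the irrelevant
ideal. -/
theorem IsStandardGraded.proj_mem_pow (h𝒜 : IsStandardGraded 𝒜) (x : S) (t : ℕ) :
    proj 𝒜 t x ∈ irrelevantIdeal 𝒜 ^ t := by
  have hx : x ∈ Algebra.adjoin k (𝒜 1 : Set S) := by
    rw [h𝒜.adjoin_eq]
    trivial
  induction hx using Algebra.adjoin_induction generalizing t with
  | mem x hx =>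
    rcases eq_or_ne t 1 with rfl | ht
    · rw [pow_one, GradedAlgebra.proj_of_mem 𝒜 hx, mem_irrelevantIdeal,
        GradedAlgebra.proj_of_mem_ne 𝒜 hx one_ne_zero]
    · rw [GradedAlgebra.proj_of_mem_ne 𝒜 hx ht.symm]
      exact Submodule.zero_mem _
  | algebraMap a =>
    have ha : algebraMap k S a ∈ 𝒜 0 := by
      rw [h𝒜.zero_eq]
      exact Submodule.mem_one.2 ⟨a, rfl⟩
    rcases eq_or_ne t 0 with rfl | ht
    · simp
    · rw [GradedAlgebra.proj_of_mem_ne 𝒜 ha ht.symm]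
      exact Submodule.zero_mem _
  | add x y _ _ hx hy =>
    rw [map_add]
    exact Submodule.add_mem _ (hx t) (hy t)
  | mul x y _ _ hx hy =>
    rw [GradedAlgebra.proj_mul]
    refine Submodule.sum_mem _ fun ij hij => ?_
    rw [← Finset.HasAntidiagonal.mem_antidiagonal.1 hij, pow_add]
    exact Ideal.mul_mem_mul (hx _) (hy _)

theorem IsStandardGraded.mem_irrelevantIdeal_pow (h𝒜 : IsStandardGraded 𝒜) {x : S} {t : ℕ} :
    x ∈ irrelevantIdeal 𝒜 ^ t ↔ ∀ i < t, proj 𝒜 i x = 0 := by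
  refine ⟨proj_eq_zero_of_mem_irrelevantIdeal_pow 𝒜 t, fun h => ?_⟩
  obtain ⟨N, hN⟩ := GradedAlgebra.exists_sum_proj_eq 𝒜 x
  rw [← (hN N le_rfl).1]
  refine Submodule.sum_mem _ fun i _ => ?_
  by_cases hi : i < t
  · rw [h i hi]
    exact Submodule.zero_mem _
  · exact Ideal.pow_le_pow_right (not_lt.1 hi) (h𝒜.proj_mem_pow x i)

end Graded

section Length

variable {k S M : Type*} [Field k] [CommRing S] [Algebra k S] [AddCommGroup M] [Module k M]
  [Module S M] [IsScalarTower k S M]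

/-- If every element of `S` acts on `M` as a scalar of `k`, then `M` has the same submodules,
hence the same length, over `S` and over `k`. -/
theorem Module.length_eq_of_forall_smul_eq (h : ∀ s : S, ∃ a : k, ∀ x : M, s • x = a • x) :
    Module.length S M = Module.length k M := by
  rw [Module.length, Module.length, WithBot.unbot_inj]
  refine Order.krullDim_eq_of_orderIso (RelIso.ofSurjective
    (Submodule.restrictScalarsEmbedding k S M) fun N => ?_)
  refine ⟨⟨N.toAddSubmonoid, fun s x hx => ?_⟩, rfl⟩
  obtain ⟨a, ha⟩ := h s
  rw [ha]
  exact N.smul_mem a hx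

theorem Module.length_le_length_of_isScalarTower :
    Module.length S M ≤ Module.length k M := by
  rw [← WithBot.coe_le_coe, Module.coe_length, Module.coe_length]
  exact Order.krullDim_le_of_orderEmbedding (Submodule.restrictScalarsEmbedding k S M)

end Length

/-! ### Hilbert functions and Hilbert–Samuel functions -/

section HilbertFunction

open GradedAlgebra

theorem Ideal.mk_mem_smul_top_iff {S : Type*} [CommRing S] (I L : Ideal S) (x : S) :
    Ideal.Quotient.mk L x ∈ (I • ⊤ : Submodule S (S ⧸ L)) ↔ ∃ y ∈ I, x - y ∈ L := by
  rw [Ideal.smul_top_eq_map, Submodule.restrictScalars_mem, Ideal.Quotient.algebraMap_eq,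
    Ideal.mem_map_iff_of_surjective _ Ideal.Quotient.mk_surjective]
  refine exists_congr fun y => and_congr_right fun _ => ?_
  rw [eq_comm, Ideal.Quotient.mk_eq_mk_iff_sub_mem]

variable {k S : Type*} [Field k] [CommRing S] [Algebra k S] {𝒜 : ℕ → Submodule k S}
  [GradedAlgebra 𝒜]

variable (𝒜) in
/-- The degree `t` component of `S ⧸ L`: the image of `𝒜 t`. -/
abbrev gradedComponent (L : Ideal S) (t : ℕ) : Submodule k (S ⧸ L) :=
  (𝒜 t).map (Ideal.Quotient.mkₐ k L).toLinearMap

theorem IsStandardGraded.gradedComponent_le (h𝒜 : IsStandardGraded 𝒜) (L : Ideal S) (t : ℕ) :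
    gradedComponent 𝒜 L t ≤
      (irrelevantIdeal 𝒜 ^ t • ⊤ : Submodule S (S ⧸ L)).restrictScalars k := by
  rintro _ ⟨x, hx, rfl⟩
  refine (Ideal.mk_mem_smul_top_iff _ _ _).2 ⟨x, ?_, by rw [sub_self]; exact L.zero_mem⟩
  rw [← GradedAlgebra.proj_of_mem 𝒜 hx]
  exact h𝒜.proj_mem_pow x t

/-- The degree `t` component of `S ⧸ L` maps to the quotient of consecutive powers of the
irrelevant ideal. -/
def IsStandardGraded.toGradedPiece (h𝒜 : IsStandardGraded 𝒜) (L : Ideal S) (t : ℕ) :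
    gradedComponent 𝒜 L t →ₗ[k] GradedPiece (irrelevantIdeal 𝒜) (S ⧸ L) t :=
  { toFun := fun z => Submodule.Quotient.mk ⟨z.1, h𝒜.gradedComponent_le L t z.2⟩
    map_add' := fun _ _ => rfl
    map_smul' := fun _ _ => rfl }

theorem IsStandardGraded.toGradedPiece_eq_mk_iff (h𝒜 : IsStandardGraded 𝒜) (L : Ideal S) (t : ℕ)
    (z : gradedComponent 𝒜 L t) (w : ↥(irrelevantIdeal 𝒜 ^ t • ⊤ : Submodule S (S ⧸ L))) :
    h𝒜.toGradedPiece L t z = Submodule.mkQ _ w ↔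
      (z : S ⧸ L) - w ∈ (irrelevantIdeal 𝒜 ^ (t + 1) • ⊤ : Submodule S (S ⧸ L)) :=
  Submodule.Quotient.eq _

theorem IsStandardGraded.toGradedPiece_bijective (h𝒜 : IsStandardGraded 𝒜) {L : Ideal S}
    (hL : L.IsHomogeneous 𝒜) (t : ℕ) : Function.Bijective (h𝒜.toGradedPiece L t) := by
  constructor
  · rw [injective_iff_map_eq_zero]
    rintro ⟨_, x, hx, rfl⟩ h
    rw [← map_zero (Submodule.mkQ _), h𝒜.toGradedPiece_eq_mk_iff, ZeroMemClass.coe_zero,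
      sub_zero] at h
    have h1 : Ideal.Quotient.mk L x ∈
        (irrelevantIdeal 𝒜 ^ (t + 1) • ⊤ : Submodule S (S ⧸ L)) := h
    obtain ⟨y, hy, hxy⟩ := (Ideal.mk_mem_smul_top_iff _ _ _).1 h1
    have h2 := hL.proj_mem hxy t
    rw [map_sub, GradedAlgebra.proj_of_mem 𝒜 hx,
      proj_eq_zero_of_mem_irrelevantIdeal_pow 𝒜 (t + 1) hy t (Nat.lt_succ_self t), sub_zero] at h2
    exact Subtype.ext (Ideal.Quotient.eq_zero_iff_mem.2 h2)
  · intro z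
    obtain ⟨⟨z, hz⟩, rfl⟩ := Submodule.mkQ_surjective _ z
    obtain ⟨x, rfl⟩ := Ideal.Quotient.mk_surjective z
    obtain ⟨y, hy, hxy⟩ := (Ideal.mk_mem_smul_top_iff _ _ _).1 hz
    refine ⟨⟨Ideal.Quotient.mk L (proj 𝒜 t y), proj 𝒜 t y, GradedAlgebra.proj_mem 𝒜 y t, rfl⟩, ?_⟩
    rw [h𝒜.toGradedPiece_eq_mk_iff]
    change Ideal.Quotient.mk L (proj 𝒜 t y) - Ideal.Quotient.mk L x ∈
      (irrelevantIdeal 𝒜 ^ (t + 1) • ⊤ : Submodule S (S ⧸ L))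
    rw [← map_sub, Ideal.mk_mem_smul_top_iff]
    refine ⟨proj 𝒜 t y - y, ?_, ?_⟩
    · rw [h𝒜.mem_irrelevantIdeal_pow]
      intro i hi
      rw [map_sub]
      rcases eq_or_ne t i with rfl | hne
      · rw [GradedAlgebra.proj_of_mem 𝒜 (GradedAlgebra.proj_mem 𝒜 y _), sub_self]
      · rw [GradedAlgebra.proj_of_mem_ne 𝒜 (GradedAlgebra.proj_mem 𝒜 y _) hne,
          proj_eq_zero_of_mem_irrelevantIdeal_pow 𝒜 t hy i (by omega), sub_zero]
    · rw [sub_sub_sub_cancel_left, ← neg_sub]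
      exact L.neg_mem hxy

theorem IsStandardGraded.length_gradedPiece (h𝒜 : IsStandardGraded 𝒜) {L : Ideal S}
    (hL : L.IsHomogeneous 𝒜) (t : ℕ) :
    Module.length S (GradedPiece (irrelevantIdeal 𝒜) (S ⧸ L) t) =
      Module.length k (gradedComponent 𝒜 L t) := by
  rw [(LinearEquiv.ofBijective _ (h𝒜.toGradedPiece_bijective hL t)).length_eq]
  refine Module.length_eq_of_forall_smul_eq fun s => ?_
  obtain ⟨a, -, ha⟩ := h𝒜.exists_sub_algebraMap_mem s
  refine ⟨a, fun x => ?_⟩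
  rw [← sub_eq_zero, ← algebraMap_smul S a x, ← sub_smul]
  obtain ⟨⟨x, hx⟩, rfl⟩ := Submodule.mkQ_surjective _ x
  rw [← map_smul]
  refine (Submodule.Quotient.mk_eq_zero _).2 ?_
  exact smul_mem_pow_succ_smul ha hx

variable [IsNoetherianRing S]

theorem IsStandardGraded.length_gradedComponent_ne_top [Nontrivial S] (h𝒜 : IsStandardGraded 𝒜)
    {L : Ideal S} (hL : L.IsHomogeneous 𝒜) (t : ℕ) :
    Module.length k (gradedComponent 𝒜 L t) ≠ ⊤ := by
  rw [← h𝒜.length_gradedPiece hL]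
  intro h
  have h1 := Module.length_quotient_pow_succ_smul (irrelevantIdeal 𝒜) (S ⧸ L) t
  rw [h, top_add] at h1
  exact Module.length_quotient_pow_smul_ne_top h𝒜.irrelevantIdeal_isMaximal (S ⧸ L) (t + 1) h1

theorem IsStandardGraded.length_gradedComponent [Nontrivial S] (h𝒜 : IsStandardGraded 𝒜)
    {L : Ideal S} (hL : L.IsHomogeneous 𝒜) (t : ℕ) :
    Module.length k (gradedComponent 𝒜 L t) = hilbertFunction 𝒜 L t := by
  have h := h𝒜.length_gradedComponent_ne_top hL t
  have : IsNoetherian k (gradedComponent 𝒜 L t) :=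
    ((isFiniteLength_iff_isNoetherian_isArtinian (R := k)).1 (Module.length_ne_top_iff.1 h)).1
  exact Module.length_eq_finrank _ _

/-- The Hilbert function is the difference function of the Hilbert–Samuel function of the
irrelevant ideal. -/
theorem IsStandardGraded.hilbertSamuelFunction_succ [Nontrivial S] (h𝒜 : IsStandardGraded 𝒜)
    {L : Ideal S} (hL : L.IsHomogeneous 𝒜) (t : ℕ) :
    hilbertSamuelFunction (irrelevantIdeal 𝒜) (S ⧸ L) (t + 1) =
      hilbertFunction 𝒜 L t + hilbertSamuelFunction (irrelevantIdeal 𝒜) (S ⧸ L) t := by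
  have h := Module.length_quotient_pow_succ_smul (irrelevantIdeal 𝒜) (S ⧸ L) t
  rw [h𝒜.length_gradedPiece hL, h𝒜.length_gradedComponent hL] at h
  rw [hilbertSamuelFunction, h, ENat.toNat_add (ENat.natCast_ne_top _)
    (Module.length_quotient_pow_smul_ne_top h𝒜.irrelevantIdeal_isMaximal (S ⧸ L) t),
    ENat.toNat_natCast, hilbertSamuelFunction]

theorem IsStandardGraded.hilbertSamuelFunction_eq_sum [Nontrivial S] (h𝒜 : IsStandardGraded 𝒜)
    {L : Ideal S} (hL : L.IsHomogeneous 𝒜) (t : ℕ) :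
    hilbertSamuelFunction (irrelevantIdeal 𝒜) (S ⧸ L) t =
      ∑ i : Fin t, hilbertFunction 𝒜 L i := by
  induction t with
  | zero => simpa using hilbertSamuelFunction_zero _
  | succ t ih =>
    rw [h𝒜.hilbertSamuelFunction_succ hL, ih, Fin.sum_univ_castSucc, add_comm]
    rfl

/-- If the elements of degree less than `N` generate `(S ⧸ L) ⧸ Q` as a `k`-vector space, the
dimension of the latter is at most the value of the Hilbert–Samuel function at `N`. -/
theorem IsStandardGraded.length_quotient_le [Nontrivial S] (h𝒜 : IsStandardGraded 𝒜)
    {L : Ideal S} (hL : L.IsHomogeneous 𝒜) (Q : Submodule S (S ⧸ L)) (N : ℕ)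
    (h : ∀ x : S, ∃ v ∈ degreeLT 𝒜 N, Ideal.Quotient.mk L (x - v) ∈ Q) :
    Module.length k ((S ⧸ L) ⧸ Q) ≤
      hilbertSamuelFunction (irrelevantIdeal 𝒜) (S ⧸ L) N := by
  let f : (∀ i : Fin N, gradedComponent 𝒜 L i) →ₗ[k] (S ⧸ L) ⧸ Q :=
    (Q.mkQ.restrictScalars k).comp
      (∑ i : Fin N, (Submodule.subtype _).comp (LinearMap.proj i))
  have hf : Function.Surjective f := by
    intro z
    obtain ⟨z, rfl⟩ := Submodule.mkQ_surjective _ z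
    obtain ⟨x, rfl⟩ := Ideal.Quotient.mk_surjective z
    obtain ⟨v, hv, hxv⟩ := h x
    refine ⟨fun i => ⟨Ideal.Quotient.mk L (proj 𝒜 i v), _, GradedAlgebra.proj_mem 𝒜 v i, rfl⟩, ?_⟩
    have h1 : f (fun i => ⟨Ideal.Quotient.mk L (proj 𝒜 i v), _, GradedAlgebra.proj_mem 𝒜 v i, rfl⟩)
        = Q.mkQ (Ideal.Quotient.mk L v) := by
      conv_rhs => rw [← GradedAlgebra.sum_proj_of_mem_degreeLT 𝒜 hv, Finset.sum_range, map_sum]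
      simp [f]
    rw [h1]
    refine (Submodule.Quotient.eq Q).2 ?_
    rw [← map_sub, ← neg_sub, map_neg]
    exact Q.neg_mem hxv
  refine (Module.length_le_of_surjective f hf).trans ?_
  rw [Module.length_pi_of_fintype, h𝒜.hilbertSamuelFunction_eq_sum hL, Nat.cast_sum]
  exact (Finset.sum_congr rfl fun (i : Fin N) _ => h𝒜.length_gradedComponent hL i).le

end HilbertFunction

/-! ### The dimension of a standard graded algebra -/

section GradedDimension

open GradedAlgebra

theorem exists_ltSeries_last_isMaximal {S : Type*} [CommRing S]
    (l : LTSeries (PrimeSpectrum S)) :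
    ∃ l' : LTSeries (PrimeSpectrum S), l'.head = l.head ∧ l'.last.asIdeal.IsMaximal ∧
      l.length ≤ l'.length := by
  by_cases h : l.last.asIdeal.IsMaximal
  · exact ⟨l, rfl, h, le_rfl⟩
  · obtain ⟨𝔫, h𝔫, hle⟩ := Ideal.exists_le_maximal _ l.last.isPrime.ne_top
    have hlt : l.last < ⟨𝔫, h𝔫.isPrime⟩ := lt_of_le_of_ne hle fun heq => h (by rw [heq]; exact h𝔫)
    exact ⟨l.snoc _ hlt, by simp, by simpa using h𝔫, by simp⟩

variable {k S : Type*} [Field k] [CommRing S] [Algebra k S] {𝒜 : ℕ → Submodule k S}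
  [GradedAlgebra 𝒜] [IsNoetherianRing S]

theorem IsStandardGraded.finiteType [Nontrivial S] (h𝒜 : IsStandardGraded 𝒜) :
    Algebra.FiniteType k S := by
  have h := h𝒜.length_gradedComponent_ne_top (Ideal.IsHomogeneous.bot 𝒜) 1
  have h1 : IsNoetherian k (gradedComponent 𝒜 (⊥ : Ideal S) 1) :=
    ((isFiniteLength_iff_isNoetherian_isArtinian (R := k)).1 (Module.length_ne_top_iff.1 h)).1
  have h2 : (gradedComponent 𝒜 (⊥ : Ideal S) 1).FG := (Submodule.fg_top _).1 (h1.noetherian ⊤)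
  have h3 : (𝒜 1).FG := by
    refine Submodule.fg_of_fg_map_injective _ ?_ h2
    intro x y hxy
    have := (Ideal.Quotient.mk_eq_mk_iff_sub_mem x y).1 hxy
    rwa [Ideal.mem_bot, sub_eq_zero] at this
  obtain ⟨s, hs⟩ := h3
  refine ⟨⟨s, ?_⟩⟩
  rw [← Algebra.adjoin_span, hs, h𝒜.adjoin_eq]

/-- For a maximal ideal `𝔫`, the ring `S` is spanned modulo `𝔫 ^ t` by its elements of degree
less than a linear function of `t`. -/
theorem IsStandardGraded.exists_degreeLT_add_pow [Nontrivial S] (h𝒜 : IsStandardGraded 𝒜)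
    {𝔫 : Ideal S} (h𝔫 : 𝔫.IsMaximal) :
    ∃ D s : ℕ, ∀ (t : ℕ) (x : S), ∃ v ∈ degreeLT 𝒜 (D * t + s), x - v ∈ 𝔫 ^ t := by
  classical
  have hft := h𝒜.finiteType
  -- by the Nullstellensatz, `S ⧸ 𝔫` is spanned by the elements of bounded degree
  obtain ⟨s, hs⟩ : ∃ s : ℕ, ∀ x : S, ∃ v ∈ degreeLT 𝒜 s, x - v ∈ 𝔫 := by
    let _ : Field (S ⧸ 𝔫) := Ideal.Quotient.field 𝔫
    have hfin : Module.Finite k (S ⧸ 𝔫) := finite_of_finite_type_of_isJacobsonRing k (S ⧸ 𝔫)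
    obtain ⟨G, hG⟩ := hfin.fg_top
    choose σ hσ using Ideal.Quotient.mk_surjective (I := 𝔫)
    obtain ⟨s, hs⟩ := exists_subset_degreeLT 𝒜 (G.finite_toSet.image σ)
    refine ⟨s, fun x => ?_⟩
    have h1 : (⊤ : Submodule k (S ⧸ 𝔫)) ≤
        (degreeLT 𝒜 s).map (Ideal.Quotient.mkₐ k 𝔫).toLinearMap := by
      rw [← hG, Submodule.span_le]
      intro g hg
      exact ⟨σ g, hs ⟨g, hg, rfl⟩, hσ g⟩
    obtain ⟨v, hv, hvx⟩ := h1 (Submodule.mem_top (x := Ideal.Quotient.mk 𝔫 x))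
    refine ⟨v, hv, (Ideal.Quotient.mk_eq_mk_iff_sub_mem x v).1 hvx.symm⟩
  obtain ⟨G, hG⟩ := IsNoetherian.noetherian 𝔫
  obtain ⟨D, hD⟩ := exists_subset_degreeLT 𝒜 G.finite_toSet
  have hspan : ∀ t : ℕ,
      Ideal.span ((degreeLT 𝒜 (D * t + 1) : Set S) ∩ (𝔫 ^ t : Ideal S)) = 𝔫 ^ t := by
    intro t
    refine le_antisymm (Ideal.span_le.2 Set.inter_subset_right) ?_
    induction t with
    | zero =>
      have h1 : (1 : S) ∈ degreeLT 𝒜 (D * 0 + 1) := (mem_degreeLT 𝒜).2 fun i hi =>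
        GradedAlgebra.proj_of_mem_ne 𝒜 SetLike.GradedOne.one_mem (by omega)
      have h2 : (1 : S) ∈ Ideal.span
          ((degreeLT 𝒜 (D * 0 + 1) : Set S) ∩ (𝔫 ^ 0 : Ideal S)) :=
        Ideal.subset_span ⟨h1, by simp⟩
      exact le_top.trans ((Ideal.eq_top_iff_one _).2 h2).ge
    | succ t ih =>
      rw [pow_succ]
      refine (Ideal.mul_mono ih hG.ge).trans ?_
      rw [Submodule.span_mul_span]
      refine Ideal.span_mono ?_
      rintro _ ⟨a, ha, b, hb, rfl⟩
      refine ⟨?_, Ideal.mul_mem_mul ha.2 (hG ▸ Submodule.subset_span hb)⟩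
      exact degreeLT_mono 𝒜 (by rw [mul_add]; omega) (mul_mem_degreeLT 𝒜 ha.1 (hD hb))
  refine ⟨D, s + 1, fun t => ?_⟩
  induction t with
  | zero => exact fun x => ⟨0, Submodule.zero_mem _, by simp⟩
  | succ t ih =>
    intro x
    have key : ∀ y ∈ 𝔫 ^ t, ∃ v ∈ degreeLT 𝒜 (D * t + (s + 1)), y - v ∈ 𝔫 ^ (t + 1) := by
      intro y hy
      rw [← hspan t] at hy
      induction hy using Submodule.closure_induction with
      | zero => exact ⟨0, Submodule.zero_mem _, by simp⟩
      | add a b _ _ ha hb =>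
        obtain ⟨v, hv, hav⟩ := ha
        obtain ⟨w, hw, hbw⟩ := hb
        refine ⟨v + w, Submodule.add_mem _ hv hw, ?_⟩
        rw [add_sub_add_comm]
        exact Submodule.add_mem _ hav hbw
      | smul_mem r g hg =>
        obtain ⟨w, hw, hrw⟩ := hs r
        refine ⟨g * w, degreeLT_mono 𝒜 (by omega) (mul_mem_degreeLT 𝒜 hg.1 hw), ?_⟩
        rw [smul_eq_mul, mul_comm r g, ← mul_sub, pow_succ]
        exact Ideal.mul_mem_mul hg.2 hrw
    obtain ⟨v, hv, hxv⟩ := ih x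
    obtain ⟨w, hw, hyw⟩ := key _ hxv
    have hle : D * t + (s + 1) ≤ D * (t + 1) + (s + 1) := by rw [mul_add]; omega
    refine ⟨v + w, degreeLT_mono 𝒜 hle (Submodule.add_mem _ hv hw), ?_⟩
    rwa [← sub_sub]

/-- A bound on the growth of the Hilbert–Samuel function at the irrelevant ideal gives
the same bound at every other maximal ideal. -/
theorem IsStandardGraded.hilbertSamuelBounded [Nontrivial S] (h𝒜 : IsStandardGraded 𝒜)
    {L : Ideal S} (hL : L.IsHomogeneous 𝒜) {d : ℕ}
    (h : HilbertSamuelBounded (irrelevantIdeal 𝒜) (S ⧸ L) d) {𝔫 : Ideal S} (h𝔫 : 𝔫.IsMaximal) :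
    HilbertSamuelBounded 𝔫 (S ⧸ L) d := by
  obtain ⟨D, s, hDs⟩ := h𝒜.exists_degreeLT_add_pow h𝔫
  obtain ⟨C, hC⟩ := h
  refine ⟨C * (D + s + 1) ^ d, fun t => ?_⟩
  have h1 : Module.length S ((S ⧸ L) ⧸ (𝔫 ^ t • ⊤ : Submodule S (S ⧸ L))) ≤
      hilbertSamuelFunction (irrelevantIdeal 𝒜) (S ⧸ L) (D * t + s) := by
    refine (Module.length_le_length_of_isScalarTower (k := k)).trans
      (h𝒜.length_quotient_le hL _ _ fun x => ?_)
    obtain ⟨v, hv, hxv⟩ := hDs t x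
    exact ⟨v, hv, (Ideal.mk_mem_smul_top_iff _ _ _).2
      ⟨_, hxv, by rw [sub_self]; exact L.zero_mem⟩⟩
  have h2 := (ENat.toNat_le_of_le_natCast h1).trans (hC _)
  refine h2.trans ?_
  rw [mul_assoc, ← mul_pow]
  refine Nat.mul_le_mul_left _ (Nat.pow_le_pow_left ?_ d)
  nlinarith [Nat.zero_le (D * 1), Nat.zero_le (s * t)]

/-- Chains of primes above a homogeneous ideal `L` are no longer than the difference of the
heights of the irrelevant ideal and of `L`. -/
theorem IsStandardGraded.length_le_of_height_le [Nontrivial S] (h𝒜 : IsStandardGraded 𝒜)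
    {L : Ideal S} (hL : L.IsHomogeneous 𝒜) {c d : ℕ} (hLc : L.height = c)
    (hd : (irrelevantIdeal 𝒜).height = d + c) (l : LTSeries (PrimeSpectrum S))
    (hl : L ≤ l.head.asIdeal) : l.length ≤ d := by
  obtain ⟨l', hhead, hlast, hlen⟩ := exists_ltSeries_last_isMaximal l
  have hl' : L ≤ l'.head.asIdeal := by rwa [hhead]
  have hprime := l'.head.isPrime
  obtain ⟨p, hp, hple⟩ := Ideal.exists_minimalPrimes_le hl'
  have hphom := hL.of_mem_minimalPrimes hp
  have hpp : p.IsPrime := hp.1.1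
  have hb : HilbertSamuelBounded (irrelevantIdeal 𝒜) (S ⧸ p) d := by
    refine HilbertSamuelBounded.quotient_prime h𝒜.irrelevantIdeal_isMaximal d p hpp
      (h𝒜.le_irrelevantIdeal hphom hpp.ne_top) ?_
    rw [hd, ← hLc, add_comm]
    exact add_le_add (Ideal.height_mono hp.1.2) le_rfl
  have hb' := h𝒜.hilbertSamuelBounded hphom hb hlast
  exact hlen.trans (length_le_of_hilbertSamuelBounded hlast _ d l' rfl rfl
    (hb'.of_surjective hlast (g := Submodule.factor hple) (Submodule.factor_surjective hple)))

end GradedDimension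

/-! ### The graded case -/

section GradedCase

open GradedAlgebra

/-- The leading coefficient of the difference of a polynomial of degree at most `d + 1`. -/
theorem Polynomial.coeff_taylor_one_sub {P : Polynomial ℝ} {d : ℕ} (h : P.natDegree ≤ d + 1) :
    (P.taylor 1 - P).coeff d = (d + 1 : ℝ) * P.coeff (d + 1) := by
  have h1 : (P.hasseDeriv d).natDegree < 2 := by
    have := Polynomial.natDegree_hasseDeriv_le P d
    omega
  rw [Polynomial.coeff_sub, Polynomial.taylor_coeff, Polynomial.eval_eq_sum_range' h1]
  simp [Finset.sum_range_succ, Polynomial.hasseDeriv_coeff, add_comm 1 d]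

variable {k S : Type*} [Field k] [CommRing S] [Algebra k S] {𝒜 : ℕ → Submodule k S}
  [GradedAlgebra 𝒜]

theorem IsStandardGraded.irrelevantIdeal_le_radical [Nontrivial S] (h𝒜 : IsStandardGraded 𝒜)
    {L : Ideal S} (hL : L.IsHomogeneous 𝒜)
    (h : ∀ l : LTSeries (PrimeSpectrum S), L ≤ l.head.asIdeal → l.length ≤ 0) :
    irrelevantIdeal 𝒜 ≤ L.radical := by
  rw [Ideal.radical_eq_sInf, le_sInf_iff]
  rintro q ⟨hLq, hq⟩
  obtain ⟨p, hp, hpq⟩ := Ideal.exists_minimalPrimes_le hLq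
  have hpp : p.IsPrime := hp.1.1
  have h𝔪 := h𝒜.irrelevantIdeal_isMaximal
  have hle := h𝒜.le_irrelevantIdeal (hL.of_mem_minimalPrimes hp) hpp.ne_top
  have heq : p = irrelevantIdeal 𝒜 := by
    by_contra hne
    have hlt : (⟨p, hpp⟩ : PrimeSpectrum S) < ⟨irrelevantIdeal 𝒜, h𝔪.isPrime⟩ :=
      lt_of_le_of_ne hle fun heq => hne (congrArg PrimeSpectrum.asIdeal heq)
    have := h ((RelSeries.singleton _ (⟨p, hpp⟩ : PrimeSpectrum S)).snoc _ hlt)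
      (by simpa using hp.1.2)
    simp at this
  rwa [heq] at hpq

variable [IsNoetherianRing S]

theorem IsStandardGraded.tendsto_hilbertFunction [Nontrivial S] (h𝒜 : IsStandardGraded 𝒜)
    {L : Ideal S} (hL : L.IsHomogeneous 𝒜) {d : ℕ} {e : ℝ}
    (h : HasNormalizedMultiplicity (irrelevantIdeal 𝒜) (d + 1) (S ⧸ L) e) :
    Tendsto (fun t : ℕ => (hilbertFunction 𝒜 L t : ℝ) / (t : ℝ) ^ d) atTop
      (𝓝 ((d + 1) * e)) := by
  have h𝔪 := h𝒜.irrelevantIdeal_isMaximal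
  obtain ⟨P, hP⟩ := exists_polynomial_hilbertSamuelFunction h𝔪 (S ⧸ L)
  obtain ⟨B, hB⟩ := h.bddAbove_range
  have hB0 : 0 ≤ B := le_trans (by positivity) (hB ⟨0, rfl⟩)
  have hdeg : P.natDegree ≤ d + 1 := by
    refine Polynomial.natDegree_le_of_eventually_le (C := B) hP fun t => ?_
    rw [abs_of_nonneg (Nat.cast_nonneg _)]
    rcases Nat.eq_zero_or_pos t with rfl | ht
    · rw [hilbertSamuelFunction_zero, Nat.cast_zero]
      positivity
    · have h1 := hB ⟨t, rfl⟩
      have h2 : (0 : ℝ) < (t : ℝ) ^ (d + 1) := by positivity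
      rw [div_le_iff₀ h2] at h1
      refine h1.trans (mul_le_mul_of_nonneg_left ?_ hB0)
      gcongr
      linarith
  have hcoeff : P.coeff (d + 1) = e := by
    refine tendsto_nhds_unique (Polynomial.tendsto_eval_div_pow hdeg) (h.congr' ?_)
    filter_upwards [hP] with t ht
    rw [ht]
  have hdeg' : (P.taylor 1 - P).natDegree ≤ d := by
    have := Polynomial.natDegree_sub_comp_X_sub_C_le hdeg (-1)
    rw [← neg_sub, Polynomial.natDegree_neg]
    simpa [Polynomial.taylor_apply] using this
  have hlim := Polynomial.tendsto_eval_div_pow hdeg'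
  rw [Polynomial.coeff_taylor_one_sub hdeg, hcoeff] at hlim
  refine hlim.congr' ?_
  filter_upwards [hP, (tendsto_add_atTop_nat 1).eventually hP] with t h1 h2
  rw [h𝒜.hilbertSamuelFunction_succ hL, Nat.cast_add, h1] at h2
  rw [Polynomial.eval_sub, Polynomial.taylor_eval, eq_sub_of_add_eq h2]
  push_cast
  rw [add_comm]

/-- In dimension zero the Hilbert–Samuel function is eventually the vector space dimension. -/
theorem IsStandardGraded.finrank_quotient_eq [Nontrivial S] (h𝒜 : IsStandardGraded 𝒜)
    {L : Ideal S} (hL : L.IsHomogeneous 𝒜) {N : ℕ} (hN : irrelevantIdeal 𝒜 ^ N ≤ L) :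
    Module.finrank k (S ⧸ L) = hilbertSamuelFunction (irrelevantIdeal 𝒜) (S ⧸ L) N := by
  have hbot : (irrelevantIdeal 𝒜 ^ N • ⊤ : Submodule S (S ⧸ L)) = ⊥ := by
    rw [eq_bot_iff]
    intro z hz
    obtain ⟨x, rfl⟩ := Ideal.Quotient.mk_surjective z
    obtain ⟨y, hy, hxy⟩ := (Ideal.mk_mem_smul_top_iff _ _ _).1 hz
    refine Ideal.Quotient.eq_zero_iff_mem.2 ?_
    simpa using L.add_mem hxy (hN hy)
  have hχ : hilbertSamuelFunction (irrelevantIdeal 𝒜) (S ⧸ L) N =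
      (Module.length S (S ⧸ L)).toNat := by
    rw [hilbertSamuelFunction, (Submodule.quotEquivOfEqBot _ hbot).length_eq]
  have h1 : Module.length k (S ⧸ L) ≤
      hilbertSamuelFunction (irrelevantIdeal 𝒜) (S ⧸ L) N := by
    rw [← ((Submodule.quotEquivOfEqBot _ hbot).restrictScalars k).length_eq]
    refine h𝒜.length_quotient_le hL _ N fun x => ?_
    refine ⟨∑ i ∈ Finset.range N, proj 𝒜 i x, Submodule.sum_mem _ fun i hi => ?_, ?_⟩
    · refine (mem_degreeLT 𝒜).2 fun j hj => ?_
      exact GradedAlgebra.proj_of_mem_ne 𝒜 (GradedAlgebra.proj_mem 𝒜 x i)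
        (by have := Finset.mem_range.1 hi; omega)
    · refine (Ideal.mk_mem_smul_top_iff _ _ _).2 ⟨_, ?_, by rw [sub_self]; exact L.zero_mem⟩
      rw [h𝒜.mem_irrelevantIdeal_pow]
      intro j hj
      rw [map_sub, map_sum, Finset.sum_eq_single_of_mem j (Finset.mem_range.2 hj)
        fun i _ hij => GradedAlgebra.proj_of_mem_ne 𝒜 (GradedAlgebra.proj_mem 𝒜 x i) hij,
        GradedAlgebra.proj_of_mem 𝒜 (GradedAlgebra.proj_mem 𝒜 x j), sub_self]
  have hne : Module.length k (S ⧸ L) ≠ ⊤ := ne_top_of_le_ne_top (ENat.natCast_ne_top _) h1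
  have hnoeth : IsNoetherian k (S ⧸ L) :=
    ((isFiniteLength_iff_isNoetherian_isArtinian (R := k)).1 (Module.length_ne_top_iff.1 hne)).1
  have h2 : Module.length S (S ⧸ L) ≤ Module.length k (S ⧸ L) :=
    Module.length_le_length_of_isScalarTower
  rw [Module.length_eq_finrank] at h1 h2
  refine le_antisymm (by exact_mod_cast h1) ?_
  rw [hχ]
  exact ENat.toNat_le_of_le_natCast h2

theorem IsStandardGraded.gradedMultiplicity_eq [Nontrivial S] (h𝒜 : IsStandardGraded 𝒜)
    {L : Ideal S} (hL : L.IsHomogeneous 𝒜) {d : ℕ} {e : ℝ}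
    (h : HasNormalizedMultiplicity (irrelevantIdeal 𝒜) d (S ⧸ L) e)
    (hd : natKrullDim (S ⧸ L) = d)
    (hle : ∀ l : LTSeries (PrimeSpectrum S), L ≤ l.head.asIdeal → l.length ≤ d) :
    gradedMultiplicity 𝒜 L = d.factorial * e := by
  rw [gradedMultiplicity, hd]
  rcases d with _ | d
  · rw [if_pos rfl, Nat.factorial_zero, Nat.cast_one, one_mul]
    obtain ⟨N, hN⟩ := Ideal.exists_pow_le_of_le_radical_of_fg
      (h𝒜.irrelevantIdeal_le_radical hL hle) (IsNoetherian.noetherian (irrelevantIdeal 𝒜))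
    refine tendsto_nhds_unique (tendsto_const_nhds.congr' ?_) h
    filter_upwards [eventually_ge_atTop N] with t ht
    rw [h𝒜.finrank_quotient_eq hL ((Ideal.pow_le_pow_right ht).trans hN), pow_zero, div_one]
  · rw [if_neg (Nat.succ_ne_zero d), Nat.add_sub_cancel]
    refine Tendsto.limUnder_eq (f := atTop) ?_
    have hlim := (h𝒜.tendsto_hilbertFunction hL h).const_mul (d.factorial : ℝ)
    rw [Nat.factorial_succ, Nat.cast_mul, mul_comm ((d + 1 : ℕ) : ℝ), mul_assoc]
    push_cast
    refine hlim.congr fun t => ?_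
    ring

theorem symbolicPower_eq_unmixedPart_iff_gradedMultiplicity
    (h𝒜 : IsStandardGraded 𝒜) (hS : IsCohenMacaulayRing S) {I J : Ideal S}
    (hIh : I.IsHomogeneous 𝒜) (hJh : J.IsHomogeneous 𝒜) {m c : ℕ} (hm : 1 ≤ m)
    (hI : IsUnmixedIdeal I) (hCI : IsGenericallyCI I) (hIc : I.height = c)
    (hJ : J ≤ symbolicPower I m) (hJc : J.height = c) :
    symbolicPower I m = unmixedPart J ↔
      gradedMultiplicity 𝒜 J = gradedMultiplicity 𝒜 I * ((c + m - 1).choose c : ℝ) := by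
  have hJtop : J ≠ ⊤ := fun h => by
    rw [h, Ideal.height_top] at hJc
    exact ENat.top_ne_natCast _ hJc
  have : Nontrivial S := by
    by_contra hS'
    rw [not_nontrivial_iff_subsingleton] at hS'
    exact hJtop (Subsingleton.elim _ _)
  have h𝔪 := h𝒜.irrelevantIdeal_isMaximal
  have hle : ∀ L : Ideal S, L.IsHomogeneous 𝒜 → ∀ p ∈ L.minimalPrimes,
      p ≤ irrelevantIdeal 𝒜 := fun L hL p hp =>
    h𝒜.le_irrelevantIdeal (hL.of_mem_minimalPrimes hp) hp.1.1.ne_top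
  obtain ⟨d, hd⟩ := exists_height_eq_add h𝔪 (h𝒜.le_irrelevantIdeal hJh hJtop) hJc
  have hdim : ∀ L : Ideal S, L.IsHomogeneous 𝒜 → L.height = c → natKrullDim (S ⧸ L) = d :=
    fun L hL hLc => by
      obtain ⟨l, hl, hld⟩ := hS.exists_ltSeries_le h𝔪 hLc (hle L hL) hd
      exact natKrullDim_quotient_eq (h𝒜.length_le_of_height_le hL hLc hd) l hl hld
  obtain ⟨eI, eJ, hmI, hmJ, h⟩ := symbolicPower_eq_unmixedPart_iff_multiplicity hS h𝔪 hm hI hCI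
    hIc hJ hJc (hle J hJh) hd
  rw [h, h𝒜.gradedMultiplicity_eq hIh hmI (hdim I hIh hIc)
      (h𝒜.length_le_of_height_le hIh hIc hd),
    h𝒜.gradedMultiplicity_eq hJh hmJ (hdim J hJh hJc) (h𝒜.length_le_of_height_le hJh hJc hd),
    mul_assoc, mul_right_inj' (by exact_mod_cast d.factorial_ne_zero)]

end GradedCase

end

theorem theorem3p2 {S : Type*} [CommRing S] (hS : IsCohenMacaulayRing S)
    (I J : Ideal S) (m c : ℕ) (hm : 1 ≤ m)
    (hI : IsUnmixedIdeal I) (hCI : IsGenericallyCI I) (hIc : I.height = c)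
    (hJ : J ≤ symbolicPower I m) (hJc : J.height = c) :
    (∀ [IsLocalRing S],
      symbolicPower I m = unmixedPart J ↔
        localMultiplicity J = localMultiplicity I * ((c + m - 1).choose c : ℝ)) ∧
    (∀ {k : Type*} [Field k] [Algebra k S] (𝒜 : ℕ → Submodule k S) [GradedAlgebra 𝒜],
      IsStandardGraded 𝒜 → I.IsHomogeneous 𝒜 → J.IsHomogeneous 𝒜 →
        (symbolicPower I m = unmixedPart J ↔
          gradedMultiplicity 𝒜 J = gradedMultiplicity 𝒜 I * ((c + m - 1).choose c : ℝ))) := by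
  have := hS.isNoetherianRing
  exact ⟨symbolicPower_eq_unmixedPart_iff_localMultiplicity hS hm hI hCI hIc hJ hJc,
    fun 𝒜 _ h𝒜 hIh hJh => symbolicPower_eq_unmixedPart_iff_gradedMultiplicity h𝒜 hS hIh hJh hm
      hI hCI hIc hJ hJc⟩
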